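/- Let $(M,\omega)$ be a compact connected symplectic manifold of real dimension $4$ with an effective Hamiltonian action of the torus $\mathbb T=(S^1)^2$, with moment map $\mu:M\to\mathfrak t^*$; thus $\mu$ is smooth and $\mathbb T$-invariant, and $\omega(\xi^\sharp,\cdot)=-d\langle\mu,\xi\rangle$ for all $\xi\in\mathfrak t=\mathrm{Lie}(\mathbb T)$, where $\xi^\sharp$ is the infinitesimal action of $\xi$. Let $\Delta=\mu(M)$ be the moment polytope, $\mathring\Delta$ its interior, and $\mathring M=\mu^{-1}(\mathring\Delta)$. For an endomorphism field $J$ of $TM$ let $J^{*_\omega}$ be its symplectic adjoint, $\omega(J\cdot,\cdot)=\omega(\cdot,J^{*_\omega}\cdot)$. Let $GK^{\mathbb T}_\omega(M)$ be the set of smooth $\mathbb T$-invariant almost complex structures $J$ on $M$ that are $\omega$-tamed ($\omega(v,Jv)>0$ for all $v\neq 0$) and such that $J$ and $J^{*_\omega}$ are both integrable. Let $DGK^{\mathbb T}_\omega(M)$ be the set of those $J\in GK^{\mathbb T}_\omega(M)$ with $J^{*_\omega}\mathcal K=J\mathcal K$ on $\mathring M$, where $\mathcal K$ is the distribution spanned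 by the fields $\xi^\sharp$, $\xi\in\mathfrak t$. Let $K^{\mathbb T}_\omega(M)$ be the set of $\mathbb T$-invariant $\omega$-compatible complex structures on $M$; here $J(x)$ is compatible with $\omega(x)$ if $\omega(x)$ is $J(x)$-invariant and $\omega(v,Jv)>0$ for all nonzero $v\in T_xM$. Then for every $J\in DGK^{\mathbb T}_\omega(M)\setminus K^{\mathbb T}_\omega(M)$, $$M\setminus\mathring M=\{x\in M: J(x)\text{ is compatible with }\omega(x)\}=\{x\in M: J(x)=-J^{*_\omega}(x)\}=\{x\in M: p(x)=-1\},$$ where $p=-\tfrac14\mathrm{tr}(JJ^{*_\omega})$ is the angle function. -/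

import Mathlib

open scoped Manifold ContDiff

noncomputable section

namespace ToricGK

/-- The standard torus `(S¹)ᵐ`.  Its Lie algebra is identified with `ℝᵐ`, the exponential map being
`torusExp`, and the dual of its Lie algebra is identified with `ℝᵐ` through the dual basis. -/
abbrev Torus (m : ℕ) : Type := Fin m → Circle

/-- The exponential map `ℝᵐ → (S¹)ᵐ`, `ξ ↦ (exp (i ξ₁), …, exp (i ξₘ))`. -/
def torusExp {m : ℕ} (ξ : Fin m → ℝ) : Torus m := fun i => Circle.exp (ξ i)

variable {n m : ℕ} {M : Type*} [TopologicalSpace M] [ChartedSpace (EuclideanSpace ℝ (Fin n)) M]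

instance finiteDimensionalTangent (x : M) : FiniteDimensional ℝ (TangentSpace (𝓡 n) x) :=
  inferInstanceAs (FiniteDimensional ℝ (EuclideanSpace ℝ (Fin n)))

instance t2Tangent (x : M) : T2Space (TangentSpace (𝓡 n) x) :=
  inferInstanceAs (T2Space (EuclideanSpace ℝ (Fin n)))

variable (n M) in
/-- (Not necessarily smooth) vector fields. -/
abbrev VField : Type _ := (x : M) → TangentSpace (𝓡 n) x

variable (n M) in
/-- (Not necessarily smooth) fields of endomorphisms of the tangent bundle. -/
abbrev EndField : Type _ := (x : M) → TangentSpace (𝓡 n) x →L[ℝ] TangentSpace (𝓡 n) x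

variable (n M) in
/-- (Not necessarily smooth) fields of bilinear forms on the tangent bundle. -/
abbrev BilinField : Type _ :=
  (x : M) → TangentSpace (𝓡 n) x →L[ℝ] TangentSpace (𝓡 n) x →L[ℝ] ℝ

/-- Smoothness of a vector field, as a section of the tangent bundle. -/
def SmoothVField [IsManifold (𝓡 n) ∞ M] (X : VField n M) : Prop :=
  ContMDiff (𝓡 n) (𝓡 n).tangent ∞
    (fun x => (Bundle.TotalSpace.mk' (EuclideanSpace ℝ (Fin n)) x (X x) : TangentBundle (𝓡 n) M))

/-- Smoothness of a field of endomorphisms, as a section of the bundle `End(TM)`. -/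
def SmoothEndField [IsManifold (𝓡 n) ∞ M] (A : EndField n M) : Prop :=
  ContMDiff (𝓡 n)
    ((𝓡 n).prod 𝓘(ℝ, EuclideanSpace ℝ (Fin n) →L[ℝ] EuclideanSpace ℝ (Fin n))) ∞
    (fun x => Bundle.TotalSpace.mk' (EuclideanSpace ℝ (Fin n) →L[ℝ] EuclideanSpace ℝ (Fin n))
      (E := fun y : M => TangentSpace (𝓡 n) y →L[ℝ] TangentSpace (𝓡 n) y) x (A x))

/-- Smoothness of a field of bilinear forms, as a section of the bundle `T*M ⊗ T*M`. -/
def SmoothBilinField [IsManifold (𝓡 n) ∞ M] (β : BilinField n M) : Prop :=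
  ContMDiff (𝓡 n)
    ((𝓡 n).prod 𝓘(ℝ, EuclideanSpace ℝ (Fin n) →L[ℝ] EuclideanSpace ℝ (Fin n) →L[ℝ] ℝ)) ∞
    (fun x => Bundle.TotalSpace.mk'
      (EuclideanSpace ℝ (Fin n) →L[ℝ] EuclideanSpace ℝ (Fin n) →L[ℝ] ℝ)
      (E := fun y : M => TangentSpace (𝓡 n) y →L[ℝ] TangentSpace (𝓡 n) y →L[ℝ] ℝ) x (β x))

/-- Lie bracket of vector fields. -/
abbrev bracket (X Y : VField n M) : VField n M := VectorField.mlieBracket (𝓡 n) X Y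

/-- The derivative `X · f` of a function `f` along a vector field `X`. -/
def deriveAlong (X : VField n M) (f : M → ℝ) (x : M) : ℝ := mvfderiv (𝓡 n) f x (X x)

/-- The exterior derivative of a 2-form `β` evaluated on vector fields, by the invariant formula
`dβ(X,Y,Z) = X β(Y,Z) - Y β(X,Z) + Z β(X,Y) - β([X,Y],Z) + β([X,Z],Y) - β([Y,Z],X)`. -/
def extDerivTwo (β : BilinField n M) (X Y Z : VField n M) (x : M) : ℝ :=
  deriveAlong X (fun y => β y (Y y) (Z y)) x
    - deriveAlong Y (fun y => β y (X y) (Z y)) x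
    + deriveAlong Z (fun y => β y (X y) (Y y)) x
    - β x (bracket X Y x) (Z x) + β x (bracket X Z x) (Y x) - β x (bracket Y Z x) (X x)

variable (n M) in
/-- Symplectic forms: smooth closed nondegenerate 2-forms. -/
structure SymplecticForm [IsManifold (𝓡 n) ∞ M] where
  /-- The underlying field of bilinear forms. -/
  form : BilinField n M
  smooth : SmoothBilinField form
  alternating : ∀ (x : M) (v : TangentSpace (𝓡 n) x), form x v v = 0
  nondegenerate : ∀ (x : M) (v : TangentSpace (𝓡 n) x), (∀ w, form x v w = 0) → v = 0
  closed : ∀ X Y Z : VField n M, SmoothVField X → SmoothVField Y → SmoothVField Z →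
    ∀ x, extDerivTwo form X Y Z x = 0

section Symplectic

variable [IsManifold (𝓡 n) ∞ M] (Ω : SymplecticForm n M)

theorem SymplecticForm.antisymm (x : M) (v w : TangentSpace (𝓡 n) x) :
    Ω.form x v w = - Ω.form x w v := by
  have h := Ω.alternating x (v + w)
  simp only [map_add, add_apply, Ω.alternating] at h
  linarith

/-- The symplectic form at a point, as an algebraic bilinear form. -/
def SymplecticForm.bilin (x : M) : LinearMap.BilinForm ℝ (TangentSpace (𝓡 n) x) :=
  LinearMap.mk₂ ℝ (fun v w => Ω.form x v w) (by simp) (by simp) (by simp) (by simp)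

theorem SymplecticForm.bilin_nondegenerate (x : M) : (Ω.bilin x).Nondegenerate := by
  refine ⟨fun v hv => Ω.nondegenerate x v hv, fun v hv => Ω.nondegenerate x v fun w => ?_⟩
  rw [Ω.antisymm]
  simpa [SymplecticForm.bilin] using hv w

/-- The symplectic adjoint `A^{*ω}` of a field of endomorphisms `A`,
characterized by `ω(A v, w) = ω(v, A^{*ω} w)`. -/
def SymplecticForm.adj (A : EndField n M) : EndField n M := fun x =>
  LinearMap.toContinuousLinearMap
    ((Ω.bilin x).leftAdjointOfNondegenerate (Ω.bilin_nondegenerate x)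
      (A x : TangentSpace (𝓡 n) x →ₗ[ℝ] TangentSpace (𝓡 n) x))

theorem SymplecticForm.form_adj (A : EndField n M) (x : M) (v w : TangentSpace (𝓡 n) x) :
    Ω.form x (A x v) w = Ω.form x v (Ω.adj A x w) := by
  have h : Ω.form x (Ω.adj A x w) v = Ω.form x w (A x v) :=
    (Ω.bilin x).isAdjointPairLeftAdjointOfNondegenerate (Ω.bilin_nondegenerate x)
      (A x : TangentSpace (𝓡 n) x →ₗ[ℝ] TangentSpace (𝓡 n) x) w v
  rw [Ω.antisymm x v, h, Ω.antisymm]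

theorem SymplecticForm.eq_adj (A : EndField n M) (x : M)
    (B : TangentSpace (𝓡 n) x →L[ℝ] TangentSpace (𝓡 n) x)
    (h : ∀ v w, Ω.form x (A x v) w = Ω.form x v (B w)) : B = Ω.adj A x := by
  ext1 w
  refine sub_eq_zero.mp (Ω.nondegenerate x _ fun v => ?_)
  rw [Ω.antisymm, map_sub, ← h, ← Ω.form_adj, sub_self, neg_zero]

end Symplectic

/-- Almost complex structures: smooth fields of endomorphisms with `J² = -Id`. -/
structure IsAlmostComplex [IsManifold (𝓡 n) ∞ M] (J : EndField n M) : Prop where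
  smooth : SmoothEndField J
  sq : ∀ (x : M) (v : TangentSpace (𝓡 n) x), J x (J x v) = -v

/-- The Nijenhuis expression `[JX,JY] - J[JX,Y] - J[X,JY] - [X,Y]`. -/
def nijenhuis (J : EndField n M) (X Y : VField n M) : VField n M := fun x =>
  bracket (fun y => J y (X y)) (fun y => J y (Y y)) x
    - J x (bracket (fun y => J y (X y)) Y x)
    - J x (bracket X (fun y => J y (Y y)) x)
    - bracket X Y x

/-- Integrability of an almost complex structure: its Nijenhuis tensor vanishes. -/
def Integrable [IsManifold (𝓡 n) ∞ M] (J : EndField n M) : Prop :=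
  ∀ X Y : VField n M, SmoothVField X → SmoothVField Y → ∀ x, nijenhuis J X Y x = 0

section Forms

variable [IsManifold (𝓡 n) ∞ M] (Ω : SymplecticForm n M)

/-- `J` is `ω`-tamed: the bilinear form `ω(·, J·)` is positive definite (possibly not symmetric). -/
def IsTamed (J : EndField n M) : Prop :=
  ∀ (x : M) (v : TangentSpace (𝓡 n) x), v ≠ 0 → 0 < Ω.form x v (J x v)

/-- `J(x)` is compatible with `ω(x)`: it preserves `ω(x)`, and `ω(·, J·)` is positive definite
at `x`. -/
def IsCompatibleAt (J : EndField n M) (x : M) : Prop :=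
  (∀ v w : TangentSpace (𝓡 n) x, Ω.form x (J x v) (J x w) = Ω.form x v w) ∧
    ∀ v : TangentSpace (𝓡 n) x, v ≠ 0 → 0 < Ω.form x v (J x v)

/-- The angle function `p = -¼ tr (J J^{*ω})`. -/
def angle (J : EndField n M) (x : M) : ℝ :=
  -(1 / 4) * LinearMap.trace ℝ (TangentSpace (𝓡 n) x)
    ((J x ∘L Ω.adj J x : TangentSpace (𝓡 n) x →L[ℝ] TangentSpace (𝓡 n) x) :
      TangentSpace (𝓡 n) x →ₗ[ℝ] TangentSpace (𝓡 n) x)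

end Forms

section Action

variable [MulAction (Torus m) M]

/-- The infinitesimal action `ξ^♯` of `ξ ∈ 𝔱 = ℝᵐ`: its value at `x` is the velocity at `s = 0` of
`s ↦ exp(s ξ) • x`. -/
def infAction (ξ : Fin m → ℝ) : VField n M := fun x =>
  (mfderiv 𝓘(ℝ, ℝ) (𝓡 n) (fun s : ℝ => torusExp (s • ξ) • x) 0 (1 : ℝ) : EuclideanSpace ℝ (Fin n))

variable (m) in
/-- The subspace `𝒦` of the tangent space spanned by the infinitesimal actions,
i.e. the tangent space to the orbit. -/
def orbitDist (x : M) : Submodule ℝ (TangentSpace (𝓡 n) x) :=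
  Submodule.span ℝ (Set.range fun ξ : Fin m → ℝ => (infAction ξ x : TangentSpace (𝓡 n) x))

variable (m) in
/-- A field of endomorphisms is torus-invariant if it commutes with the differential of the
action of each element of the torus. -/
def InvariantEnd (A : EndField n M) : Prop :=
  ∀ (t : Torus m) (x : M) (v : TangentSpace (𝓡 n) x),
    mfderiv (𝓡 n) (𝓡 n) (fun y : M => t • y) x (A x v)
      = A (t • x) (mfderiv (𝓡 n) (𝓡 n) (fun y : M => t • y) x v)

variable [IsManifold (𝓡 n) ∞ M]

/-- An effective Hamiltonian action of the torus `(S¹)ᵐ` on `(M, ω)` with moment map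
`μ : M → 𝔱* = ℝᵐ`.  Smoothness of the action is expressed on the universal cover `ℝᵐ` of the torus.
The Hamiltonian field of `f` is `-ω⁻¹(df)`. -/
structure IsHamiltonianToric (Ω : SymplecticForm n M) (μ : M → Fin m → ℝ) : Prop where
  smooth_action : ContMDiff (𝓘(ℝ, Fin m → ℝ).prod (𝓡 n)) (𝓡 n) ∞
    (fun q : (Fin m → ℝ) × M => torusExp q.1 • q.2)
  effective : FaithfulSMul (Torus m) M
  symplectic : ∀ (t : Torus m) (x : M) (v w : TangentSpace (𝓡 n) x),
    Ω.form (t • x) (mfderiv (𝓡 n) (𝓡 n) (fun y : M => t • y) x v)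
      (mfderiv (𝓡 n) (𝓡 n) (fun y : M => t • y) x w) = Ω.form x v w
  smooth_moment : ContMDiff (𝓡 n) 𝓘(ℝ, Fin m → ℝ) ∞ μ
  moment_invariant : ∀ (t : Torus m) (x : M), μ (t • x) = μ x
  hamiltonian : ∀ (ξ : Fin m → ℝ) (x : M) (v : TangentSpace (𝓡 n) x),
    Ω.form x (infAction ξ x) v = - mvfderiv (𝓡 n) (fun y => ∑ i, ξ i * μ y i) x v

/-- The set `M° = μ⁻¹(Δ°)`, where `Δ = μ(M)` is the moment polytope. -/
def openPart (μ : M → Fin m → ℝ) : Set M := μ ⁻¹' interior (Set.range μ)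

variable (m) in
/-- `GK_ω^𝕋(M)`: torus-invariant generalized Kähler structures of symplectic type, i.e.
torus-invariant `ω`-tamed almost complex structures `J` with both `J` and `J^{*ω}` integrable. -/
def GK (Ω : SymplecticForm n M) : Set (EndField n M) :=
  {J | IsAlmostComplex J ∧ IsTamed Ω J ∧ InvariantEnd m J ∧ Integrable J ∧ Integrable (Ω.adj J)}

/-- `DGK_ω^𝕋(M)`: the elements `J` of `GK_ω^𝕋(M)` with `J^{*ω} 𝒦 = J 𝒦` on `M°`. -/
def DGK (Ω : SymplecticForm n M) (μ : M → Fin m → ℝ) : Set (EndField n M) :=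
  {J | J ∈ GK m Ω ∧ ∀ x ∈ openPart μ,
    (orbitDist m x).map (Ω.adj J x : TangentSpace (𝓡 n) x →ₗ[ℝ] TangentSpace (𝓡 n) x)
      = (orbitDist m x).map (J x : TangentSpace (𝓡 n) x →ₗ[ℝ] TangentSpace (𝓡 n) x)}

variable (m) in
/-- `K_ω^𝕋(M)`: torus-invariant `ω`-compatible complex structures. -/
def Kahler (Ω : SymplecticForm n M) : Set (EndField n M) :=
  {J | IsAlmostComplex J ∧ (∀ x, IsCompatibleAt Ω J x) ∧ InvariantEnd m J ∧ Integrable J}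

end Action

end ToricGK

end

open scoped Topology RealInnerProductSpace
open Filter Set
set_option linter.unusedSectionVars false

noncomputable section

/-! Write `K₀, K₁` for the generators of the action and `G k j = ω(K k, J (K j))` for the Gram
matrix. Let `R` be the set where the infinitesimal action is injective. The proof shows that `R` is
the open part of `M`. It then shows that the failure of compatibility is a constant multiple of a
2-form vanishing off `R`.

The equality of `R` with the open part replaces the convexity theory of moment maps by the
complexified action. Off `R` some circle subgroup fixes the point. Its linearization is nonzero by
effectiveness and commutes with `J`, so it has rank at least two. Hence the complement of `R` has
Hausdorff codimension at least two in charts, and `R` is dense and connected (`dense_regularSet`,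
`isPreconnected_regularSet`). The fields `ξ^♯ - J η^♯` commute because `J` is integrable and
invariant, they frame `TM` over `R` because `J` is tamed, and they are complete because `M` is
compact. So `R` is a single orbit of a local diffeomorphism action (`IsFrameAction.subset_range`).
Along the `-J η^♯` directions the moment map has derivative with positive definite symmetric part,
again by tameness. It is therefore injective and open, and its range contains the interior of its
closure. This yields both inclusions (`openPart_eq_regularSet`).

For the second half, apply `[J K₀, J K₁] = 0` and `[J^{*ω} K₀, J^{*ω} K₁] = 0` to the moment
components. Since `J^{*ω} 𝒦 = J 𝒦`, the second relation can be rewritten in terms of the fields `J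
K₀, J K₁`. Together the two say that `(G 0 1 - G 1 0) / det G` has zero derivative along them
(`deriv_ratio_eq_zero`). The ratio is torus invariant, so it is a constant `c` on `R`. Expanding in
the frame then gives `ω(·, J·) + ω(J·, ·) = -c (ν₀ ∧ ν₁ - ν₀J ∧ ν₁J)` with `νᵢ = ω(K i, ·)`, first
on `R` and then everywhere by density (`exists_skewPart_eq`). Off `R` the forms `ν₀, ν₁` are
dependent and the right side vanishes. On `R` its value on `(K₀, K₁)` is `c det G`, which is nonzero
unless `c = 0`, and `c = 0` is the Kähler case.

The angle condition is pointwise linear algebra: `p = -1` makes the square of `J + J^{*ω}`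
traceless, and this endomorphism is skew for an inner product, hence zero. -/

namespace ToricGK

/-! ### Calculus in normed spaces: straightening, mixed derivatives, short periodic orbits. -/

section Analysis

variable {E F G : Type*} [NormedAddCommGroup E] [NormedSpace ℝ E] [NormedAddCommGroup F]
  [NormedSpace ℝ F] [NormedAddCommGroup G] [NormedSpace ℝ G]

/-- A frame of commuting vector fields is locally the frame of partial derivatives of a
parametrization. -/
theorem exists_straightening [CompleteSpace E] [CompleteSpace F] (B : E → F →L[ℝ] E) (p : E)
    (hB : ContDiffAt ℝ 1 B p) (hinv : (B p).IsInvertible)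
    (hsymm : ∀ᶠ y in 𝓝 p, ∀ a b : F, fderiv ℝ B y (B y a) b = fderiv ℝ B y (B y b) a) :
    ∃ σ : F → E, σ 0 = p ∧ Filter.map σ (𝓝 0) = 𝓝 p ∧
      ∀ᶠ v in 𝓝 0, HasFDerivAt σ (B (σ v)) v := by
  -- θ is the dual coframe. Differentiating `B θ = id` turns the commutation hypothesis into
  -- closedness of θ, so θ has a primitive `h` on a ball. The parametrization is the local inverse
  -- of `h - h p`.
  set θ : E → E →L[ℝ] F := fun y => (B y).inverse with hθ
  have hinvp : ∀ᶠ y in 𝓝 p, (B y).IsInvertible := by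
    obtain ⟨e, he⟩ := hinv
    have : ∀ᶠ T in 𝓝 (B p), T.IsInvertible := by
      rw [← he]
      filter_upwards [ContinuousLinearEquiv.nhds e] with T hT
      obtain ⟨e', he'⟩ := hT
      exact ⟨e', he'⟩
    exact hB.continuousAt.eventually this
  have hBd : ∀ᶠ y in 𝓝 p, ContDiffAt ℝ 1 B y := hB.eventually (by simp)
  have hθd : ∀ y, (B y).IsInvertible → ContDiffAt ℝ 1 B y → ContDiffAt ℝ 1 θ y := by
    rintro y ⟨e, he⟩ hy
    have h1 : ContDiffAt ℝ 1 (ContinuousLinearMap.inverse : (F →L[ℝ] E) → (E →L[ℝ] F)) (B y) := by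
      rw [← he]
      exact contDiffAt_map_inverse e
    exact h1.comp y hy
  obtain ⟨r, hr, hball⟩ := Metric.eventually_nhds_iff_ball.1
    (hinvp.and (hBd.and (hsymm.and (hinvp.eventually_nhds))))
  have hsym : ∀ a ∈ Metric.ball p r, ∀ x y, fderiv ℝ θ a x y = fderiv ℝ θ a y x := by
    intro y hy u w
    obtain ⟨h1, h2, h3, h4⟩ := hball y hy
    have hdB : DifferentiableAt ℝ B y := h2.differentiableAt (by simp)
    have hdθ : DifferentiableAt ℝ θ y := (hθd y h1 h2).differentiableAt (by simp)
    have key : ∀ w u, B y (fderiv ℝ θ y w u) = - fderiv ℝ B y w (θ y u) := by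
      intro w u
      have e1 : (fun z => B z (θ z u)) =ᶠ[𝓝 y] fun _ => u := by
        filter_upwards [h4] with z hz
        obtain ⟨e, he⟩ := hz
        simp [hθ, ← he]
      have e2 : HasFDerivAt (fun z => θ z u) ((fderiv ℝ θ y).flip u) y := by
        simpa using hdθ.hasFDerivAt.clm_apply (hasFDerivAt_const u y)
      have e3 := (hdB.hasFDerivAt.clm_apply e2).unique
        ((hasFDerivAt_const u y).congr_of_eventuallyEq e1)
      have e4 := congrArg (fun L => L w) e3
      simp at e4
      exact eq_neg_of_add_eq_zero_left e4
    obtain ⟨e, he⟩ := h1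
    have hθy : θ y = e.symm := by simp [hθ, ← he]
    have hinj : Function.Injective (B y) := by rw [← he]; exact e.injective
    apply hinj
    rw [key, key]
    have h5 := h3 (θ y u) (θ y w)
    have h6 : ∀ u, B y (θ y u) = u := fun u => by rw [hθy, ← he]; simp
    rw [h6, h6] at h5
    rw [h5]
  obtain ⟨h, hh⟩ := (convex_ball p r).exists_forall_hasFDerivAt_of_fderiv_symmetric
    Metric.isOpen_ball (fun y hy => ((hθd y (hball y hy).1 (hball y hy).2.1).differentiableAt
      (by simp)).differentiableWithinAt) hsym
  have hpb : Metric.ball p r ∈ 𝓝 p := Metric.ball_mem_nhds p hr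
  have hstrict : HasStrictFDerivAt h (θ p) p :=
    hasStrictFDerivAt_of_hasFDerivAt_of_continuousAt
      (by filter_upwards [hpb] with y hy using hh y hy)
      (hθd p hinv hB).continuousAt
  obtain ⟨e, he⟩ := id hinv
  have hθp : θ p = e.symm := by simp [hθ, ← he]
  rw [hθp] at hstrict
  set g : E → F := fun y => h y - h p with hg
  have hstrict' : HasStrictFDerivAt g (e.symm : E →L[ℝ] F) p := hstrict.sub_const _
  set T := hstrict'.toOpenPartialHomeomorph g with hT
  have hTp : T p = 0 := by simp [hT, hg]
  have hps : p ∈ T.source := hstrict'.mem_toOpenPartialHomeomorph_source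
  have h0 : (0 : F) ∈ T.target := hTp ▸ T.map_source hps
  have hs0 : T.symm 0 = p := by rw [← hTp]; exact T.left_inv hps
  refine ⟨T.symm, hs0, ?_, ?_⟩
  · have := T.symm.map_nhds_eq (x := 0) (by simpa using h0)
    rwa [hs0] at this
  · have hc : ContinuousAt T.symm 0 := T.symm.continuousAt (by simpa using h0)
    have hev : ∀ᶠ v in 𝓝 (0 : F), T.symm v ∈ Metric.ball p r :=
      hc.eventually (by rw [hs0]; exact hpb)
    filter_upwards [hev, T.open_target.mem_nhds h0] with v hv hvt
    obtain ⟨e', he'⟩ := (hball _ hv).1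
    have h7 : HasFDerivAt g (e'.symm : E →L[ℝ] F) (T.symm v) := by
      have := (hh _ hv).sub_const (h p)
      have h8 : θ (T.symm v) = e'.symm := by simp [hθ, ← he']
      rwa [h8] at this
    rw [← he']
    exact T.hasFDerivAt_symm hvt h7

/-- Symmetry of the second derivative of the joint map lets the time derivative pass through the
space derivative. This linearizes a flow in both variables at time zero. -/
theorem hasDerivAt_fderiv_of_contDiffAt {Φ : ℝ → E → F} {K : E → F} {y : E}
    (hΦ : ContDiffAt ℝ 2 (fun q : ℝ × E => Φ q.1 q.2) (0, y))
    (hK : ∀ᶠ z in 𝓝 y, HasDerivAt (fun s => Φ s z) (K z) 0) :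
    HasDerivAt (fun s => fderiv ℝ (Φ s) y) (fderiv ℝ K y) 0 := by
  set Ψ : ℝ × E → F := fun q => Φ q.1 q.2 with hΨ
  have hd : ContDiffAt ℝ 1 (fderiv ℝ Ψ) (0, y) := hΦ.fderiv_right (by norm_num)
  have hd' : HasFDerivAt (fderiv ℝ Ψ) (fderiv ℝ (fderiv ℝ Ψ) (0, y)) (0, y) :=
    (hd.differentiableAt (by simp)).hasFDerivAt
  have hev : ∀ᶠ q in 𝓝 ((0 : ℝ), y), DifferentiableAt ℝ Ψ q :=
    (hΦ.eventually (by simp)).mono fun q hq => hq.differentiableAt (by simp)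
  have h1 : (fun s => fderiv ℝ (Φ s) y) =ᶠ[𝓝 0]
      fun s => (fderiv ℝ Ψ (s, y)).comp (ContinuousLinearMap.inr ℝ ℝ E) := by
    have hc : ContinuousAt (fun s : ℝ => (s, y)) 0 := by fun_prop
    filter_upwards [hc.eventually hev] with s hs
    have h2 : HasFDerivAt (fun z : E => (s, z)) (ContinuousLinearMap.inr ℝ ℝ E) y := by
      exact (hasFDerivAt_prodMk_right s y)
    exact (hs.hasFDerivAt.comp y h2).fderiv
  have h2 : fderiv ℝ K y = (fderiv ℝ (fderiv ℝ Ψ) (0, y)).flip (1, 0) ∘L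
      ContinuousLinearMap.inr ℝ ℝ E := by
    have h3 : K =ᶠ[𝓝 y] fun z => fderiv ℝ Ψ (0, z) (1, 0) := by
      have hc : ContinuousAt (fun z : E => ((0 : ℝ), z)) y := by fun_prop
      filter_upwards [hc.eventually hev, hK] with z hz hz'
      have h4 : HasDerivAt (fun s : ℝ => (s, z)) ((1 : ℝ), (0 : E)) 0 := by
        simpa using (hasDerivAt_id (0 : ℝ)).prodMk (hasDerivAt_const (0 : ℝ) z)
      exact hz'.unique (hz.hasFDerivAt.comp_hasDerivAt (f := fun s : ℝ => (s, z)) 0 h4)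
    rw [h3.fderiv_eq]
    have h5 : HasFDerivAt (fun z => fderiv ℝ Ψ (0, z))
        ((fderiv ℝ (fderiv ℝ Ψ) (0, y)).comp (ContinuousLinearMap.inr ℝ ℝ E)) y :=
      hd'.comp y (hasFDerivAt_prodMk_right (0 : ℝ) y)
    have h6 := h5.clm_apply (hasFDerivAt_const ((1 : ℝ), (0 : E)) y)
    rw [h6.fderiv]
    ext u
    simp
  have hsym : IsSymmSndFDerivAt ℝ Ψ (0, y) :=
    hΦ.isSymmSndFDerivAt (by simp)
  have h7 : HasDerivAt (fun s : ℝ => fderiv ℝ Ψ (s, y))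
      (fderiv ℝ (fderiv ℝ Ψ) (0, y) (1, 0)) 0 := by
    have h4 : HasDerivAt (fun s : ℝ => (s, y)) ((1 : ℝ), (0 : E)) 0 := by
      simpa using (hasDerivAt_id (0 : ℝ)).prodMk (hasDerivAt_const (0 : ℝ) y)
    exact hd'.comp_hasDerivAt (0 : ℝ) h4
  refine HasDerivAt.congr_of_eventuallyEq ?_ h1
  have h8 := h7.clm_comp (hasDerivAt_const (0 : ℝ) (ContinuousLinearMap.inr ℝ ℝ E))
  have h9 : fderiv ℝ K y = fderiv ℝ (fderiv ℝ Ψ) (0, y) (1, 0) ∘L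
      ContinuousLinearMap.inr ℝ ℝ E + fderiv ℝ Ψ (0, y) ∘L 0 := by
    rw [h2]
    ext u
    simp [hsym.eq (1, 0) (0, u)]
  rw [h9]
  exact h8

/-- The Hessian terms cancel by symmetry, leaving only the derivatives of the two fields. -/
theorem fderiv_fderiv_apply_sub {f : E → ℝ} {X Y : E → E} {x : E} (hf : ContDiffAt ℝ 2 f x)
    (hX : DifferentiableAt ℝ X x) (hY : DifferentiableAt ℝ Y x) :
    fderiv ℝ (fun y => fderiv ℝ f y (Y y)) x (X x) - fderiv ℝ (fun y => fderiv ℝ f y (X y)) x (Y x)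
      = fderiv ℝ f x (VectorField.lieBracket ℝ X Y x) := by
  have hd : DifferentiableAt ℝ (fderiv ℝ f) x :=
    (hf.fderiv_right (m := 1) (by norm_num)).differentiableAt (by simp)
  have h1 := (hd.hasFDerivAt.clm_apply hY.hasFDerivAt).fderiv
  have h2 := (hd.hasFDerivAt.clm_apply hX.hasFDerivAt).fderiv
  have hsym : IsSymmSndFDerivAt ℝ f x := hf.isSymmSndFDerivAt (by simp)
  rw [h1, h2, VectorField.lieBracket]
  simp [hsym.eq (X x) (Y x)]

/-- A closed orbit of a vector field with small Lipschitz constant is an equilibrium. -/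
theorem eq_zero_of_periodic_of_lipschitz {K : E → E} {S : Set E} {γ : ℝ → E} {T : ℝ}
    {c : NNReal} (hT : 0 < T) (hc : c * T < 1) (hK : LipschitzOnWith c K S) (hS : ∀ s, γ s ∈ S)
    (hγ : ∀ s, HasDerivAt γ (K (γ s)) s) (hper : γ T = γ 0) : K (γ 0) = 0 := by
  have hcont : Continuous fun s => K (γ s) :=
    hK.continuousOn.comp_continuous (continuous_iff_continuousAt.2 fun s => (hγ s).continuousAt) hS
  obtain ⟨s₀, hs₀, hmax⟩ := (isCompact_Icc (a := (0 : ℝ)) (b := T)).exists_isMaxOn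
    ⟨0, by simp [hT.le]⟩ hcont.norm.continuousOn
  set m := ‖K (γ s₀)‖ with hm
  have hb : ∀ s ∈ Icc (0 : ℝ) T, ‖K (γ s)‖ ≤ m := fun s hs => hmax hs
  have h1 : ∀ s ∈ Icc (0 : ℝ) T, ‖γ s - γ s₀‖ ≤ m * T := by
    intro s hs
    have := (convex_Icc (0 : ℝ) T).norm_image_sub_le_of_norm_hasDerivWithin_le
      (fun r _ => (hγ r).hasDerivWithinAt) hb hs₀ hs
    refine this.trans (mul_le_mul_of_nonneg_left ?_ (norm_nonneg _))
    rw [Real.norm_eq_abs, abs_le]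
    constructor <;> linarith [hs.1, hs.2, hs₀.1, hs₀.2]
  have h2 : ∀ s ∈ Icc (0 : ℝ) T, ‖K (γ s) - K (γ s₀)‖ ≤ c * (m * T) := fun s hs =>
    (hK.norm_sub_le (hS s) (hS s₀)).trans (mul_le_mul_of_nonneg_left (h1 s hs) c.2)
  have h3 := (convex_Icc (0 : ℝ) T).norm_image_sub_le_of_norm_hasDerivWithin_le
      (f := fun s => γ s - s • K (γ s₀)) (f' := fun s => K (γ s) - K (γ s₀))
      (fun r _ => by
        simpa using! ((hγ r).sub ((hasDerivAt_id r).smul_const (K (γ s₀)))).hasDerivWithinAt)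
      h2 (left_mem_Icc.2 hT.le) (right_mem_Icc.2 hT.le)
  simp only [hper, zero_smul, sub_zero, sub_sub_cancel_left, norm_neg, norm_smul,
    Real.norm_eq_abs, abs_of_pos hT] at h3
  have h4 : m ≤ (c * T) * m := by
    have : T * m ≤ T * (c * T * m) := by nlinarith
    exact le_of_mul_le_mul_left this hT
  have hm0 : m ≤ 0 := by
    by_contra h
    push Not at h
    nlinarith
  have := hb 0 (left_mem_Icc.2 hT.le)
  exact norm_le_zero_iff.1 (this.trans hm0)

end Analysis

/-- A separation of `R` spreads to the whole space: the points near which `R` lies in one of the two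
pieces form two open sets that cover. Connectedness gives them a common point, and density of `R`
then puts a point of `R` in both pieces. -/
theorem isPreconnected_of_dense_of_local {X : Type*} [TopologicalSpace X] [PreconnectedSpace X]
    {R : Set X} (hR : Dense R) (hloc : ∀ x, ∃ U, IsOpen U ∧ x ∈ U ∧ IsPreconnected (U ∩ R)) :
    IsPreconnected R := by
  intro u v hu hv huv hRu hRv
  by_contra hne
  have hA : ∀ w : Set X, IsOpen {x | ∃ U, IsOpen U ∧ x ∈ U ∧ U ∩ R ⊆ w} := by
    intro w
    rw [isOpen_iff_mem_nhds]
    rintro x ⟨U, hU, hx, hUw⟩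
    filter_upwards [hU.mem_nhds hx] with y hy using ⟨U, hU, hy, hUw⟩
  have hcov : (univ : Set X) ⊆ {x | ∃ U, IsOpen U ∧ x ∈ U ∧ U ∩ R ⊆ u} ∪
      {x | ∃ U, IsOpen U ∧ x ∈ U ∧ U ∩ R ⊆ v} := by
    intro x _
    obtain ⟨U, hU, hx, hpre⟩ := hloc x
    by_cases h1 : (U ∩ R ∩ u).Nonempty
    · by_cases h2 : (U ∩ R ∩ v).Nonempty
      · obtain ⟨z, hz, hz'⟩ := hpre u v hu hv (inter_subset_right.trans huv) h1 h2
        exact (hne ⟨z, hz.2, hz'⟩).elim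
      · left
        refine ⟨U, hU, hx, fun z hz => ?_⟩
        exact (huv hz.2).resolve_right fun h => h2 ⟨z, hz, h⟩
    · right
      refine ⟨U, hU, hx, fun z hz => ?_⟩
      exact (huv hz.2).resolve_left fun h => h1 ⟨z, hz, h⟩
  obtain ⟨a, haR, hau⟩ := hRu
  obtain ⟨b, hbR, hbv⟩ := hRv
  obtain ⟨x, -, ⟨U, hU, hxU, hUu⟩, ⟨V, hV, hxV, hVv⟩⟩ := isPreconnected_univ _ _ (hA u) (hA v) hcov
    ⟨a, mem_univ _, u, hu, hau, inter_subset_left⟩ ⟨b, mem_univ _, v, hv, hbv, inter_subset_left⟩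
  obtain ⟨z, ⟨hzU, hzV⟩, hzR⟩ := hR.inter_open_nonempty _ (hU.inter hV) ⟨x, hxU, hxV⟩
  exact hne ⟨z, hzR, hUu ⟨hzU, hzR⟩, hVv ⟨hzV, hzR⟩⟩

/-! ### Hausdorff dimension of zero sets. -/

section Dimension

variable {E F : Type*} [NormedAddCommGroup E] [NormedSpace ℝ E] [FiniteDimensional ℝ E]
  [NormedAddCommGroup F] [NormedSpace ℝ F] [FiniteDimensional ℝ F]

/-- Near a point where the derivative of `K` is `A`, the zeros of `K` form a set of dimension at
most `dim ker A`. -/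
theorem exists_dimH_zeros_le {K : E → F} {A : E →L[ℝ] F} {x : E} (hK : HasStrictFDerivAt K A x) :
    ∃ V ∈ 𝓝 x, dimH {y ∈ V | K y = 0} ≤ Module.finrank ℝ (LinearMap.ker A.toLinearMap) := by
  set W := LinearMap.ker A.toLinearMap with hW
  -- With `P` a projection onto the kernel, the pair `(P, A)` is injective, hence antilipschitz. On
  -- the zeros of `K`, strict differentiability makes the `A` component negligible, so `P` alone is
  -- antilipschitz there.
  obtain ⟨P, hP⟩ := W.subtype.exists_leftInverse_of_injective W.ker_subtype
  have hP' : ∀ w : W, P w = w := fun w => LinearMap.congr_fun hP w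
  obtain ⟨c, hc, hanti⟩ := (P.prod A.toLinearMap).exists_antilipschitzWith (by
    refine LinearMap.ker_eq_bot'.2 fun z hz => ?_
    simp only [LinearMap.prod_apply, Function.prod_apply, Prod.mk_eq_zero] at hz
    have hzW : z ∈ W := hz.2
    have := hP' ⟨z, hzW⟩
    rw [hz.1] at this
    simpa using (congrArg Subtype.val this).symm)
  -- With this constant the `A` component accounts for at most half of `‖y - z‖`, so it can dominate
  -- the maximum only when `y = z`.
  have hε : (0 : ℝ) < ((2 * c)⁻¹ : NNReal) := by positivity
  have hlit := hK.isLittleO.def hε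
  rw [nhds_prod_eq] at hlit
  obtain ⟨V, hV, hVb⟩ := Filter.eventually_prod_self_iff (r := fun y z =>
    ‖K y - K z - A (y - z)‖ ≤ ((2 * c)⁻¹ : NNReal) * ‖y - z‖) |>.1 hlit
  refine ⟨V, hV, ?_⟩
  set S : Set E := {y ∈ V | K y = 0} with hS
  have hf : AntilipschitzWith c fun s : S => P s := by
    refine AntilipschitzWith.of_le_mul_dist fun y z => ?_
    have h1 := hVb y y.2.1 z z.2.1
    simp only [y.2.2, z.2.2, sub_self, zero_sub, norm_neg] at h1
    have h2 := hanti.le_mul_dist (y : E) z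
    rw [dist_eq_norm, dist_eq_norm, ← map_sub] at h2
    have h3 : ‖(P.prod A.toLinearMap) ((y : E) - z)‖ = max ‖P ((y : E) - z)‖ ‖A ((y : E) - z)‖ := rfl
    rw [h3] at h2
    rw [Subtype.dist_eq, dist_eq_norm, dist_eq_norm, ← map_sub]
    rcases max_cases ‖P ((y : E) - z)‖ ‖A ((y : E) - z)‖ with h | h
    · rwa [h.1] at h2
    · rw [h.1] at h2
      have h4 : c * ‖A ((y : E) - z)‖ ≤ c * (((2 * c)⁻¹ : NNReal) * ‖(y : E) - z‖) :=
        mul_le_mul_of_nonneg_left h1 c.2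
      have h5 : (c : ℝ) * (((2 * c)⁻¹ : NNReal) * ‖(y : E) - z‖) = ‖(y : E) - z‖ / 2 := by
        have : (c : ℝ) ≠ 0 := by exact_mod_cast hc.ne'
        push_cast
        field_simp
      have h6 : ‖(y : E) - z‖ ≤ 0 := by linarith
      exact h6.trans (by positivity)
  calc dimH S = dimH (Subtype.val '' (univ : Set S)) := by simp
    _ = dimH (univ : Set S) := isometry_subtype_coe.dimH_image _
    _ ≤ dimH ((fun s : S => P s) '' univ) := hf.le_dimH_image _
    _ ≤ dimH (univ : Set W) := dimH_mono (subset_univ _)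
    _ = Module.finrank ℝ W := Real.dimH_univ_eq_finrank W

theorem dimH_le_of_local {X : Type*} [EMetricSpace X] [SecondCountableTopology X] {s : Set X}
    {d : ENNReal} (h : ∀ x ∈ s, ∃ V ∈ 𝓝 x, dimH (s ∩ V) ≤ d) : dimH s ≤ d := by
  by_contra! hlt
  obtain ⟨x, hx, hx'⟩ := exists_mem_nhdsWithin_lt_dimH_of_lt_dimH hlt
  obtain ⟨V, hV, hV'⟩ := h x hx
  exact (hx' (s ∩ V) (inter_mem self_mem_nhdsWithin (mem_nhdsWithin_of_mem_nhds hV))).not_ge hV'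

end Dimension

/-! ### Removing a set of codimension larger than one keeps convex open sets connected. -/

section Complement

variable {E : Type*} [NormedAddCommGroup E] [NormedSpace ℝ E] [FiniteDimensional ℝ E]

/-- The central projection from `a` onto a hyperplane does not increase dimension. -/
theorem dimH_centralProjection_le {W : Type*} [NormedAddCommGroup W] [NormedSpace ℝ W]
    (N : Set E) (ℓ : E →L[ℝ] ℝ) (P : E →L[ℝ] W) (a m : E) :
    dimH ((fun n => P (a - m + (2 * ℓ (n - a))⁻¹ • (n - a))) '' (N ∩ {n | 0 < ℓ (n - a)}))
      ≤ dimH N := by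
  -- The projection is smooth on the open half space in front of `a`. Convexity of the half space is
  -- what the dimension bound for `C¹` maps requires.
  refine (ContDiffOn.dimH_image_le (s := {n | 0 < ℓ (n - a)}) ?_ ?_ inter_subset_right).trans
    (dimH_mono inter_subset_left)
  · refine P.contDiff.comp_contDiffOn (contDiffOn_const.add (ContDiffOn.smul (ContDiffOn.inv ?_ ?_) ?_))
    · fun_prop
    · intro x hx
      have : 0 < ℓ (x - a) := hx
      positivity
    · fun_prop
  · have : {n | 0 < ℓ (n - a)} = {n | ℓ a < ℓ n} := by ext n; simp
    rw [this]
    exact convex_halfSpace_gt ℓ.toLinearMap.isLinear _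

/-- A convex open set minus a set of codimension larger than one is connected. -/
theorem isPreconnected_diff_of_dimH_lt {U N : Set E} (hU : IsOpen U) (hUc : Convex ℝ U)
    (hN : dimH N < (Module.finrank ℝ E - 1 : ℕ)) : IsPreconnected (U \ N) := by
  refine isPreconnected_of_forall_pair fun v hv w hw => ?_
  rcases eq_or_ne v w with rfl | hne
  · exact ⟨{v}, by simpa using hv, by simp, by simp, isPreconnected_singleton⟩
  obtain ⟨ℓ, hℓ⟩ : ∃ ℓ : E →L[ℝ] ℝ, ℓ (w - v) = 1 := by
    obtain ⟨g, hg⟩ := SeparatingDual.exists_eq_one (R := ℝ) (sub_ne_zero.2 hne.symm)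
    exact ⟨g, hg⟩
  set W := LinearMap.ker ℓ.toLinearMap with hW
  have hWdim : Module.finrank ℝ W = Module.finrank ℝ E - 1 := by
    have h1 := ℓ.toLinearMap.finrank_range_add_finrank_ker
    have h2 : LinearMap.range ℓ.toLinearMap = ⊤ := by
      refine LinearMap.range_eq_top.2 fun r => ⟨r • (w - v), ?_⟩
      simp only [ContinuousLinearMap.coe_coe, map_smul, hℓ, smul_eq_mul, mul_one]
    rw [h2, finrank_top, Module.finrank_self] at h1
    rw [hW, ← h1, Nat.add_sub_cancel_left]
  let P : E →L[ℝ] W := (ContinuousLinearMap.id ℝ E - ℓ.smulRight (w - v)).codRestrict W (by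
    intro z
    have : ℓ (z - ℓ z • (w - v)) = 0 := by rw [map_sub, map_smul, hℓ]; simp
    simpa [hW] using this)
  have hP : ∀ z : W, P z = z := by
    intro z
    have hz : ℓ z = 0 := z.2
    ext
    simp [P, hz]
  set m : E := (2 : ℝ)⁻¹ • (v + w) with hm
  have hmU : m ∈ U := by
    have := hUc hv.1 hw.1 (a := (2 : ℝ)⁻¹) (b := 2⁻¹) (by norm_num) (by norm_num) (by norm_num)
    rwa [← smul_add] at this
  -- `B` consists of the points of the middle hyperplane whose segment to `v` or to `w` meets `N`.
  -- The factor 2 reflects that `ℓ` changes by `1/2` from either endpoint to that hyperplane. As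
  -- `dim B` is smaller than that of the hyperplane, some nearby `p` avoids `B`, and the path from
  -- `v` to `w` bends at `m + p`.
  set B := ((fun n => P (v - m + (2 * ℓ (n - v))⁻¹ • (n - v))) '' (N ∩ {n | 0 < ℓ (n - v)})) ∪
    ((fun n => P (w - m + (2 * (-ℓ) (n - w))⁻¹ • (n - w))) '' (N ∩ {n | 0 < (-ℓ) (n - w)})) with hB
  have hBdim : dimH B < Module.finrank ℝ W := by
    rw [hWdim, hB, dimH_union, max_lt_iff]
    exact ⟨(dimH_centralProjection_le _ _ _ _ _).trans_lt hN,
      (dimH_centralProjection_le _ _ _ _ _).trans_lt hN⟩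
  have hdense := dense_compl_of_dimH_lt_finrank hBdim
  have hopen : IsOpen {p : W | m + (p : E) ∈ U} := hU.preimage (by fun_prop)
  obtain ⟨p, hpU, hpB⟩ := hdense.inter_open_nonempty _ hopen ⟨0, by simpa using hmU⟩
  set u := m + (p : E) with hu
  have hℓp : ℓ p = 0 := p.2
  have hℓw : ℓ w = 1 + ℓ v := by rw [map_sub] at hℓ; linarith
  have hgen : ∀ (a : E) (lam : E →L[ℝ] ℝ), a ∈ U \ N → lam (u - a) = 2⁻¹ →
      p ∉ (fun n => P (a - m + (2 * lam (n - a))⁻¹ • (n - a))) '' (N ∩ {n | 0 < lam (n - a)}) →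
      segment ℝ a u ⊆ U \ N := by
    intro a lam ha hlam hp n hn
    refine ⟨hUc.segment_subset ha.1 hpU hn, fun hnN => ?_⟩
    rw [segment_eq_image'] at hn
    obtain ⟨t, ht, rfl⟩ := hn
    rcases ht.1.eq_or_lt with rfl | ht0
    · simp only [zero_smul, add_zero] at hnN; exact ha.2 hnN
    · refine hp ⟨_, ⟨hnN, ?_⟩, ?_⟩
      · simp only [mem_ofPred_eq, add_sub_cancel_left, map_smul, hlam, smul_eq_mul]; positivity
      · simp only [add_sub_cancel_left, map_smul, hlam, smul_eq_mul]
        rw [smul_smul]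
        have : (2 * (t * 2⁻¹))⁻¹ * t = 1 := by field_simp
        rw [this, one_smul, hu]
        rw [show a - m + (m + (p : E) - a) = p by abel, hP]
  have hsv : segment ℝ v u ⊆ U \ N := by
    refine hgen v ℓ hv ?_ fun h => hpB (Or.inl h)
    rw [hu, hm]
    simp only [map_sub, map_add, map_smul, hℓp, hℓw, smul_eq_mul]
    ring
  have hsw : segment ℝ w u ⊆ U \ N := by
    refine hgen w (-ℓ) hw ?_ fun h => hpB (Or.inr h)
    rw [hu, hm]
    simp only [neg_apply, map_sub, map_add, map_smul, hℓp, hℓw, smul_eq_mul]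
    ring
  refine ⟨segment ℝ v u ∪ segment ℝ w u, union_subset hsv hsw, Or.inl (left_mem_segment _ _ _),
    Or.inr (left_mem_segment _ _ _), ?_⟩
  exact IsPreconnected.union u (right_mem_segment _ _ _) (right_mem_segment _ _ _)
    (convex_segment _ _).isPreconnected (convex_segment _ _).isPreconnected

end Complement

/-! ### Strictly monotone maps of a Euclidean space. -/

section Monotone

variable {H : Type*} [NormedAddCommGroup H] [InnerProductSpace ℝ H] [FiniteDimensional ℝ H]

theorem inner_sub_pos_of_fderiv_pos {G : H → H} {D : H → H →L[ℝ] H}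
    (hG : ∀ x, HasFDerivAt G (D x) x) (hpos : ∀ x ζ, ζ ≠ 0 → 0 < ⟪ζ, D x ζ⟫) {a b : H}
    (hab : a ≠ b) : 0 < ⟪a - b, G a - G b⟫ := by
  set g : ℝ → ℝ := fun t => ⟪a - b, G (b + t • (a - b))⟫ with hg
  have hder : ∀ t, HasDerivAt g ⟪a - b, D (b + t • (a - b)) (a - b)⟫ t := by
    intro t
    have h1 : HasDerivAt (fun t : ℝ => b + t • (a - b)) (a - b) t := by
      simpa using ((hasDerivAt_id t).smul_const (a - b)).const_add b
    have h2 := (hG (b + t • (a - b))).comp_hasDerivAt t h1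
    exact (innerSL ℝ (a - b)).hasFDerivAt.comp_hasDerivAt t h2
  have hmono : StrictMono g := strictMono_of_deriv_pos fun t => by
    rw [(hder t).deriv]; exact hpos _ _ (sub_ne_zero.2 hab)
  have := hmono (zero_lt_one)
  simp only [hg, zero_smul, add_zero, one_smul, add_sub_cancel] at this
  rw [inner_sub_right]
  linarith

theorem isOpenMap_of_fderiv_pos {G : H → H} {D : H → H →L[ℝ] H}
    (hG : ∀ x, HasFDerivAt G (D x) x) (hD : Continuous D)
    (hpos : ∀ x ζ, ζ ≠ 0 → 0 < ⟪ζ, D x ζ⟫) : IsOpenMap G := by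
  refine isOpenMap_iff_nhds_le.2 fun x => ?_
  have hinj : Function.Injective (D x) := by
    refine (injective_iff_map_eq_zero _).2 fun ζ hζ => ?_
    by_contra h
    have := hpos x ζ h
    rw [hζ, inner_zero_right] at this
    exact lt_irrefl _ this
  have hsurj : LinearMap.range (D x).toLinearMap = ⊤ :=
    LinearMap.range_eq_top.2 (LinearMap.injective_iff_surjective.1 hinj)
  have hs : HasStrictFDerivAt G (D x) x := hasStrictFDerivAt_of_hasFDerivAt_of_continuousAt
    (Eventually.of_forall hG) hD.continuousAt
  exact (hs.map_nhds_eq_of_surj hsurj).ge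

/-- The term `ε x` makes the monotone map antilipschitz, hence proper. Its range is then closed as
well as open. -/
theorem surjective_add_smul_of_fderiv_pos {G : H → H} {D : H → H →L[ℝ] H}
    (hG : ∀ x, HasFDerivAt G (D x) x) (hD : Continuous D)
    (hpos : ∀ x ζ, ζ ≠ 0 → 0 < ⟪ζ, D x ζ⟫) {ε : ℝ} (hε : 0 < ε) :
    Function.Surjective fun x => G x + ε • x := by
  set Gε : H → H := fun x => G x + ε • x with hGε
  have hder : ∀ x, HasFDerivAt Gε (D x + ε • ContinuousLinearMap.id ℝ H) x := fun x =>
    (hG x).add ((hasFDerivAt_id x).const_smul ε)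
  have hopen : IsOpenMap Gε := by
    refine isOpenMap_of_fderiv_pos hder (by fun_prop) fun x ζ hζ => ?_
    simp only [add_apply, FunLike.coe_smul, Pi.smul_apply,
      ContinuousLinearMap.coe_id', id_eq, inner_add_right, inner_smul_right]
    have := hpos x ζ hζ
    have : 0 ≤ ε * ⟪ζ, ζ⟫ := mul_nonneg hε.le real_inner_self_nonneg
    linarith
  have hcont : Continuous Gε := continuous_iff_continuousAt.2 fun x => (hder x).continuousAt
  have hanti : AntilipschitzWith (Real.toNNReal ε⁻¹) Gε := by
    refine AntilipschitzWith.of_le_mul_dist fun a b => ?_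
    rw [Real.coe_toNNReal _ (by positivity), dist_eq_norm, dist_eq_norm]
    rcases eq_or_ne a b with rfl | hab
    · simp
    have h1 := inner_sub_pos_of_fderiv_pos hG hpos hab
    have h2 : ⟪a - b, Gε a - Gε b⟫ = ⟪a - b, G a - G b⟫ + ε * ‖a - b‖ ^ 2 := by
      rw [← real_inner_self_eq_norm_sq, ← inner_smul_right, ← inner_add_right]
      simp only [hGε, smul_sub]
      congr 1
      abel
    have h3 := real_inner_le_norm (a - b) (Gε a - Gε b)
    have h4 : 0 < ‖a - b‖ := norm_pos_iff.2 (sub_ne_zero.2 hab)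
    have h5 : ε * ‖a - b‖ ≤ ‖Gε a - Gε b‖ := by
      refine le_of_mul_le_mul_left ?_ h4
      nlinarith
    rw [inv_mul_eq_div, le_div_iff₀ hε]
    linarith
  have hclosed : IsClosed (range Gε) := by
    have : IsProperMap Gε := isProperMap_iff_tendsto_cocompact.2 ⟨hcont, by
      rw [← Metric.cobounded_eq_cocompact]
      exact hanti.tendsto_cobounded⟩
    exact this.isClosedMap.isClosed_range
  exact range_eq_univ.1 (IsClopen.eq_univ ⟨hclosed, hopen.isOpen_range⟩ (range_nonempty _))

/-- The range of a strictly monotone `C¹` map of a finite dimensional space contains the interior of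
its closure. -/
theorem interior_closure_range_subset_of_fderiv_pos {G : H → H} {D : H → H →L[ℝ] H}
    (hG : ∀ x, HasFDerivAt G (D x) x) (hD : Continuous D)
    (hpos : ∀ x ζ, ζ ≠ 0 → 0 < ⟪ζ, D x ζ⟫) : interior (closure (range G)) ⊆ range G := by
  intro y hy
  -- These are the solutions of the regularized equations. A uniform bound on them lets `ε` tend to
  -- zero.
  set S : Set H := {η | ∃ ε : ℝ, 0 < ε ∧ ε ≤ 1 ∧ G η + ε • η = y} with hS
  -- Monotonicity tested between `η` and `a`, with `G η` replaced by `y - ε η`, bounds `η` from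
  -- above in the direction `G a - y`.
  have hbound : ∀ a : H, ∀ η ∈ S, ⟪G a - y, η⟫ ≤ ⟪G a - y, a⟫ + ‖a‖ ^ 2 := by
    rintro a η ⟨ε, hε, hε1, rfl⟩
    have h1 : 0 ≤ ⟪η - a, G η - G a⟫ := by
      rcases eq_or_ne η a with rfl | h
      · simp
      · exact (inner_sub_pos_of_fderiv_pos hG hpos h).le
    have h2 : ⟪η, a⟫ ≤ ‖η‖ * ‖a‖ := real_inner_le_norm _ _
    simp only [inner_sub_left, inner_sub_right, inner_add_left, inner_smul_left,
      RCLike.conj_to_real] at h1 ⊢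
    rw [real_inner_self_eq_norm_sq]
    have e1 := real_inner_comm η (G a)
    have e2 := real_inner_comm η (G η)
    have e3 := real_inner_comm a (G a)
    have e4 := real_inner_comm a (G η)
    have h3 : ε * ⟪η, a⟫ ≤ ε * (‖η‖ * ‖a‖) := mul_le_mul_of_nonneg_left h2 hε.le
    have h4 : ε * (‖η‖ * ‖a‖) ≤ ε * (‖η‖ ^ 2 + ‖a‖ ^ 2) :=
      mul_le_mul_of_nonneg_left (by nlinarith [sq_nonneg (‖η‖ - ‖a‖)]) hε.le
    have h5 : ε * ‖a‖ ^ 2 ≤ ‖a‖ ^ 2 := by nlinarith [sq_nonneg ‖a‖]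
    nlinarith
  have hbdd : ∃ B : ℝ, ∀ η ∈ S, η ≠ 0 → ‖η‖⁻¹ • η ∈ Metric.sphere (0 : H) 1 → ‖η‖ ≤ B := by
    refine (isCompact_sphere (0 : H) 1).induction_on
      (p := fun s => ∃ B : ℝ, ∀ η ∈ S, η ≠ 0 → ‖η‖⁻¹ • η ∈ s → ‖η‖ ≤ B) ⟨0, by simp⟩ ?_ ?_ ?_
    · rintro s t hst ⟨B, hB⟩
      exact ⟨B, fun η h1 h2 h3 => hB η h1 h2 (hst h3)⟩
    · rintro s t ⟨B, hB⟩ ⟨B', hB'⟩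
      refine ⟨max B B', fun η h1 h2 h3 => ?_⟩
      rcases h3 with h3 | h3
      · exact (hB η h1 h2 h3).trans (le_max_left _ _)
      · exact (hB' η h1 h2 h3).trans (le_max_right _ _)
    -- For a unit direction `e`, the point `y + (δ/2) e` lies in the closure of the range. Some `G
    -- a` within `δ/4` of it satisfies `⟪G a - y, e⟫ ≥ δ/4`, and the pairing stays above `δ/8` for
    -- directions near `e`. So `hbound` bounds all solutions pointing that way, and compactness of
    -- the sphere makes the bound uniform.
    · intro e he
      have hen : ‖e‖ = 1 := by simpa using he
      obtain ⟨δ, hδ, hball⟩ := Metric.isOpen_iff.1 isOpen_interior y hy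
      have hmem : y + (δ / 2) • e ∈ closure (range G) := by
        refine interior_subset (hball ?_)
        rw [Metric.mem_ball, dist_eq_norm, add_sub_cancel_left, norm_smul, hen,
          Real.norm_of_nonneg (by positivity)]
        linarith
      obtain ⟨-, ⟨a, rfl⟩, ha⟩ := Metric.mem_closure_iff.1 hmem (δ / 4) (by positivity)
      have hκ : δ / 4 ≤ ⟪G a - y, e⟫ := by
        have h1 : ⟪G a - y, e⟫ = ⟪G a - (y + (δ / 2) • e), e⟫ + δ / 2 := by
          rw [← sub_sub, inner_sub_left (G a - y), inner_smul_left, real_inner_self_eq_norm_sq, hen]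
          simp
        have h2 := abs_real_inner_le_norm (G a - (y + (δ / 2) • e)) e
        rw [hen, mul_one, ← dist_eq_norm, dist_comm] at h2
        have := (abs_le.1 h2).1
        linarith
      have hopen : {e' | δ / 8 < ⟪G a - y, e'⟫} ∈ 𝓝 e := by
        refine (isOpen_lt continuous_const (by fun_prop)).mem_nhds ?_
        simp only [mem_ofPred_eq]
        linarith
      refine ⟨_, mem_nhdsWithin_of_mem_nhds hopen, (⟪G a - y, a⟫ + ‖a‖ ^ 2) / (δ / 8), ?_⟩
      intro η h1 h2 h3
      have hη : 0 < ‖η‖ := norm_pos_iff.2 h2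
      simp only [mem_ofPred_eq, inner_smul_right] at h3
      have h4 := hbound a η h1
      rw [inv_mul_eq_div, lt_div_iff₀ hη] at h3
      rw [le_div_iff₀ (by positivity)]
      linarith
  obtain ⟨B, hB⟩ := hbdd
  have hex : ∀ n : ℕ, ∃ η : H, G η + ((n : ℝ) + 1)⁻¹ • η = y := fun n =>
    surjective_add_smul_of_fderiv_pos hG hD hpos (by positivity) y
  choose η hη using hex
  have hηB : ∀ n, η n ∈ Metric.closedBall (0 : H) (max B 0) := by
    intro n
    rw [mem_closedBall_zero_iff]
    rcases eq_or_ne (η n) 0 with h | h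
    · simp [h]
    · refine (hB _ ⟨_, by positivity, ?_, hη n⟩ h ?_).trans (le_max_left _ _)
      · exact inv_le_one_of_one_le₀ (by linarith [(Nat.cast_nonneg n : (0 : ℝ) ≤ n)])
      · have : ‖η n‖ ≠ 0 := norm_ne_zero_iff.2 h
        simp [norm_smul, this]
  obtain ⟨z, -, φ, hφ, hlim⟩ := (isCompact_closedBall (0 : H) (max B 0)).tendsto_subseq hηB
  refine ⟨z, ?_⟩
  have h1 : Tendsto (fun n => G (η (φ n))) atTop (𝓝 (G z)) :=
    ((hG z).continuousAt.tendsto).comp hlim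
  have h2 : Tendsto (fun n => ((φ n : ℝ) + 1)⁻¹ • η (φ n)) atTop (𝓝 ((0 : ℝ) • z)) := by
    refine Tendsto.smul ?_ hlim
    have : Tendsto (fun n : ℕ => ((n : ℝ) + 1)⁻¹) atTop (𝓝 0) := by
      simpa using tendsto_one_div_add_atTop_nhds_zero_nat (𝕜 := ℝ)
    exact this.comp hφ.tendsto_atTop
  have h3 := h1.add h2
  simp only [hη, zero_smul, add_zero] at h3
  exact (tendsto_nhds_unique h3 tendsto_const_nhds)

end Monotone

/-! ### Vector fields, brackets and derivatives read in charts. -/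

section LocalRepresentation

variable {n : ℕ} {M : Type*} [TopologicalSpace M] [ChartedSpace (EuclideanSpace ℝ (Fin n)) M]

/-- Smoothness of a vector field at a point. -/
def SmoothVFieldAt [IsManifold (𝓡 n) ∞ M] (X : VField n M) (x : M) : Prop :=
  ContMDiffAt (𝓡 n) (𝓡 n).tangent ∞
    (fun x => (Bundle.TotalSpace.mk' (EuclideanSpace ℝ (Fin n)) x (X x) : TangentBundle (𝓡 n) M)) x

/-- The derivative of the chart at `z`. -/
def chartDeriv (z x : M) : TangentSpace (𝓡 n) x →L[ℝ] EuclideanSpace ℝ (Fin n) :=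
  mfderiv (𝓡 n) 𝓘(ℝ, EuclideanSpace ℝ (Fin n)) (extChartAt (𝓡 n) z) x

/-- The derivative of the inverse of the chart at `z`. -/
def chartSymmDeriv (z : M) (y : EuclideanSpace ℝ (Fin n)) :
    EuclideanSpace ℝ (Fin n) →L[ℝ] TangentSpace (𝓡 n) ((extChartAt (𝓡 n) z).symm y) :=
  mfderiv 𝓘(ℝ, EuclideanSpace ℝ (Fin n)) (𝓡 n) (extChartAt (𝓡 n) z).symm y

/-- The expression of a vector field in the chart at `z`. -/
def chartRep (z : M) (X : VField n M) (y : EuclideanSpace ℝ (Fin n)) : EuclideanSpace ℝ (Fin n) :=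
  chartDeriv z ((extChartAt (𝓡 n) z).symm y) (X ((extChartAt (𝓡 n) z).symm y))

theorem chartRep_apply {z x : M} (hx : x ∈ (extChartAt (𝓡 n) z).source) (X : VField n M) :
    chartRep z X (extChartAt (𝓡 n) z x) = chartDeriv z x (X x) := by
  -- The tangent space depends on the base point, so an equality of points cannot be rewritten
  -- directly. The base point is generalized and then substituted. The same device recurs below.
  have h : ∀ x', x' = x → chartDeriv z x' (X x') = chartDeriv z x (X x) := by
    rintro _ rfl; rfl
  exact h _ ((extChartAt (𝓡 n) z).left_inv hx)

theorem chart_target_mem_nhds {z : M} {y : EuclideanSpace ℝ (Fin n)}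
    (hy : y ∈ (extChartAt (𝓡 n) z).target) : (extChartAt (𝓡 n) z).target ∈ 𝓝 y :=
  (isOpen_extChartAt_target z).mem_nhds hy

variable [IsManifold (𝓡 n) ∞ M]

theorem contMDiffAt_chart_symm {z : M} {y : EuclideanSpace ℝ (Fin n)}
    (hy : y ∈ (extChartAt (𝓡 n) z).target) :
    ContMDiffAt 𝓘(ℝ, EuclideanSpace ℝ (Fin n)) (𝓡 n) ∞ (extChartAt (𝓡 n) z).symm y :=
  (contMDiffOn_extChartAt_symm z).contMDiffAt (chart_target_mem_nhds hy)

theorem contMDiffAt_chart {z x : M} (hx : x ∈ (extChartAt (𝓡 n) z).source) :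
    ContMDiffAt (𝓡 n) 𝓘(ℝ, EuclideanSpace ℝ (Fin n)) ∞ (extChartAt (𝓡 n) z) x :=
  contMDiffAt_extChartAt' (by rwa [extChartAt_source] at hx)

theorem hasMFDerivAt_chart {z x : M} (hx : x ∈ (extChartAt (𝓡 n) z).source) :
    HasMFDerivAt (𝓡 n) 𝓘(ℝ, EuclideanSpace ℝ (Fin n)) (extChartAt (𝓡 n) z) x (chartDeriv z x) :=
  ((contMDiffAt_chart hx).mdifferentiableAt (by simp)).hasMFDerivAt

theorem hasMFDerivAt_chart_symm {z : M} {y : EuclideanSpace ℝ (Fin n)}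
    (hy : y ∈ (extChartAt (𝓡 n) z).target) :
    HasMFDerivAt 𝓘(ℝ, EuclideanSpace ℝ (Fin n)) (𝓡 n) (extChartAt (𝓡 n) z).symm y
      (chartSymmDeriv z y) :=
  ((contMDiffAt_chart_symm hy).mdifferentiableAt (by simp)).hasMFDerivAt

theorem chartSymmDeriv_chartDeriv {z : M} {y : EuclideanSpace ℝ (Fin n)}
    (hy : y ∈ (extChartAt (𝓡 n) z).target)
    (v : TangentSpace (𝓡 n) ((extChartAt (𝓡 n) z).symm y)) :
    chartSymmDeriv z y (chartDeriv z _ v) = v := by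
  have h := mfderivWithin_extChartAt_symm_comp_mfderiv_extChartAt (I := 𝓡 n) hy
  rw [ModelWithCorners.Boundaryless.range_eq_univ, mfderivWithin_univ] at h
  exact congrArg (fun L => L v) h

theorem chartDeriv_chartSymmDeriv {z : M} {y : EuclideanSpace ℝ (Fin n)}
    (hy : y ∈ (extChartAt (𝓡 n) z).target) (v : EuclideanSpace ℝ (Fin n)) :
    chartDeriv z _ (chartSymmDeriv z y v) = v := by
  have h := mfderiv_extChartAt_comp_mfderivWithin_extChartAt_symm (I := 𝓡 n) hy
  rw [ModelWithCorners.Boundaryless.range_eq_univ, mfderivWithin_univ] at h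
  exact congrArg (fun L => L v) h

theorem chartDeriv_injective {z x : M} (hx : x ∈ (extChartAt (𝓡 n) z).source) :
    Function.Injective (chartDeriv (n := n) z x) := by
  have h : ∀ x', x' = x → Function.Injective (chartDeriv (n := n) z x') →
      Function.Injective (chartDeriv (n := n) z x) := by
    rintro _ rfl; exact id
  exact h _ ((extChartAt (𝓡 n) z).left_inv hx)
    (Function.LeftInverse.injective (chartSymmDeriv_chartDeriv ((extChartAt (𝓡 n) z).map_source hx)))

theorem chartDeriv_surjective {z x : M} (hx : x ∈ (extChartAt (𝓡 n) z).source) :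
    Function.Surjective (chartDeriv (n := n) z x) := by
  have h : ∀ x', x' = x → Function.Surjective (chartDeriv (n := n) z x') →
      Function.Surjective (chartDeriv (n := n) z x) := by
    rintro _ rfl; exact id
  exact h _ ((extChartAt (𝓡 n) z).left_inv hx)
    (Function.RightInverse.surjective
      (chartDeriv_chartSymmDeriv ((extChartAt (𝓡 n) z).map_source hx)))

theorem chartSymmDeriv_chartRep {z : M} {y : EuclideanSpace ℝ (Fin n)}
    (hy : y ∈ (extChartAt (𝓡 n) z).target) (X : VField n M) :
    chartSymmDeriv z y (chartRep z X y) = X ((extChartAt (𝓡 n) z).symm y) :=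
  chartSymmDeriv_chartDeriv hy _

theorem mpullback_eq_chartRep {z : M} {y : EuclideanSpace ℝ (Fin n)}
    (hy : y ∈ (extChartAt (𝓡 n) z).target) (X : VField n M) :
    VectorField.mpullback 𝓘(ℝ, EuclideanSpace ℝ (Fin n)) (𝓡 n) (extChartAt (𝓡 n) z).symm X y
      = chartRep z X y := by
  have h : (chartSymmDeriv (n := n) z y).inverse = chartDeriv z _ :=
    ContinuousLinearMap.inverse_eq
      (ContinuousLinearMap.ext fun v => chartSymmDeriv_chartDeriv hy v)
      (ContinuousLinearMap.ext fun v => chartDeriv_chartSymmDeriv hy v)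
  exact congrArg (fun L => L (X ((extChartAt (𝓡 n) z).symm y))) h

theorem mpullback_eventuallyEq_chartRep {z : M} {y : EuclideanSpace ℝ (Fin n)}
    (hy : y ∈ (extChartAt (𝓡 n) z).target) (X : VField n M) :
    (fun y => (VectorField.mpullback 𝓘(ℝ, EuclideanSpace ℝ (Fin n)) (𝓡 n)
      (extChartAt (𝓡 n) z).symm X y : EuclideanSpace ℝ (Fin n))) =ᶠ[𝓝 y] chartRep z X := by
  filter_upwards [chart_target_mem_nhds hy] with w hw using mpullback_eq_chartRep hw X

theorem SmoothVFieldAt.chartRep {z : M} {y : EuclideanSpace ℝ (Fin n)} {X : VField n M}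
    (hy : y ∈ (extChartAt (𝓡 n) z).target) (hX : SmoothVFieldAt X ((extChartAt (𝓡 n) z).symm y)) :
    ContDiffAt ℝ ∞ (chartRep z X) y := by
  have h' := isInvertible_mfderivWithin_extChartAt_symm (I := 𝓡 n) hy
  rw [ModelWithCorners.Boundaryless.range_eq_univ, mfderivWithin_univ] at h'
  have h := ContMDiffAt.mpullback_vectorField_preimage (m := ∞) (n := ∞) hX
    (contMDiffAt_chart_symm hy) h' (by simp)
  rw [contMDiffAt_vectorSpace_iff_contDiffAt] at h
  exact h.congr_of_eventuallyEq (mpullback_eventuallyEq_chartRep hy X).symm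

theorem mlieBracket_modelSpace (V W : (y : EuclideanSpace ℝ (Fin n)) → TangentSpace (𝓡 n) y)
    (y : EuclideanSpace ℝ (Fin n)) :
    VectorField.mlieBracket 𝓘(ℝ, EuclideanSpace ℝ (Fin n)) V W y
      = VectorField.lieBracket ℝ V W y := by
  have h : VectorField.mlieBracket 𝓘(ℝ, EuclideanSpace ℝ (Fin n)) V W y
      = VectorField.lieBracketWithin ℝ V W univ y := by
    rw [← VectorField.mlieBracketWithin_univ, VectorField.mlieBracketWithin_eq_lieBracketWithin]
  exact h.trans (congrFun VectorField.lieBracketWithin_univ y)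

/-- The chart expression is the pullback by the inverse chart, and pullback by a local
diffeomorphism commutes with brackets. -/
theorem lieBracket_chartRep {z x : M} {X Y : VField n M} (hx : x ∈ (extChartAt (𝓡 n) z).source)
    (hX : SmoothVFieldAt X x) (hY : SmoothVFieldAt Y x) :
    VectorField.lieBracket ℝ (chartRep z X) (chartRep z Y) (extChartAt (𝓡 n) z x)
      = chartDeriv z x (bracket X Y x) := by
  have : IsManifold (𝓡 n) (minSmoothness ℝ 2) M := by
    rw [minSmoothness_of_isRCLikeNormedField]; infer_instance
  have hy := (extChartAt (𝓡 n) z).map_source hx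
  have h3 : (extChartAt (𝓡 n) z).symm (extChartAt (𝓡 n) z x) = x := (extChartAt (𝓡 n) z).left_inv hx
  have h := VectorField.mpullback_mlieBracket (n := ∞) (I := 𝓘(ℝ, EuclideanSpace ℝ (Fin n)))
    (I' := 𝓡 n) (f := (extChartAt (𝓡 n) z).symm) (V := X) (W := Y) (x₀ := extChartAt (𝓡 n) z x)
    (by rw [h3]; exact hX.mdifferentiableAt (by simp))
    (by rw [h3]; exact hY.mdifferentiableAt (by simp))
    (contMDiffAt_chart_symm hy) (by
      rw [minSmoothness_of_isRCLikeNormedField]; exact WithTop.coe_le_coe.2 le_top)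
  have h4 := (mpullback_eq_chartRep hy (bracket X Y)).symm.trans
    (h.trans (mlieBracket_modelSpace _ _ _))
  rw [chartRep_apply hx] at h4
  rw [h4]
  refine Filter.EventuallyEq.lieBracket_vectorField_eq ?_ ?_ 
  · exact (mpullback_eventuallyEq_chartRep hy X).symm
  · exact (mpullback_eventuallyEq_chartRep hy Y).symm

theorem bracket_eq_zero_iff {z x : M} {X Y : VField n M} (hx : x ∈ (extChartAt (𝓡 n) z).source)
    (hX : SmoothVFieldAt X x) (hY : SmoothVFieldAt Y x) :
    bracket X Y x = 0 ↔
      VectorField.lieBracket ℝ (chartRep z X) (chartRep z Y) (extChartAt (𝓡 n) z x) = 0 := by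
  rw [lieBracket_chartRep hx hX hY]
  exact ⟨fun h => by rw [h, map_zero], fun h => chartDeriv_injective hx (by rw [h, map_zero])⟩

theorem deriveAlong_eq_of_hasMFDerivAt {f : M → ℝ} {x : M}
    {L : TangentSpace (𝓡 n) x →L[ℝ] ℝ} (hf : HasMFDerivAt (𝓡 n) 𝓘(ℝ, ℝ) f x L) (X : VField n M) :
    deriveAlong X f x = L (X x) := by
  have h : mfderiv (𝓡 n) 𝓘(ℝ, ℝ) f x = L := hf.mfderiv
  exact congrArg (fun L => L (X x)) h

theorem hasMFDerivAt_mvfderiv {f : M → ℝ} {x : M} (hf : MDifferentiableAt (𝓡 n) 𝓘(ℝ, ℝ) f x) :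
    HasMFDerivAt (𝓡 n) 𝓘(ℝ, ℝ) f x (mvfderiv (𝓡 n) f x) := hf.hasMFDerivAt

/-- Derivatives of functions along vector fields can be computed in charts. -/
theorem fderiv_comp_chart_symm {z : M} {y : EuclideanSpace ℝ (Fin n)} {f : M → ℝ}
    (hy : y ∈ (extChartAt (𝓡 n) z).target)
    (hf : MDifferentiableAt (𝓡 n) 𝓘(ℝ, ℝ) f ((extChartAt (𝓡 n) z).symm y)) (X : VField n M) :
    fderiv ℝ (f ∘ (extChartAt (𝓡 n) z).symm) y (chartRep z X y)
      = deriveAlong X f ((extChartAt (𝓡 n) z).symm y) := by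
  have h5 : HasFDerivAt (f ∘ (extChartAt (𝓡 n) z).symm)
      ((mvfderiv (𝓡 n) f ((extChartAt (𝓡 n) z).symm y)).comp (chartSymmDeriv z y)) y :=
    hasMFDerivAt_iff_hasFDerivAt.1
      (HasMFDerivAt.comp y (hasMFDerivAt_mvfderiv hf) (hasMFDerivAt_chart_symm hy))
  rw [h5.fderiv, ContinuousLinearMap.comp_apply, chartSymmDeriv_chartRep hy]
  rfl

/-- The commutator of the two derivations is the derivative along the bracket, so only the bracket
at the point itself matters. This will be applied to the components of the moment map. -/
theorem deriveAlong_deriveAlong_comm {x : M} {X Y : VField n M} {f : M → ℝ}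
    (hX : SmoothVFieldAt X x) (hY : SmoothVFieldAt Y x) (hf : ContMDiff (𝓡 n) 𝓘(ℝ, ℝ) ∞ f)
    (hXY : bracket X Y x = 0) :
    deriveAlong X (deriveAlong Y f) x = deriveAlong Y (deriveAlong X f) x := by
  have hx := mem_extChartAt_source (I := 𝓡 n) x
  have hy := (extChartAt (𝓡 n) x).map_source hx
  have h3 : (extChartAt (𝓡 n) x).symm (extChartAt (𝓡 n) x x) = x := (extChartAt (𝓡 n) x).left_inv hx
  set y := extChartAt (𝓡 n) x x
  have hfd : ∀ w, MDifferentiableAt (𝓡 n) 𝓘(ℝ, ℝ) f w := fun w => (hf w).mdifferentiableAt (by simp)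
  have hX' := SmoothVFieldAt.chartRep hy (by rwa [h3] : SmoothVFieldAt X _)
  have hY' := SmoothVFieldAt.chartRep hy (by rwa [h3] : SmoothVFieldAt Y _)
  set g := f ∘ (extChartAt (𝓡 n) x).symm with hg
  have hgs : ContDiffAt ℝ ∞ g y := by
    have := ContMDiffAt.comp y (hf _) (contMDiffAt_chart_symm hy)
    exact contMDiffAt_iff_contDiffAt.1 this
  have hkey : ∀ X Y : VField n M, ContDiffAt ℝ ∞ (chartRep x Y) y →
      deriveAlong X (deriveAlong Y f) x
        = fderiv ℝ (fun w => fderiv ℝ g w (chartRep x Y w)) y (chartRep x X y) := by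
    intro X Y hY
    have h1 : (fun w => fderiv ℝ g w (chartRep x Y w)) =ᶠ[𝓝 y]
        (deriveAlong Y f) ∘ (extChartAt (𝓡 n) x).symm := by
      filter_upwards [chart_target_mem_nhds hy] with w hw
      exact fderiv_comp_chart_symm hw (hfd _) Y
    have h2 : ContDiffAt ℝ ∞ (fun w => fderiv ℝ g w (chartRep x Y w)) y :=
      (hgs.fderiv_right (by simp)).clm_apply hY
    have h4 : MDifferentiableAt (𝓡 n) 𝓘(ℝ, ℝ) (deriveAlong Y f) x := by
      have h5 : (fun w => fderiv ℝ g w (chartRep x Y w)) ∘ extChartAt (𝓡 n) x =ᶠ[𝓝 x]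
          deriveAlong Y f := by
        filter_upwards [extChartAt_source_mem_nhds (I := 𝓡 n) x] with w hw
        have := fderiv_comp_chart_symm ((extChartAt (𝓡 n) x).map_source hw) (hfd _) Y
        rw [(extChartAt (𝓡 n) x).left_inv hw] at this
        exact this
      refine MDifferentiableAt.congr_of_eventuallyEq ?_ h5.symm
      refine MDifferentiableAt.comp x (h2.differentiableAt (by simp)).mdifferentiableAt
        (hasMFDerivAt_chart hx).mdifferentiableAt
    rw [h1.fderiv_eq, fderiv_comp_chart_symm hy (by rwa [h3]), h3]
  rw [hkey X Y hY', hkey Y X hX', ← sub_eq_zero,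
    fderiv_fderiv_apply_sub (hgs.of_le (by exact WithTop.coe_le_coe.2 le_top))
      (hX'.differentiableAt (by simp)) (hY'.differentiableAt (by simp)),
    (bracket_eq_zero_iff hx hX hY).1 hXY, map_zero]

end LocalRepresentation

/-! ### The exponential map of the torus. -/

section Torus

variable {m : ℕ}

theorem torusExp_add (ξ η : Fin m → ℝ) : torusExp (ξ + η) = torusExp ξ * torusExp η := by
  ext i; simp [torusExp]

theorem torusExp_zero : torusExp (0 : Fin m → ℝ) = 1 := by
  ext i; simp [torusExp]

theorem torusExp_surjective : Function.Surjective (torusExp (m := m)) := by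
  intro t
  choose ξ hξ using fun i => Circle.exp_surjective (t i)
  exact ⟨ξ, funext hξ⟩

end Torus

/-! ### Smoothness of fields through charts, and velocities of curves. -/

section Sections

variable {n : ℕ} {M : Type*} [TopologicalSpace M] [ChartedSpace (EuclideanSpace ℝ (Fin n)) M]
  [IsManifold (𝓡 n) ∞ M]

theorem smoothVFieldAt_of_chartRep {X : VField n M} {x : M}
    (h : ContDiffAt ℝ ∞ (chartRep x X) (extChartAt (𝓡 n) x x)) : SmoothVFieldAt X x := by
  rw [SmoothVFieldAt, Bundle.contMDiffAt_section]
  have h1 : ContMDiffAt (𝓡 n) 𝓘(ℝ, EuclideanSpace ℝ (Fin n)) ∞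
      (chartRep x X ∘ extChartAt (𝓡 n) x) x :=
    h.contMDiffAt.comp x (contMDiffAt_chart (mem_extChartAt_source x))
  refine h1.congr_of_eventuallyEq ?_
  filter_upwards [extChartAt_source_mem_nhds (I := 𝓡 n) x] with w hw
  rw [Function.comp_apply, chartRep_apply hw]
  have hw' : w ∈ (trivializationAt (EuclideanSpace ℝ (Fin n)) (TangentSpace (𝓡 n)) x).baseSet := by
    rw [TangentBundle.trivializationAt_baseSet]
    rwa [extChartAt_source] at hw
  have h2 := TangentBundle.continuousLinearMapAt_trivializationAt (I := 𝓡 n) (x₀ := x) (x := w)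
    (by rwa [extChartAt_source] at hw)
  have h3 := congrArg (fun L => L (X w)) h2
  rw [← Bundle.Trivialization.continuousLinearMapAt_apply_of_mem (R := ℝ) _ hw']
  exact h3

/-- The velocity of a curve. -/
def HasVelocity {M : Type*} [TopologicalSpace M] [ChartedSpace (EuclideanSpace ℝ (Fin n)) M]
    (γ : ℝ → M) (s : ℝ) (v : EuclideanSpace ℝ (Fin n)) : Prop :=
  HasMFDerivAt 𝓘(ℝ, ℝ) (𝓡 n) γ s ((1 : ℝ →L[ℝ] ℝ).smulRight v)

variable {γ : ℝ → M} {s : ℝ} {v w : EuclideanSpace ℝ (Fin n)}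

theorem HasVelocity.unique (h : HasVelocity γ s v) (h' : HasVelocity γ s w) : v = w := by
  have h1 := hasMFDerivAt_unique h h'
  have h2 : (1 : ℝ) • v = (1 : ℝ) • w := congrArg (fun L => L (1 : ℝ)) h1
  simpa using h2

theorem hasVelocity_of_hasMFDerivAt {L : TangentSpace 𝓘(ℝ, ℝ) s →L[ℝ] TangentSpace (𝓡 n) (γ s)}
    (h : HasMFDerivAt 𝓘(ℝ, ℝ) (𝓡 n) γ s L) (hv : L (1 : ℝ) = v) : HasVelocity γ s v := by
  have h2 : L = ((1 : ℝ →L[ℝ] ℝ).smulRight v : ℝ →L[ℝ] EuclideanSpace ℝ (Fin n)) := by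
    refine ContinuousLinearMap.ext_ring ?_
    exact hv.trans (one_smul ℝ v).symm
  exact Eq.mp (congrArg (HasMFDerivAt 𝓘(ℝ, ℝ) (𝓡 n) γ s) h2) h

theorem HasVelocity.congr_velocity (h : HasVelocity γ s v) (hvw : v = w) : HasVelocity γ s w :=
  hvw ▸ h

theorem HasVelocity.comp {f : M → M} (h : HasVelocity γ s v)
    {L : TangentSpace (𝓡 n) (γ s) →L[ℝ] TangentSpace (𝓡 n) (f (γ s))}
    (hf : HasMFDerivAt (𝓡 n) (𝓡 n) f (γ s) L) : HasVelocity (f ∘ γ) s (L v) := by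
  refine hasVelocity_of_hasMFDerivAt (HasMFDerivAt.comp s hf h) ?_
  exact congrArg L (one_smul ℝ v)

theorem HasVelocity.hasDerivAt_comp {F : Type*} [NormedAddCommGroup F] [NormedSpace ℝ F] {f : M → F}
    (h : HasVelocity γ s v) {L : TangentSpace (𝓡 n) (γ s) →L[ℝ] F}
    (hf : HasMFDerivAt (𝓡 n) 𝓘(ℝ, F) f (γ s) L) : HasDerivAt (f ∘ γ) (L v) s := by
  let L' : EuclideanSpace ℝ (Fin n) →L[ℝ] F := L
  have h1 : HasFDerivAt (f ∘ γ) (L'.comp ((1 : ℝ →L[ℝ] ℝ).smulRight v)) s :=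
    hasMFDerivAt_iff_hasFDerivAt.1 (HasMFDerivAt.comp s hf h)
  have h2 : L' ((1 : ℝ) • v) = L' v := congrArg L' (one_smul ℝ v)
  exact h1.hasDerivAt.congr_deriv h2

theorem HasVelocity.comp_add_const {a : ℝ} (h : HasVelocity γ (s + a) v) :
    HasVelocity (fun r => γ (r + a)) s v := by
  have h3 : HasMFDerivAt 𝓘(ℝ, ℝ) 𝓘(ℝ, ℝ) (fun r : ℝ => r + a) s (ContinuousLinearMap.id ℝ ℝ) :=
    hasMFDerivAt_iff_hasFDerivAt.2 ((hasFDerivAt_id s).add_const a)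
  exact HasMFDerivAt.comp (f := fun r : ℝ => r + a) (g := γ) s h h3

theorem hasVelocity_chart_symm {z : M} {c : ℝ → EuclideanSpace ℝ (Fin n)}
    (hc : HasDerivAt c v s) (hs : c s ∈ (extChartAt (𝓡 n) z).target) :
    HasVelocity (fun r => (extChartAt (𝓡 n) z).symm (c r)) s (chartSymmDeriv z (c s) v) := by
  refine hasVelocity_of_hasMFDerivAt (HasMFDerivAt.comp s (hasMFDerivAt_chart_symm hs)
    (hasMFDerivAt_iff_hasFDerivAt.2 hc.hasFDerivAt)) ?_
  exact congrArg (chartSymmDeriv z (c s)) (one_smul ℝ v)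

theorem isMIntegralCurve_iff_hasVelocity {X : VField n M} :
    IsMIntegralCurve (I := 𝓡 n) γ X ↔ ∀ s, HasVelocity γ s (X (γ s)) := Iff.rfl

end Sections

/-! ### The torus action: its flow, its linearization and invariant fields. -/

section Action

variable {n m : ℕ} {M : Type*} [TopologicalSpace M] [ChartedSpace (EuclideanSpace ℝ (Fin n)) M]
  [IsManifold (𝓡 n) ∞ M] [MulAction (Torus m) M]

/-- Smoothness of the action of the torus, on the universal cover. -/
abbrev SmoothTorusAction (n m : ℕ) (M : Type*) [TopologicalSpace M]
    [ChartedSpace (EuclideanSpace ℝ (Fin n)) M] [MulAction (Torus m) M] : Prop :=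
  ContMDiff (𝓘(ℝ, Fin m → ℝ).prod (𝓡 n)) (𝓡 n) ∞
    (fun q : (Fin m → ℝ) × M => torusExp q.1 • q.2)

theorem torusExp_add_smul (ξ η : Fin m → ℝ) (x : M) :
    torusExp (ξ + η) • x = torusExp ξ • torusExp η • x := by
  rw [torusExp_add, mul_smul]

theorem torusExp_zero_smul (x : M) : torusExp (0 : Fin m → ℝ) • x = x := by
  rw [torusExp_zero, one_smul]

/-- The differential of the action of `t` at `x`. -/
def actDeriv (t : Torus m) (x : M) : TangentSpace (𝓡 n) x →L[ℝ] TangentSpace (𝓡 n) (t • x) :=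
  mfderiv (𝓡 n) (𝓡 n) (fun y : M => t • y) x

theorem contMDiff_torus_smul (hact : SmoothTorusAction n m M) (t : Torus m) :
    ContMDiff (𝓡 n) (𝓡 n) ∞ (fun y : M => t • y) := by
  obtain ⟨ξ, rfl⟩ := torusExp_surjective t
  exact hact.comp (contMDiff_const.prodMk contMDiff_id)

theorem hasMFDerivAt_torus_smul (hact : SmoothTorusAction n m M) (t : Torus m) (x : M) :
    HasMFDerivAt (𝓡 n) (𝓡 n) (fun y : M => t • y) x (actDeriv t x) :=
  ((contMDiff_torus_smul hact t x).mdifferentiableAt (by simp)).hasMFDerivAt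

theorem contMDiff_torusExp_smul (hact : SmoothTorusAction n m M) (ξ : Fin m → ℝ) (x : M) :
    ContMDiff 𝓘(ℝ, ℝ) (𝓡 n) ∞ (fun s : ℝ => torusExp (s • ξ) • x) := by
  have h : ContMDiff 𝓘(ℝ, ℝ) 𝓘(ℝ, Fin m → ℝ) ∞ (fun s : ℝ => s • ξ) :=
    (contDiff_id.smul contDiff_const).contMDiff
  exact hact.comp (h.prodMk contMDiff_const)

theorem hasVelocity_torusExp_zero (hact : SmoothTorusAction n m M) (ξ : Fin m → ℝ) (x : M) :
    HasVelocity (fun s : ℝ => torusExp (s • ξ) • x) 0 (infAction (n := n) ξ x) := by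
  have h := ((contMDiff_torusExp_smul hact ξ x 0).mdifferentiableAt (by simp)).hasMFDerivAt
  refine hasVelocity_of_hasMFDerivAt h ?_
  rfl

theorem hasVelocity_torusExp (hact : SmoothTorusAction n m M) (ξ : Fin m → ℝ) (x : M) (s : ℝ) :
    HasVelocity (fun s : ℝ => torusExp (s • ξ) • x) s (infAction (n := n) ξ (torusExp (s • ξ) • x)) := by
  have h0 : ∀ r, r = 0 → HasVelocity (fun s' : ℝ => torusExp (s' • ξ) • torusExp (s • ξ) • x) r
      (infAction (n := n) ξ (torusExp (s • ξ) • x)) := by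
    rintro _ rfl; exact hasVelocity_torusExp_zero hact ξ (torusExp (s • ξ) • x)
  have h2 : (fun r : ℝ => torusExp (r • ξ) • x) =
      fun r : ℝ => torusExp ((r + -s) • ξ) • torusExp (s • ξ) • x := by
    funext r
    rw [← torusExp_add_smul, ← add_smul, neg_add_cancel_right]
  have h3 := (h0 _ (add_neg_cancel s)).comp_add_const
  rwa [← h2] at h3

theorem isMIntegralCurve_torusExp (hact : SmoothTorusAction n m M) (ξ : Fin m → ℝ) (x : M) :
    IsMIntegralCurve (I := 𝓡 n) (fun s : ℝ => torusExp (s • ξ) • x) (infAction (n := n) ξ) :=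
  isMIntegralCurve_iff_hasVelocity.2 (hasVelocity_torusExp hact ξ x)

/-- The torus is commutative, so each of its elements carries integral curves of `ξ^♯` to integral
curves of `ξ^♯`. -/
theorem actDeriv_infAction (hact : SmoothTorusAction n m M) (t : Torus m) (ξ : Fin m → ℝ) (x : M) :
    actDeriv t x (infAction (n := n) ξ x) = (infAction (n := n) ξ (t • x) : TangentSpace (𝓡 n) (t • x)) := by
  have h1 := hasVelocity_torusExp_zero hact ξ x
  have h0 : ∀ x', x' = x → HasMFDerivAt (𝓡 n) (𝓡 n) (fun y : M => t • y) x' (actDeriv t x) := by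
    rintro _ rfl; exact hasMFDerivAt_torus_smul hact t _
  have h2 := h1.comp (h0 _ (by simp only [zero_smul]; exact torusExp_zero_smul x))
  have h3 : (fun y : M => t • y) ∘ (fun s : ℝ => torusExp (s • ξ) • x) =
      fun s : ℝ => torusExp (s • ξ) • t • x := by
    funext s
    simp only [Function.comp_apply]
    rw [← mul_smul, ← mul_smul, mul_comm]
  rw [h3] at h2
  exact h2.unique (hasVelocity_torusExp_zero hact ξ (t • x))

section Chart

variable (z : M) (ξ : Fin m → ℝ)

/-- The local flow of `ξ^♯` in the chart at `z`. -/
def chartAct (s : ℝ) (y : EuclideanSpace ℝ (Fin n)) : EuclideanSpace ℝ (Fin n) :=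
  extChartAt (𝓡 n) z (torusExp (s • ξ) • (extChartAt (𝓡 n) z).symm y)

variable {z ξ}

theorem chartAct_zero {y : EuclideanSpace ℝ (Fin n)} (hy : y ∈ (extChartAt (𝓡 n) z).target) :
    chartAct z ξ 0 y = y := by
  rw [chartAct, zero_smul, torusExp_zero_smul, (extChartAt (𝓡 n) z).right_inv hy]

theorem contDiffAt_chartAct (hact : SmoothTorusAction n m M) {s : ℝ} {y : EuclideanSpace ℝ (Fin n)}
    (hy : y ∈ (extChartAt (𝓡 n) z).target)
    (hs : torusExp (s • ξ) • (extChartAt (𝓡 n) z).symm y ∈ (extChartAt (𝓡 n) z).source) :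
    ContDiffAt ℝ ∞ (fun q : ℝ × EuclideanSpace ℝ (Fin n) => chartAct z ξ q.1 q.2) (s, y) := by
  have h1 : ContMDiffAt 𝓘(ℝ, ℝ × EuclideanSpace ℝ (Fin n)) 𝓘(ℝ, Fin m → ℝ) ∞
      (fun q : ℝ × EuclideanSpace ℝ (Fin n) => q.1 • ξ) (s, y) :=
    (contDiff_fst.smul contDiff_const).contMDiff _
  have h2 : ContMDiffAt 𝓘(ℝ, ℝ × EuclideanSpace ℝ (Fin n)) (𝓡 n) ∞
      (fun q : ℝ × EuclideanSpace ℝ (Fin n) => (extChartAt (𝓡 n) z).symm q.2) (s, y) :=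
    ContMDiffAt.comp (s, y) (g := (extChartAt (𝓡 n) z).symm) (f := Prod.snd)
      (contMDiffAt_chart_symm hy) (contDiff_snd.contMDiff _)
  have h3 := ContMDiffAt.comp (s, y) (hact _) (h1.prodMk h2)
  exact (ContMDiffAt.comp (s, y) (contMDiffAt_chart hs) h3).contDiffAt

theorem hasFDerivAt_chartAct (hact : SmoothTorusAction n m M) {s : ℝ}
    {y : EuclideanSpace ℝ (Fin n)} (hy : y ∈ (extChartAt (𝓡 n) z).target)
    (hs : torusExp (s • ξ) • (extChartAt (𝓡 n) z).symm y ∈ (extChartAt (𝓡 n) z).source) :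
    HasFDerivAt (chartAct z ξ s) (chartDeriv z _ ∘L actDeriv (torusExp (s • ξ)) _ ∘L
      chartSymmDeriv z y) y := by
  refine hasMFDerivAt_iff_hasFDerivAt.1 ?_
  exact HasMFDerivAt.comp y (hasMFDerivAt_chart hs)
    (HasMFDerivAt.comp y (hasMFDerivAt_torus_smul hact _ _) (hasMFDerivAt_chart_symm hy))

theorem hasDerivAt_chartAct_zero (hact : SmoothTorusAction n m M) {y : EuclideanSpace ℝ (Fin n)}
    (hy : y ∈ (extChartAt (𝓡 n) z).target) :
    HasDerivAt (fun s => chartAct z ξ s y) (chartRep z (infAction (n := n) ξ) y) 0 := by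
  have h0 : ∀ x', x' = (extChartAt (𝓡 n) z).symm y → HasMFDerivAt (𝓡 n)
      𝓘(ℝ, EuclideanSpace ℝ (Fin n)) (extChartAt (𝓡 n) z) x'
      (chartDeriv z ((extChartAt (𝓡 n) z).symm y)) := by
    rintro _ rfl; exact hasMFDerivAt_chart ((extChartAt (𝓡 n) z).map_target hy)
  exact (hasVelocity_torusExp_zero hact ξ ((extChartAt (𝓡 n) z).symm y)).hasDerivAt_comp
    (h0 _ (by simp only [zero_smul]; exact torusExp_zero_smul _))

theorem eventually_chartAct_mem (hact : SmoothTorusAction n m M) {y : EuclideanSpace ℝ (Fin n)}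
    (hy : y ∈ (extChartAt (𝓡 n) z).target) :
    ∀ᶠ s : ℝ in 𝓝 0,
      torusExp (s • ξ) • (extChartAt (𝓡 n) z).symm y ∈ (extChartAt (𝓡 n) z).source := by
  have h := (contMDiff_torusExp_smul hact ξ ((extChartAt (𝓡 n) z).symm y)).continuous.continuousAt
    (x := 0)
  refine h.eventually_mem ?_
  rw [zero_smul, torusExp_zero_smul]
  exact (isOpen_extChartAt_source z).mem_nhds ((extChartAt (𝓡 n) z).map_target hy)

theorem contDiffAt_chartRep_infAction (hact : SmoothTorusAction n m M)
    {y : EuclideanSpace ℝ (Fin n)} (hy : y ∈ (extChartAt (𝓡 n) z).target) :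
    ContDiffAt ℝ ∞ (chartRep z (infAction (n := n) ξ)) y := by
  have hz : ∀ w ∈ (extChartAt (𝓡 n) z).target,
      ContDiffAt ℝ ∞ (fun q : ℝ × EuclideanSpace ℝ (Fin n) => chartAct z ξ q.1 q.2) (0, w) :=
    fun w hw => contDiffAt_chartAct hact hw (by
      rw [zero_smul, torusExp_zero_smul]; exact (extChartAt (𝓡 n) z).map_target hw)
  have h1 : chartRep z (infAction (n := n) ξ) =ᶠ[𝓝 y] fun w =>
      fderiv ℝ (fun q : ℝ × EuclideanSpace ℝ (Fin n) => chartAct z ξ q.1 q.2) (0, w) (1, 0) := by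
    filter_upwards [chart_target_mem_nhds hy] with w hw
    have h4 : HasDerivAt (fun s : ℝ => (s, w)) ((1 : ℝ), (0 : EuclideanSpace ℝ (Fin n))) 0 := by
      simpa using (hasDerivAt_id (0 : ℝ)).prodMk (hasDerivAt_const (0 : ℝ) w)
    exact (hasDerivAt_chartAct_zero hact hw).unique
      (((hz w hw).differentiableAt (by simp)).hasFDerivAt.comp_hasDerivAt
        (f := fun s : ℝ => (s, w)) 0 h4)
  refine ContDiffAt.congr_of_eventuallyEq ?_ h1
  have h2 : ContDiffAt ℝ ∞
      (fderiv ℝ (fun q : ℝ × EuclideanSpace ℝ (Fin n) => chartAct z ξ q.1 q.2)) (0, y) :=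
    (hz y hy).fderiv_right (by simp)
  have h3 : ContDiffAt ℝ ∞ (fun w : EuclideanSpace ℝ (Fin n) => ((0 : ℝ), w)) y :=
    contDiffAt_const.prodMk contDiffAt_id
  exact (h2.comp y h3).clm_apply contDiffAt_const

theorem hasDerivAt_fderiv_chartAct (hact : SmoothTorusAction n m M)
    {y : EuclideanSpace ℝ (Fin n)} (hy : y ∈ (extChartAt (𝓡 n) z).target) :
    HasDerivAt (fun s => fderiv ℝ (chartAct z ξ s) y) (fderiv ℝ (chartRep z (infAction (n := n) ξ)) y) 0 := by
  refine hasDerivAt_fderiv_of_contDiffAt ((contDiffAt_chartAct hact hy ?_).of_le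
    (by exact WithTop.coe_le_coe.2 le_top)) ?_
  · rw [zero_smul, torusExp_zero_smul]; exact (extChartAt (𝓡 n) z).map_target hy
  · filter_upwards [chart_target_mem_nhds hy] with w hw using hasDerivAt_chartAct_zero hact hw

end Chart

theorem smoothVFieldAt_infAction (hact : SmoothTorusAction n m M) (ξ : Fin m → ℝ) (x : M) :
    SmoothVFieldAt (infAction (n := n) ξ) x :=
  smoothVFieldAt_of_chartRep
    (contDiffAt_chartRep_infAction hact (mem_extChartAt_target (I := 𝓡 n) x))

/-- Vector fields invariant under the torus commute with the infinitesimal action. -/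
theorem bracket_infAction_eq_zero (hact : SmoothTorusAction n m M) (ξ : Fin m → ℝ) {X : VField n M}
    {x : M} (hX : SmoothVFieldAt X x) (hinv : ∀ t : Torus m, actDeriv t x (X x) = X (t • x)) :
    bracket (infAction (n := n) ξ) X x = 0 := by
  have hx := mem_extChartAt_source (I := 𝓡 n) x
  have hy := mem_extChartAt_target (I := 𝓡 n) x
  have hxy : (extChartAt (𝓡 n) x).symm (extChartAt (𝓡 n) x x) = x := (extChartAt (𝓡 n) x).left_inv hx
  rw [bracket_eq_zero_iff hx (smoothVFieldAt_infAction hact ξ x) hX]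
  set y := extChartAt (𝓡 n) x x with hydef
  have hX' : ContDiffAt ℝ ∞ (chartRep x X) y := SmoothVFieldAt.chartRep hy (by rwa [hxy])
  -- By invariance, the field along the orbit is the linearized flow applied to its initial value.
  -- Differentiating the two sides at `s = 0` gives the two terms of the bracket.
  have h1 : (fun s => chartRep x X (chartAct x ξ s y)) =ᶠ[𝓝 0]
      fun s => fderiv ℝ (chartAct x ξ s) y (chartRep x X y) := by
    filter_upwards [eventually_chartAct_mem (ξ := ξ) hact hy] with s hs
    rw [(hasFDerivAt_chartAct hact hy hs).fderiv]
    simp only [ContinuousLinearMap.comp_apply]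
    rw [chartSymmDeriv_chartRep hy, chartAct, chartRep_apply hs]
    congr 1
    have : ∀ x', x' = x → X (torusExp (s • ξ) • x') = actDeriv (torusExp (s • ξ)) x' (X x') := by
      rintro _ rfl; exact (hinv _).symm
    exact this _ hxy
  have h2 : HasDerivAt (fun s => chartRep x X (chartAct x ξ s y))
      (fderiv ℝ (chartRep x X) y (chartRep x (infAction (n := n) ξ) y)) 0 := by
    have h3 := (hX'.differentiableAt (by simp)).hasFDerivAt
    rw [← chartAct_zero (z := x) (ξ := ξ) hy] at h3
    have h4 := h3.comp_hasDerivAt (0 : ℝ) (hasDerivAt_chartAct_zero hact hy)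
    rw [chartAct_zero hy] at h4
    exact h4
  have h3 := ((hasDerivAt_fderiv_chartAct (ξ := ξ) hact hy).clm_apply
    (hasDerivAt_const (0 : ℝ) (chartRep x X y))).congr_of_eventuallyEq h1
  have h4 := h2.unique h3
  simp only [map_zero, add_zero] at h4
  rw [VectorField.lieBracket, h4, sub_self]

/-- The expression of a field of endomorphisms in the chart at `z`. -/
def chartEnd (z : M) (J : EndField n M) (y : EuclideanSpace ℝ (Fin n)) :
    EuclideanSpace ℝ (Fin n) →L[ℝ] EuclideanSpace ℝ (Fin n) :=
  chartDeriv z _ ∘L J ((extChartAt (𝓡 n) z).symm y) ∘L chartSymmDeriv z y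

theorem chartEnd_chartDeriv {J : EndField n M} {z : M} {y : EuclideanSpace ℝ (Fin n)}
    (hy : y ∈ (extChartAt (𝓡 n) z).target)
    (v : TangentSpace (𝓡 n) ((extChartAt (𝓡 n) z).symm y)) :
    chartEnd z J y (chartDeriv z _ v) = chartDeriv z _ (J _ v) := by
  have h := congrArg (fun u => chartDeriv z _ (J ((extChartAt (𝓡 n) z).symm y) u))
    (chartSymmDeriv_chartDeriv hy v)
  exact h

/-- At a fixed point of a one parameter group, the linearized action commutes with any invariant
endomorphism. -/
theorem fderiv_chartRep_infAction_comm (hact : SmoothTorusAction n m M) (ξ : Fin m → ℝ)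
    {J : EndField n M} (hJ : InvariantEnd m J) {z : M} {y : EuclideanSpace ℝ (Fin n)}
    (hy : y ∈ (extChartAt (𝓡 n) z).target)
    (hfix : ∀ s : ℝ, torusExp (s • ξ) • (extChartAt (𝓡 n) z).symm y = (extChartAt (𝓡 n) z).symm y)
    (u : EuclideanSpace ℝ (Fin n)) :
    fderiv ℝ (chartRep z (infAction (n := n) ξ)) y (chartEnd z J y u) =
      chartEnd z J y (fderiv ℝ (chartRep z (infAction (n := n) ξ)) y u) := by
  -- At a fixed point the linearized flow is an endomorphism of one tangent space, and invariance of
  -- `J` says that it commutes with `J`. The claim is the derivative of this identity at `s = 0`.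
  have h1 : ∀ s, fderiv ℝ (chartAct z ξ s) y (chartEnd z J y u) =
      chartEnd z J y (fderiv ℝ (chartAct z ξ s) y u) := by
    intro s
    rw [(hasFDerivAt_chartAct hact hy (by
      rw [hfix]; exact (extChartAt (𝓡 n) z).map_target hy)).fderiv]
    have h2 := chartSymmDeriv_chartDeriv hy (J _ (chartSymmDeriv z y u))
    have h3 := hJ (torusExp (s • ξ)) _ (chartSymmDeriv z y u)
    have h4 : ∀ x', x' = (extChartAt (𝓡 n) z).symm y → ∀ v : TangentSpace (𝓡 n) x',
        chartEnd z J y (chartDeriv z x' v) = chartDeriv z x' (J x' v) := by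
      rintro _ rfl; exact chartEnd_chartDeriv hy
    have h5 := h4 _ (hfix s) (actDeriv (torusExp (s • ξ)) _ (chartSymmDeriv z y u))
    refine Eq.trans ?_ h5.symm
    exact congrArg (chartDeriv z _) ((congrArg (actDeriv (torusExp (s • ξ)) _) h2).trans h3)
  have h2 := (hasDerivAt_fderiv_chartAct (ξ := ξ) hact hy).clm_apply
    (hasDerivAt_const (0 : ℝ) (chartEnd z J y u))
  have h3 := (chartEnd z J y).hasFDerivAt.comp_hasDerivAt (0 : ℝ)
    ((hasDerivAt_fderiv_chartAct (ξ := ξ) hact hy).clm_apply (hasDerivAt_const (0 : ℝ) u))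
  have h4 := h2.unique (h3.congr_of_eventuallyEq (Eventually.of_forall h1))
  simpa using h4

end Action

/-! ### Stability of smoothness for vector fields. -/

section Smooth

variable {n : ℕ} {M : Type*} [TopologicalSpace M] [ChartedSpace (EuclideanSpace ℝ (Fin n)) M]
  [IsManifold (𝓡 n) ∞ M]

theorem SmoothVFieldAt.add {X Y : VField n M} {x : M} (hX : SmoothVFieldAt X x)
    (hY : SmoothVFieldAt Y x) : SmoothVFieldAt (fun y => X y + Y y) x :=
  ContMDiffAt.add_section hX hY

theorem SmoothVFieldAt.smul {f : M → ℝ} {X : VField n M} {x : M}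
    (hf : ContMDiffAt (𝓡 n) 𝓘(ℝ, ℝ) ∞ f x) (hX : SmoothVFieldAt X x) :
    SmoothVFieldAt (fun y => f y • X y) x :=
  ContMDiffAt.smul_section hf hX

theorem SmoothVFieldAt.endField_apply {A : EndField n M} (hA : SmoothEndField A) {X : VField n M}
    {x : M} (hX : SmoothVFieldAt X x) : SmoothVFieldAt (fun y => A y (X y)) x :=
  ContMDiffAt.clm_bundle_apply (hA x) hX

theorem SmoothVFieldAt.congr {X Y : VField n M} {x : M} (hX : SmoothVFieldAt X x)
    (h : ∀ᶠ y in 𝓝 x, Y y = X y) : SmoothVFieldAt Y x :=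
  ContMDiffAt.congr_of_eventuallyEq hX (h.mono fun y hy => by simp only [hy])

theorem contMDiffAt_deriveAlong {f : M → ℝ} (hf : ContMDiff (𝓡 n) 𝓘(ℝ, ℝ) ∞ f) {X : VField n M}
    {x : M} (hX : SmoothVFieldAt X x) :
    ContMDiffAt (𝓡 n) 𝓘(ℝ, ℝ) ∞ (deriveAlong X f) x := by
  have hx := mem_extChartAt_source (I := 𝓡 n) x
  have hy := (extChartAt (𝓡 n) x).map_source hx
  have hX' : ContDiffAt ℝ ∞ (chartRep x X) (extChartAt (𝓡 n) x x) :=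
    SmoothVFieldAt.chartRep hy (by rwa [(extChartAt (𝓡 n) x).left_inv hx])
  have hg : ContDiffAt ℝ ∞ (f ∘ (extChartAt (𝓡 n) x).symm) (extChartAt (𝓡 n) x x) :=
    contMDiffAt_iff_contDiffAt.1 (ContMDiffAt.comp _ (hf _) (contMDiffAt_chart_symm hy))
  have h := ((hg.fderiv_right (m := ∞) (by simp)).clm_apply hX').contMDiffAt.comp x
    (contMDiffAt_chart hx)
  refine h.congr_of_eventuallyEq ?_
  filter_upwards [extChartAt_source_mem_nhds (I := 𝓡 n) x] with w hw
  have h2 := fderiv_comp_chart_symm ((extChartAt (𝓡 n) x).map_source hw)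
    ((hf _).mdifferentiableAt (by simp)) X
  rw [(extChartAt (𝓡 n) x).left_inv hw] at h2
  exact h2.symm

end Smooth

/-! ### Consequences of the Hamiltonian equation. -/

section Hamiltonian

variable {n m : ℕ} {M : Type*} [TopologicalSpace M] [ChartedSpace (EuclideanSpace ℝ (Fin n)) M]
  [IsManifold (𝓡 n) ∞ M] [MulAction (Torus m) M] {Ω : SymplecticForm n M} {μ : M → Fin m → ℝ}

/-- The differential of the moment map. -/
def momentDeriv (μ : M → Fin m → ℝ) (x : M) : TangentSpace (𝓡 n) x →L[ℝ] (Fin m → ℝ) :=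
  mfderiv (𝓡 n) 𝓘(ℝ, Fin m → ℝ) μ x

variable (hμ : IsHamiltonianToric Ω μ)
include hμ

theorem hasMFDerivAt_moment (x : M) :
    HasMFDerivAt (𝓡 n) 𝓘(ℝ, Fin m → ℝ) μ x (momentDeriv μ x) :=
  ((hμ.smooth_moment x).mdifferentiableAt (by simp)).hasMFDerivAt

theorem contMDiff_moment_apply (i : Fin m) : ContMDiff (𝓡 n) 𝓘(ℝ, ℝ) ∞ (fun y => μ y i) :=
  (ContinuousLinearMap.proj (R := ℝ) (φ := fun _ : Fin m => ℝ) i).contDiff.contMDiff.comp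
    hμ.smooth_moment

theorem deriveAlong_moment (X : VField n M) (i : Fin m) (x : M) :
    deriveAlong X (fun y => μ y i) x = momentDeriv μ x (X x) i := by
  have h1 : HasMFDerivAt 𝓘(ℝ, Fin m → ℝ) 𝓘(ℝ, ℝ) (fun p : Fin m → ℝ => p i) (μ x)
      (ContinuousLinearMap.proj (R := ℝ) (φ := fun _ : Fin m => ℝ) i) :=
    hasMFDerivAt_iff_hasFDerivAt.2
      (ContinuousLinearMap.proj (R := ℝ) (φ := fun _ : Fin m => ℝ) i).hasFDerivAt
  exact deriveAlong_eq_of_hasMFDerivAt (HasMFDerivAt.comp x h1 (hasMFDerivAt_moment hμ x)) X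

theorem form_infAction (ξ : Fin m → ℝ) (x : M) (v : TangentSpace (𝓡 n) x) :
    Ω.form x (infAction ξ x) v = - ∑ i, ξ i * momentDeriv μ x v i := by
  let ℓ : (Fin m → ℝ) →L[ℝ] ℝ :=
    ∑ i, ξ i • ContinuousLinearMap.proj (R := ℝ) (φ := fun _ : Fin m => ℝ) i
  have hℓ : ∀ p, ℓ p = ∑ i, ξ i * p i := fun p => by simp [ℓ]
  have h1 : HasMFDerivAt 𝓘(ℝ, Fin m → ℝ) 𝓘(ℝ, ℝ) ℓ (μ x) ℓ :=
    hasMFDerivAt_iff_hasFDerivAt.2 ℓ.hasFDerivAt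
  have h2 := HasMFDerivAt.comp x h1 (hasMFDerivAt_moment hμ x)
  have h3 : ℓ ∘ μ = fun y => ∑ i, ξ i * μ y i := funext fun y => hℓ _
  rw [h3] at h2
  have h4 : mfderiv (𝓡 n) 𝓘(ℝ, ℝ) (fun y => ∑ i, ξ i * μ y i) x = ℓ ∘L momentDeriv μ x := h2.mfderiv
  rw [hμ.hamiltonian, ← hℓ]
  exact congrArg Neg.neg (congrArg (fun L => L v) h4)

theorem form_infAction_single (i : Fin m) (x : M) (v : TangentSpace (𝓡 n) x) :
    Ω.form x (infAction (Pi.single i 1) x) v = - momentDeriv μ x v i := by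
  rw [form_infAction hμ]
  simp [Pi.single_apply]

/-- The Hamiltonian equation is linear in `ξ`, and nondegeneracy transfers this linearity to `ξ^♯`.
-/
theorem infAction_eq_sum (ξ : Fin m → ℝ) (x : M) :
    infAction (n := n) ξ x = ∑ i, ξ i • (infAction (n := n) (Pi.single i (1 : ℝ)) x) := by
  refine sub_eq_zero.1 (Ω.nondegenerate x _ fun v => ?_)
  simp only [map_sub, map_sum, map_smul, sub_apply, sum_apply, smul_apply, smul_eq_mul]
  simp_rw [form_infAction_single hμ]
  rw [form_infAction hμ]
  simp

theorem infAction_smul (c : ℝ) (ξ : Fin m → ℝ) (x : M) :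
    infAction (n := n) (c • ξ) x = c • infAction (n := n) ξ x := by
  rw [infAction_eq_sum hμ, infAction_eq_sum hμ ξ, Finset.smul_sum]
  simp [mul_smul]

theorem momentDeriv_infAction (ξ : Fin m → ℝ) (x : M) :
    momentDeriv (n := n) μ x (infAction ξ x) = 0 := by
  have h0 : ∀ x', x' = x → HasMFDerivAt (𝓡 n) 𝓘(ℝ, Fin m → ℝ) μ x' (momentDeriv μ x) := by
    rintro _ rfl; exact hasMFDerivAt_moment hμ _
  have h := (hasVelocity_torusExp_zero hμ.smooth_action ξ x).hasDerivAt_comp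
    (h0 _ (by simp only [zero_smul]; exact torusExp_zero_smul x))
  have h2 : μ ∘ (fun s : ℝ => torusExp (s • ξ) • x) = fun _ => μ x :=
    funext fun s => hμ.moment_invariant _ _
  rw [h2] at h
  exact h.unique (hasDerivAt_const _ _)

/-- Orbits are isotropic because the moment map is constant on them. -/
theorem form_infAction_infAction (ξ η : Fin m → ℝ) (x : M) :
    Ω.form x (infAction ξ x) (infAction η x) = 0 := by
  rw [form_infAction hμ, momentDeriv_infAction hμ]
  simp

theorem actDeriv_bijective (t : Torus m) (x : M) : Function.Bijective (actDeriv (n := n) t x) := by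
  have hinj : Function.Injective (actDeriv (n := n) t x) := by
    refine (injective_iff_map_eq_zero _).2 fun v hv => Ω.nondegenerate x v fun w => ?_
    have h := hμ.symplectic t x v w
    rw [← h]
    have h2 := congrArg (fun u => Ω.form (t • x) u (actDeriv t x w)) hv
    exact h2.trans (by simp)
  exact ⟨hinj, (LinearMap.injective_iff_surjective_of_finrank_eq_finrank (f :=
    (actDeriv (n := n) t x : TangentSpace (𝓡 n) x →ₗ[ℝ] TangentSpace (𝓡 n) (t • x))) rfl).1 hinj⟩

theorem invariantEnd_adj {J : EndField n M} (hJ : InvariantEnd m J) :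
    InvariantEnd m (Ω.adj J) := by
  intro t x v
  refine sub_eq_zero.1 (Ω.nondegenerate (t • x) _ fun w => ?_)
  obtain ⟨u, rfl⟩ := (actDeriv_bijective hμ t x).2 w
  rw [Ω.antisymm, neg_eq_zero, map_sub, sub_eq_zero, ← Ω.form_adj]
  refine (hμ.symplectic t x u _).trans ?_
  rw [← Ω.form_adj]
  refine (hμ.symplectic t x _ v).symm.trans ?_
  exact congrArg (fun z => Ω.form (t • x) z (actDeriv t x v)) (hJ t x u)

/-- The images of the infinitesimal action under an invariant integrable structure commute. -/
theorem bracket_image_eq_zero {A : EndField n M} (hA : InvariantEnd m A) (hint : Integrable A)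
    {x : M} {ξ η : Fin m → ℝ} (hξ : SmoothVFieldAt (fun y => A y (infAction (n := n) ξ y)) x)
    (hη : SmoothVFieldAt (fun y => A y (infAction (n := n) η y)) x) :
    bracket (fun y => A y (infAction (n := n) ξ y)) (fun y => A y (infAction (n := n) η y)) x = 0 := by
  have hinv : ∀ (ξ : Fin m → ℝ) (t : Torus m),
      actDeriv t x (A x (infAction (n := n) ξ x)) = A (t • x) (infAction (n := n) ξ (t • x)) :=
    fun ξ t => (hA t x _).trans
      (congrArg (A (t • x)) (actDeriv_infAction hμ.smooth_action t ξ x))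
  -- Of the four brackets in the Nijenhuis expression, the other three involve some `ξ^♯` against an
  -- invariant field, hence vanish.
  have h := hint (infAction (n := n) ξ) (infAction (n := n) η)
    (smoothVFieldAt_infAction hμ.smooth_action ξ) (smoothVFieldAt_infAction hμ.smooth_action η) x
  have h1 : bracket (infAction (n := n) ξ) (infAction (n := n) η) x = 0 :=
    bracket_infAction_eq_zero hμ.smooth_action ξ (smoothVFieldAt_infAction hμ.smooth_action η x)
      fun t => actDeriv_infAction hμ.smooth_action t η x
  have h2 : bracket (infAction (n := n) ξ) (fun y => A y (infAction (n := n) η y)) x = 0 :=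
    bracket_infAction_eq_zero hμ.smooth_action ξ hη (hinv η)
  have h3 : bracket (fun y => A y (infAction (n := n) ξ y)) (infAction (n := n) η) x = 0 := by
    rw [bracket, VectorField.mlieBracket_swap_apply]
    rw [← bracket, bracket_infAction_eq_zero hμ.smooth_action η hξ (hinv ξ), neg_zero]
  rw [nijenhuis, h1, h2, h3] at h
  simpa using h

end Hamiltonian

theorem torusExp_two_pi_smul_int {m : ℕ} (q : Fin m → ℤ) :
    torusExp ((2 * Real.pi) • fun i => (q i : ℝ)) = 1 := by
  ext i
  have h : Circle.exp (2 * Real.pi * (q i : ℝ)) = 1 := by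
    rw [mul_comm]; exact Circle.exp_int_mul_two_pi (q i)
  simpa [torusExp] using congrArg (fun z : Circle => (z : ℂ)) h

theorem eq_zero_of_torusExp_smul_eq_one {m : ℕ} {ξ : Fin m → ℝ}
    (h : ∀ s : ℝ, torusExp (s • ξ) = 1) : ξ = 0 := by
  by_contra hne
  obtain ⟨i, hi⟩ := Function.ne_iff.1 hne
  -- At `s = π / ξ i` the `i`-th coordinate is `exp (iπ) = -1`.
  have h1 := congrArg (fun z : Circle => (z : ℂ)) (congrFun (h (Real.pi / ξ i)) i)
  have h2 : Real.pi / ξ i * ξ i = Real.pi := div_mul_cancel₀ _ hi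
  simp only [torusExp, Pi.smul_apply, smul_eq_mul, h2, Circle.coe_exp, Pi.one_apply,
    Circle.coe_one, Complex.exp_pi_mul_I] at h1
  norm_num at h1

/-- A nonzero endomorphism commuting with a complex structure has rank at least two. -/
theorem finrank_ker_add_two_le {E : Type*} [AddCommGroup E] [Module ℝ E] [FiniteDimensional ℝ E]
    {A J : E →ₗ[ℝ] E} (hJ : ∀ v, J (J v) = -v) (hc : ∀ v, A (J v) = J (A v)) (hA : A ≠ 0) :
    Module.finrank ℝ (LinearMap.ker A) + 2 ≤ Module.finrank ℝ E := by
  obtain ⟨u, hu⟩ : ∃ u, A u ≠ 0 := by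
    by_contra! h
    exact hA (LinearMap.ext h)
  have hli : LinearIndependent ℝ ![A u, A (J u)] := by
    rw [LinearIndependent.pair_iff]
    intro s t hst
    rw [hc] at hst
    have h2 : (s * s + t * t) • A u = 0 := by
      have h3 : J (s • A u + t • J (A u)) = 0 := by rw [hst, map_zero]
      rw [map_add, map_smul, map_smul, hJ] at h3
      have h4 : s • (s • A u + t • J (A u)) - t • (s • J (A u) + t • -A u) = 0 := by
        rw [hst, h3]; simp
      rw [← h4]; module
    rcases smul_eq_zero.1 h2 with h | h
    · constructor <;> nlinarith [mul_self_nonneg s, mul_self_nonneg t]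
    · exact absurd h hu
  have hr : 2 ≤ Module.finrank ℝ (LinearMap.range A) := by
    have hli' : LinearIndependent ℝ
        ![(⟨A u, u, rfl⟩ : LinearMap.range A), ⟨A (J u), J u, rfl⟩] := by
      refine LinearIndependent.of_comp (LinearMap.range A).subtype ?_
      convert hli using 1
      ext i; fin_cases i <;> rfl
    simpa using hli'.fintype_card_le_finrank
  have := A.finrank_range_add_finrank_ker
  omega

/-! ### Zeros of the generator of a circle subgroup. -/

section Zeros

variable {n m : ℕ} {M : Type*} [TopologicalSpace M] [ChartedSpace (EuclideanSpace ℝ (Fin n)) M]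
  [IsManifold (𝓡 n) ∞ M]

theorem chartRep_eq_zero_iff {z : M} {y : EuclideanSpace ℝ (Fin n)}
    (hy : y ∈ (extChartAt (𝓡 n) z).target) (X : VField n M) :
    chartRep z X y = 0 ↔ X ((extChartAt (𝓡 n) z).symm y) = 0 := by
  constructor
  · intro h
    exact chartDeriv_injective ((extChartAt (𝓡 n) z).map_target hy) (h.trans (map_zero _).symm)
  · intro h
    rw [chartRep, h, map_zero]

theorem isClosed_zeros {X : VField n M} (hX : ∀ x, SmoothVFieldAt X x) :
    IsClosed {x | X x = 0} := by
  rw [← isOpen_compl_iff, isOpen_iff_mem_nhds]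
  intro x hx
  have hxs := mem_extChartAt_source (I := 𝓡 n) x
  have h1 : ContinuousAt (fun w => chartRep x X (extChartAt (𝓡 n) x w)) x :=
    ContinuousAt.comp (g := chartRep x X)
      (SmoothVFieldAt.chartRep ((extChartAt (𝓡 n) x).map_source hxs) (hX _)).continuousAt
      (continuousAt_extChartAt (I := 𝓡 n) x)
  have h2 : chartRep x X (extChartAt (𝓡 n) x x) ≠ 0 := by
    rw [Ne, chartRep_eq_zero_iff ((extChartAt (𝓡 n) x).map_source hxs),
      (extChartAt (𝓡 n) x).left_inv hxs]
    exact hx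
  filter_upwards [h1.eventually_ne h2, extChartAt_source_mem_nhds (I := 𝓡 n) x] with w hw hws hw0
  refine hw ?_
  rw [chartRep_apply hws, hw0, map_zero]

variable [MulAction (Torus m) M]

/-- The constant curve and the orbit are integral curves with the same initial point. -/
theorem torusExp_smul_eq_of_infAction_eq_zero [T2Space M] (hact : SmoothTorusAction n m M)
    {ξ : Fin m → ℝ} {x : M} (h : infAction (n := n) ξ x = 0) (s : ℝ) :
    torusExp (s • ξ) • x = x := by
  have h1 : IsMIntegralCurve (I := 𝓡 n) (fun _ : ℝ => x) (infAction (n := n) ξ) := by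
    refine isMIntegralCurve_iff_hasVelocity.2 fun s => ?_
    refine hasVelocity_of_hasMFDerivAt (hasMFDerivAt_const x s) ?_
    rw [h]; rfl
  have hsm : ContMDiff (𝓡 n) (𝓡 n).tangent 1
      (fun x => (⟨x, infAction (n := n) ξ x⟩ : TangentBundle (𝓡 n) M)) :=
    fun x => (smoothVFieldAt_infAction hact ξ x).of_le (by exact WithTop.coe_le_coe.2 le_top)
  have : IsManifold (𝓡 n) 1 M := IsManifold.of_le (n := ∞) (by exact WithTop.coe_le_coe.2 le_top)
  have h2 := isMIntegralCurve_Ioo_eq_of_contMDiff_boundaryless (t₀ := 0) hsm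
    (isMIntegralCurve_torusExp hact ξ x) h1 (by rw [zero_smul, torusExp_zero_smul])
  exact congrFun h2 s

theorem infAction_eq_zero_of_torusExp_smul_eq (hact : SmoothTorusAction n m M)
    {ξ : Fin m → ℝ} {x : M} (h : ∀ s : ℝ, torusExp (s • ξ) • x = x) :
    infAction (n := n) ξ x = 0 := by
  have h1 := hasVelocity_torusExp_zero hact ξ x
  simp only [h] at h1
  exact h1.unique (hasVelocity_of_hasMFDerivAt (v := 0) (hasMFDerivAt_const x (0 : ℝ)) rfl)

/-- A degenerate zero of the generator of a circle action is interior to the zero set. -/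
theorem eventually_infAction_eq_zero [T2Space M] (hact : SmoothTorusAction n m M)
    {ξ : Fin m → ℝ} (hξ : torusExp ((2 * Real.pi) • ξ) = 1) {z x : M}
    (hxs : x ∈ (extChartAt (𝓡 n) z).source) (h0 : infAction (n := n) ξ x = 0)
    (hD : fderiv ℝ (chartRep z (infAction (n := n) ξ)) (extChartAt (𝓡 n) z x) = 0) :
    ∀ᶠ w in 𝓝 x, infAction (n := n) ξ w = 0 := by
  have hy := (extChartAt (𝓡 n) z).map_source hxs
  have hk := contDiffAt_chartRep_infAction (ξ := ξ) hact hy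
  have hstr := hk.hasStrictFDerivAt (by simp)
  rw [hD] at hstr
  -- The constant `1 / (4π)` makes `c` times the period `2π` equal to `1/2`.
  obtain ⟨c, hc0, hc⟩ : ∃ c : NNReal, 0 < c ∧ c * (2 * Real.pi) < 1 := by
    refine ⟨Real.toNNReal (4 * Real.pi)⁻¹, Real.toNNReal_pos.2 (by positivity), ?_⟩
    rw [Real.coe_toNNReal _ (by positivity)]
    have := Real.pi_pos
    field_simp
    norm_num
  obtain ⟨S, hS, hlip⟩ := hstr.exists_lipschitzOnWith_of_nnnorm_lt c (by simpa using hc0)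
  -- Tube argument: over one compact period, orbits of points near the fixed point stay where the
  -- generator has Lipschitz constant `c`. They are closed, so they are equilibria.
  have htube : ∀ᶠ w in 𝓝 x, ∀ s ∈ Icc (0 : ℝ) (2 * Real.pi),
      torusExp (s • ξ) • w ∈ (extChartAt (𝓡 n) z).source ∩ extChartAt (𝓡 n) z ⁻¹' S := by
    refine isCompact_Icc.eventually_forall_of_forall_eventually fun s _ => ?_
    have hcont : Continuous fun q : M × ℝ => torusExp (q.2 • ξ) • q.1 :=
      hact.continuous.comp ((continuous_snd.smul continuous_const).prodMk continuous_fst)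
    refine hcont.continuousAt.eventually_mem ?_
    simp only [torusExp_smul_eq_of_infAction_eq_zero hact h0]
    exact inter_mem ((isOpen_extChartAt_source z).mem_nhds hxs)
      ((contMDiffAt_chart hxs).continuousAt hS)
  filter_upwards [htube] with w hw
  have hw' : ∀ s : ℝ,
      torusExp (s • ξ) • w ∈ (extChartAt (𝓡 n) z).source ∩ extChartAt (𝓡 n) z ⁻¹' S := by
    have hper : Function.Periodic (fun s : ℝ => torusExp (s • ξ) • w) (2 * Real.pi) := by
      intro s
      simp only [add_smul, torusExp_add, hξ, mul_one]
    intro s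
    obtain ⟨r, hr, hrs⟩ := hper.exists_mem_Ico₀ Real.two_pi_pos s
    rw [hrs]
    exact hw r ⟨hr.1, hr.2.le⟩
  have hcurve : ∀ s, HasDerivAt (fun s : ℝ => extChartAt (𝓡 n) z (torusExp (s • ξ) • w))
      (chartRep z (infAction (n := n) ξ) (extChartAt (𝓡 n) z (torusExp (s • ξ) • w))) s := by
    intro s
    rw [chartRep_apply (hw' s).1]
    exact (hasVelocity_torusExp hact ξ w s).hasDerivAt_comp (hasMFDerivAt_chart (hw' s).1)
  have h2 := eq_zero_of_periodic_of_lipschitz Real.two_pi_pos hc hlip (fun s => (hw' s).2) hcurve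
    (by simp only [hξ, zero_smul, torusExp_zero])
  simp only [zero_smul, torusExp_zero_smul] at h2
  have hws : w ∈ (extChartAt (𝓡 n) z).source := by
    have := (hw' 0).1
    rwa [zero_smul, torusExp_zero_smul] at this
  rw [chartRep_apply hws] at h2
  exact chartDeriv_injective hws (h2.trans (map_zero _).symm)

/-- The interior of the zero set is closed: at a limit point the generator and its derivative vanish
by continuity, so the generator vanishes nearby. A degenerate zero would make this interior
nonempty, hence all of `M`, and the circle would act trivially against effectiveness. -/
theorem fderiv_chartRep_infAction_ne_zero [T2Space M] [ConnectedSpace M]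
    (hact : SmoothTorusAction n m M) [FaithfulSMul (Torus m) M]
    {ξ : Fin m → ℝ} (hξ : torusExp ((2 * Real.pi) • ξ) = 1) (hne : ξ ≠ 0) {z x : M}
    (hxs : x ∈ (extChartAt (𝓡 n) z).source) (h0 : infAction (n := n) ξ x = 0) :
    fderiv ℝ (chartRep z (infAction (n := n) ξ)) (extChartAt (𝓡 n) z x) ≠ 0 := by
  intro hD
  set W := {w : M | ∀ᶠ w' in 𝓝 w, infAction (n := n) ξ w' = 0} with hW
  have hWo : IsOpen W := isOpen_setOfPred_eventually_nhds
  have hWc : IsClosed W := by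
    refine isClosed_of_closure_subset fun w hw => ?_
    have hws := mem_extChartAt_source (I := 𝓡 n) w
    have hy := (extChartAt (𝓡 n) w).map_source hws
    have hz : infAction (n := n) ξ w = 0 := by
      have hcl := isClosed_zeros (smoothVFieldAt_infAction (n := n) hact ξ)
      exact hcl.closure_subset_iff.2 (fun w' hw' => hw'.self_of_nhds) hw
    refine eventually_infAction_eq_zero hact hξ hws hz ?_
    have hk := contDiffAt_chartRep_infAction (ξ := ξ) hact hy
    have hc : ContinuousAt (fun w' => fderiv ℝ (chartRep w (infAction (n := n) ξ))
        (extChartAt (𝓡 n) w w')) w :=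
      ContinuousAt.comp (g := fderiv ℝ (chartRep w (infAction (n := n) ξ)))
        (hk.fderiv_right (m := ∞) (by simp)).continuousAt
        (continuousAt_extChartAt (I := 𝓡 n) w)
    by_contra hne0
    obtain ⟨w', hw'W, hw'1, hw's⟩ := ((mem_closure_iff_frequently.1 hw).and_eventually
      ((hc.eventually_ne hne0).and (extChartAt_source_mem_nhds (I := 𝓡 n) w))).exists
    refine hw'1 ?_
    have hy' := (extChartAt (𝓡 n) w).map_source hw's
    have : chartRep w (infAction (n := n) ξ) =ᶠ[𝓝 (extChartAt (𝓡 n) w w')] fun _ => 0 := by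
      have hcs : ContinuousAt (extChartAt (𝓡 n) w).symm (extChartAt (𝓡 n) w w') :=
        (contMDiffAt_chart_symm hy').continuousAt
      have hw'W' : ∀ᶠ u in 𝓝 ((extChartAt (𝓡 n) w).symm (extChartAt (𝓡 n) w w')),
          infAction (n := n) ξ u = 0 := by
        rw [(extChartAt (𝓡 n) w).left_inv hw's]; exact hw'W
      filter_upwards [hcs.eventually hw'W', chart_target_mem_nhds hy'] with u hu hut
      exact (chartRep_eq_zero_iff hut _).2 hu
    rw [this.fderiv_eq]
    simp
  have hWu : W = univ := by
    refine IsClopen.eq_univ ⟨hWc, hWo⟩ ⟨x, ?_⟩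
    exact eventually_infAction_eq_zero hact hξ hxs h0 hD
  refine hne (eq_zero_of_torusExp_smul_eq_one fun s => ?_)
  refine FaithfulSMul.eq_of_smul_eq_smul (α := M) fun w => ?_
  rw [one_smul]
  have hw : w ∈ W := hWu ▸ mem_univ w
  exact torusExp_smul_eq_of_infAction_eq_zero hact hw.self_of_nhds s

end Zeros

/-! ### The regular set is dense and connected. -/

section RegularSet

variable {n m : ℕ} {M : Type*} [TopologicalSpace M] [ChartedSpace (EuclideanSpace ℝ (Fin n)) M]

variable (n m M) in
/-- The set of points at which the infinitesimal action of the torus is injective. -/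
def regularSet [MulAction (Torus m) M] : Set M :=
  {x | ∀ ξ : Fin m → ℝ, infAction (n := n) ξ x = 0 → ξ = 0}

theorem chartEnd_chartEnd {J : EndField n M} (hJ : ∀ (x : M) (v : TangentSpace (𝓡 n) x),
    J x (J x v) = -v) [IsManifold (𝓡 n) ∞ M] {z : M} {y : EuclideanSpace ℝ (Fin n)}
    (hy : y ∈ (extChartAt (𝓡 n) z).target) (u : EuclideanSpace ℝ (Fin n)) :
    chartEnd z J y (chartEnd z J y u) = -u := by
  have h : chartEnd z J y (chartDeriv z _ (J _ (chartSymmDeriv z y u))) = _ :=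
    chartEnd_chartDeriv hy (J _ (chartSymmDeriv z y u))
  refine h.trans ?_
  rw [hJ, map_neg, chartDeriv_chartSymmDeriv hy]

/-- A stabilizer of positive dimension contains a circle. Integer generators are countably many and
periodic, which is what the dimension estimate uses. -/
theorem exists_int_infAction_eq_zero [IsManifold (𝓡 n) ∞ M] [T2Space M] [MulAction (Torus 2) M]
    {Ω : SymplecticForm n M} {μ : M → Fin 2 → ℝ} (hμ : IsHamiltonianToric Ω μ)
    {x : M} (hx : x ∉ regularSet n 2 M) :
    ∃ q : Fin 2 → ℤ, q ≠ 0 ∧ infAction (n := n) (fun i => (q i : ℝ)) x = 0 := by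
  have hact := hμ.smooth_action
  simp only [regularSet, mem_ofPred_eq, not_forall] at hx
  obtain ⟨ξ, hξ, hξ0⟩ := hx
  have hfix := torusExp_smul_eq_of_infAction_eq_zero hact hξ
  let e : Fin 2 → ℝ := ![1, 0]
  let H : AddSubgroup ℝ :=
    { carrier := {s | torusExp (s • e) • x = x}
      zero_mem' := by simp [torusExp_zero]
      add_mem' := fun {a b} ha hb => by
        simp only [mem_ofPred_eq] at ha hb ⊢
        rw [add_smul, torusExp_add_smul, hb, ha]
      neg_mem' := fun {a} ha => by
        simp only [mem_ofPred_eq] at ha ⊢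
        nth_rewrite 1 [← ha]
        rw [← torusExp_add_smul, ← add_smul, neg_add_cancel, zero_smul, torusExp_zero_smul] }
  have hHc : IsClosed (H : Set ℝ) :=
    isClosed_eq (contMDiff_torusExp_smul hact e x).continuous continuous_const
  have hcast : ∀ k l : ℤ, (fun i => ((![k, l] i : ℤ) : ℝ)) = ![(k : ℝ), (l : ℝ)] := by
    intro k l; ext i; fin_cases i <;> rfl
  have he : infAction (n := n) e x = 0 →
      ∃ q : Fin 2 → ℤ, q ≠ 0 ∧ infAction (n := n) (fun i => (q i : ℝ)) x = 0 := by
    intro h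
    refine ⟨![1, 0], fun h0 => by simpa using congrFun h0 0, ?_⟩
    rw [hcast]
    simpa [e] using h
  by_cases h1 : ξ 1 = 0
  · refine he ?_
    have h0 : ξ 0 ≠ 0 := fun h0 => hξ0 (by ext i; fin_cases i <;> simpa)
    have h2 : e = (ξ 0)⁻¹ • ξ := by
      ext i; fin_cases i
      · simp [e, h0]
      · simp [e, h1]
    rw [h2, infAction_smul hμ, hξ, smul_zero]
  -- Lattice vectors act trivially and `ξ` fixes `x`, so the lattice point `2π (k, l)` can be slid
  -- along `ξ` onto the first axis.
  · have hmem : ∀ k l : ℤ, 2 * Real.pi * (k - l * (ξ 0 / ξ 1)) ∈ H := by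
      intro k l
      change torusExp ((2 * Real.pi * (k - l * (ξ 0 / ξ 1))) • e) • x = x
      have h2 : (2 * Real.pi * (k - l * (ξ 0 / ξ 1))) • e =
          (2 * Real.pi) • (fun i => ((![k, l] i : ℤ) : ℝ)) + (-(2 * Real.pi * l / ξ 1)) • ξ := by
        ext i; fin_cases i
        · simp [e]; ring
        · simp [e]; field_simp; ring
      rw [h2, torusExp_add_smul, hfix, torusExp_two_pi_smul_int, one_smul]
    -- If `H` is dense, it is all of `ℝ` by closedness and the first circle fixes `x`. If it is
    -- generated by `a`, then `2π = k a` and `2π ξ₀/ξ₁ = l a`, so `ξ` is proportional to the integer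
    -- vector `(l, k)`.
    rcases H.dense_or_cyclic with hd | ⟨a, ha⟩
    · refine he (infAction_eq_zero_of_torusExp_smul_eq hact fun s => ?_)
      have : s ∈ (H : Set ℝ) := by
        rw [← hHc.closure_eq, hd.closure_eq]; trivial
      exact this
    · have h2 := hmem 1 0
      have h3 := hmem 0 (-1)
      rw [ha, AddSubgroup.mem_closure_singleton] at h2 h3
      obtain ⟨k, hk⟩ := h2
      obtain ⟨l, hl⟩ := h3
      simp only [zsmul_eq_mul, Int.cast_one, Int.cast_zero, zero_mul, sub_zero, mul_one,
        Int.cast_neg, neg_mul, one_mul, sub_neg_eq_add, zero_add] at hk hl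
      have hpi := Real.pi_pos
      have hk0 : k ≠ 0 := by
        rintro rfl
        simp at hk
      refine ⟨![l, k], fun h0 => hk0 (by simpa using congrFun h0 1), ?_⟩
      have h4 : (fun i => ((![l, k] i : ℤ) : ℝ)) = ((k : ℝ) / ξ 1) • ξ := by
        ext i; fin_cases i
        · have ha0 : a ≠ 0 := by rintro rfl; simp at hk
          have : (l : ℝ) * a = k * a * (ξ 0 / ξ 1) := by rw [hl, hk]
          have h5 : (l : ℝ) = k * (ξ 0 / ξ 1) := by
            apply mul_right_cancel₀ ha0
            linarith
          simp [h5]; ring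
        · simp [h1]
      rw [h4, infAction_smul hμ, hξ, smul_zero]

section Thin

variable [IsManifold (𝓡 n) ∞ M] [T2Space M] [ConnectedSpace M] [MulAction (Torus 2) M]
  {Ω : SymplecticForm n M} {μ : M → Fin 2 → ℝ} (hμ : IsHamiltonianToric Ω μ)
  {J : EndField n M} (hJ : ∀ (x : M) (v : TangentSpace (𝓡 n) x), J x (J x v) = -v)
  (hinv : InvariantEnd 2 J)
include hμ hJ hinv

/-- The singular set is a countable union of zero sets of integer generators. Near a zero, each has
dimension at most that of the kernel of the linearization, and this kernel has codimension at least
two since the linearization is nonzero and commutes with `J`. -/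
theorem dimH_singular_le (z : M) :
    dimH {y ∈ (extChartAt (𝓡 n) z).target | (extChartAt (𝓡 n) z).symm y ∉ regularSet n 2 M} ≤
      ((n - 2 : ℕ) : ENNReal) := by
  have hact := hμ.smooth_action
  have := hμ.effective
  have hsub : {y ∈ (extChartAt (𝓡 n) z).target |
        (extChartAt (𝓡 n) z).symm y ∉ regularSet n 2 M} ⊆
      ⋃ q : {q : Fin 2 → ℤ // q ≠ 0}, {y ∈ (extChartAt (𝓡 n) z).target |
        chartRep z (infAction (n := n) fun i => (q.1 i : ℝ)) y = 0} := by
    rintro y ⟨hy, hyr⟩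
    obtain ⟨q, hq, h⟩ := exists_int_infAction_eq_zero hμ hyr
    exact mem_iUnion.2 ⟨⟨q, hq⟩, hy, (chartRep_eq_zero_iff hy _).2 h⟩
  refine (dimH_mono hsub).trans ?_
  rw [dimH_iUnion]
  refine iSup_le fun q => dimH_le_of_local ?_
  rintro y ⟨hy, hy0⟩
  have hq : (fun i => (q.1 i : ℝ)) ≠ 0 := fun h => q.2 (funext fun i => by
    simpa using congrFun h i)
  have hk := contDiffAt_chartRep_infAction (ξ := fun i => (q.1 i : ℝ)) hact hy
  have hA := fderiv_chartRep_infAction_ne_zero hact (torusExp_two_pi_smul_int q.1) hq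
    ((extChartAt (𝓡 n) z).map_target hy) ((chartRep_eq_zero_iff hy _).1 hy0)
  rw [(extChartAt (𝓡 n) z).right_inv hy] at hA
  have hfix := torusExp_smul_eq_of_infAction_eq_zero hact ((chartRep_eq_zero_iff hy _).1 hy0)
  have hrank := finrank_ker_add_two_le
    (A := (fderiv ℝ (chartRep z (infAction (n := n) fun i => (q.1 i : ℝ))) y).toLinearMap)
    (J := (chartEnd z J y).toLinearMap) (chartEnd_chartEnd hJ hy)
    (fderiv_chartRep_infAction_comm hact _ hinv hy hfix)
    (fun h => hA (ContinuousLinearMap.coe_injective h))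
  obtain ⟨V, hV, hdim⟩ := exists_dimH_zeros_le (hk.hasStrictFDerivAt (by simp))
  refine ⟨V, hV, (dimH_mono ?_).trans (hdim.trans ?_)⟩
  · rintro w ⟨⟨-, hw⟩, hwV⟩
    exact ⟨hwV, hw⟩
  · rw [finrank_euclideanSpace_fin] at hrank
    exact_mod_cast (by omega : Module.finrank ℝ (LinearMap.ker
      (fderiv ℝ (chartRep z (infAction (n := n) fun i => (q.1 i : ℝ))) y).toLinearMap) ≤ n - 2)

theorem dense_regularSet (hn : 2 ≤ n) : Dense (regularSet n 2 M) := by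
  intro z
  rw [mem_closure_iff_nhds]
  intro U hU
  have hzs := mem_extChartAt_source (I := 𝓡 n) z
  have hz := (extChartAt (𝓡 n) z).map_source hzs
  have hlt : dimH {y ∈ (extChartAt (𝓡 n) z).target |
      (extChartAt (𝓡 n) z).symm y ∉ regularSet n 2 M} <
      Module.finrank ℝ (EuclideanSpace ℝ (Fin n)) := by
    refine (dimH_singular_le hμ hJ hinv z).trans_lt ?_
    rw [finrank_euclideanSpace_fin]
    exact_mod_cast (by omega : n - 2 < n)
  have hd := dense_compl_of_dimH_lt_finrank hlt
  have hU' : (extChartAt (𝓡 n) z).symm ⁻¹' U ∈ 𝓝 (extChartAt (𝓡 n) z z) := by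
    refine (contMDiffAt_chart_symm hz).continuousAt ?_
    rwa [(extChartAt (𝓡 n) z).left_inv hzs]
  obtain ⟨y, ⟨hyU, hyt⟩, hyN⟩ := mem_closure_iff_nhds.1 (hd (extChartAt (𝓡 n) z z)) _
    (inter_mem hU' (chart_target_mem_nhds hz))
  refine ⟨_, hyU, ?_⟩
  by_contra h
  exact hyN ⟨hyt, h⟩

theorem isPreconnected_regularSet (hn : 2 ≤ n) : IsPreconnected (regularSet n 2 M) := by
  refine isPreconnected_of_dense_of_local (dense_regularSet hμ hJ hinv hn) fun z => ?_
  have hzs := mem_extChartAt_source (I := 𝓡 n) z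
  have hz := (extChartAt (𝓡 n) z).map_source hzs
  obtain ⟨r, hr, hball⟩ := Metric.mem_nhds_iff.1 (chart_target_mem_nhds hz)
  set N := {y ∈ (extChartAt (𝓡 n) z).target | (extChartAt (𝓡 n) z).symm y ∉ regularSet n 2 M}
  have hpre : IsPreconnected (Metric.ball (extChartAt (𝓡 n) z z) r \ N) := by
    refine isPreconnected_diff_of_dimH_lt Metric.isOpen_ball (convex_ball _ _) ?_
    refine (dimH_singular_le hμ hJ hinv z).trans_lt ?_
    rw [finrank_euclideanSpace_fin]
    exact_mod_cast (by omega : n - 2 < n - 1)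
  refine ⟨(extChartAt (𝓡 n) z).source ∩ extChartAt (𝓡 n) z ⁻¹' Metric.ball _ r,
    (continuousOn_extChartAt z).isOpen_inter_preimage (isOpen_extChartAt_source z)
      Metric.isOpen_ball, ⟨hzs, Metric.mem_ball_self hr⟩, ?_⟩
  have h2 := hpre.image (extChartAt (𝓡 n) z).symm
    ((continuousOn_extChartAt_symm z).mono (sdiff_subset.trans hball))
  convert h2 using 1
  ext w
  constructor
  · rintro ⟨⟨hws, hwb⟩, hwR⟩
    refine ⟨extChartAt (𝓡 n) z w, ⟨hwb, fun h => h.2 ?_⟩, (extChartAt (𝓡 n) z).left_inv hws⟩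
    rwa [(extChartAt (𝓡 n) z).left_inv hws]
  · rintro ⟨y, ⟨hyb, hyN⟩, rfl⟩
    refine ⟨⟨(extChartAt (𝓡 n) z).map_target (hball hyb), ?_⟩, ?_⟩
    · rw [mem_preimage, (extChartAt (𝓡 n) z).right_inv (hball hyb)]; exact hyb
    · by_contra h
      exact hyN ⟨hball hyb, h⟩

end Thin

end RegularSet

/-! ### Completeness and uniqueness of integral curves. -/

section Flow

variable {n : ℕ} {M : Type*} [TopologicalSpace M] [ChartedSpace (EuclideanSpace ℝ (Fin n)) M]
  [IsManifold (𝓡 n) ∞ M]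

theorem contMDiff_one_of_smoothVFieldAt {X : VField n M} (hX : ∀ x, SmoothVFieldAt X x) :
    ContMDiff (𝓡 n) (𝓡 n).tangent 1 (fun x => (⟨x, X x⟩ : TangentBundle (𝓡 n) M)) :=
  fun x => (hX x).of_le (by exact WithTop.coe_le_coe.2 le_top)

/-- Integral curves through nearby points exist for a uniform time. -/
theorem exists_uniform_hasVelocity {X : VField n M} (hX : ∀ x, SmoothVFieldAt X x) (z : M) :
    ∃ ε > (0 : ℝ), ∀ᶠ x in 𝓝 z, ∃ γ : ℝ → M, γ 0 = x ∧
      ∀ s ∈ Ioo (-ε) ε, HasVelocity γ s (X (γ s)) := by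
  have hzs := mem_extChartAt_source (I := 𝓡 n) z
  have hz := (extChartAt (𝓡 n) z).map_source hzs
  set y := extChartAt (𝓡 n) z z with hy
  have hk : ContDiffAt ℝ 1 (chartRep z X) y :=
    (SmoothVFieldAt.chartRep hz (hX _)).of_le (by exact WithTop.coe_le_coe.2 le_top)
  obtain ⟨ε, hε, a, r, L, K, hr, hpl⟩ := IsPicardLindelof.of_contDiffAt_one hk
  obtain ⟨α, hα, hαc⟩ :=
    (hpl 0).exists_forall_mem_closedBall_eq_hasDerivWithinAt_continuousOn
  have hyr : y ∈ Metric.closedBall y r := Metric.mem_closedBall_self r.2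
  have hcont : ContinuousAt α (y, 0) := by
    refine hαc.continuousAt (prod_mem_nhds (Metric.closedBall_mem_nhds _ (by exact_mod_cast hr)) ?_)
    exact Icc_mem_nhds (by linarith) (by linarith)
  have hmem : ∀ᶠ q in 𝓝 (y, (0 : ℝ)), α q ∈ (extChartAt (𝓡 n) z).target := by
    refine hcont.eventually_mem ?_
    have h0 : α (y, 0) = y := (hα y hyr).1
    rw [h0]
    exact chart_target_mem_nhds hz
  rw [nhds_prod_eq, Filter.eventually_prod_iff] at hmem
  obtain ⟨p, hp, q, hq, hpq⟩ := hmem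
  obtain ⟨δ, hδ, hδq⟩ := Metric.eventually_nhds_iff.1 hq
  refine ⟨min δ ε, lt_min hδ hε, ?_⟩
  have hc : ContinuousAt (extChartAt (𝓡 n) z) z := continuousAt_extChartAt (I := 𝓡 n) z
  filter_upwards [hc.eventually hp, extChartAt_source_mem_nhds (I := 𝓡 n) z,
    hc (Metric.closedBall_mem_nhds y (by exact_mod_cast hr : (0 : ℝ) < r))] with x hxp hxs hxr
  refine ⟨fun s => (extChartAt (𝓡 n) z).symm (α (extChartAt (𝓡 n) z x, s)), ?_, ?_⟩
  · simp only
    rw [(hα _ hxr).1]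
    exact (extChartAt (𝓡 n) z).left_inv hxs
  · intro s hs
    have hs1 : |s| < min δ ε := abs_lt.2 hs
    have hst : α (extChartAt (𝓡 n) z x, s) ∈ (extChartAt (𝓡 n) z).target :=
      hpq hxp (hδq (by simpa using hs1.trans_le (min_le_left _ _)))
    have hs2 := abs_lt.1 (hs1.trans_le (min_le_right _ _))
    have hd := ((hα _ hxr).2 s ⟨by linarith [hs2.1], by linarith [hs2.2]⟩).hasDerivAt
      (Icc_mem_nhds (by linarith [hs2.1]) (by linarith [hs2.2]))
    exact (hasVelocity_chart_symm hd hst).congr_velocity (chartSymmDeriv_chartRep hst X)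

/-- Smooth vector fields on compact manifolds are complete. -/
theorem exists_complete_hasVelocity [T2Space M] [CompactSpace M] {X : VField n M}
    (hX : ∀ x, SmoothVFieldAt X x) (x : M) :
    ∃ γ : ℝ → M, γ 0 = x ∧ ∀ s, HasVelocity γ s (X (γ s)) := by
  have : IsManifold (𝓡 n) 1 M := IsManifold.of_le (n := ∞) (by exact WithTop.coe_le_coe.2 le_top)
  choose ε hε hγ using exists_uniform_hasVelocity hX
  obtain ⟨t, -, ht⟩ := isCompact_univ.elim_nhds_subcover
    (fun z => {x | ∃ γ : ℝ → M, γ 0 = x ∧ ∀ s ∈ Ioo (-ε z) (ε z), HasVelocity γ s (X (γ s))})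
    (fun z _ => hγ z)
  obtain ⟨δ, hδ, hδt⟩ : ∃ δ > (0 : ℝ), ∀ z ∈ t, δ ≤ ε z := by
    have h := (t.finite_toSet.eventually_all (l := 𝓝[>] (0 : ℝ))
      (p := fun z δ => δ ≤ ε z)).2 fun z _ =>
        mem_nhdsWithin_of_mem_nhds (Iic_mem_nhds (hε z))
    obtain ⟨δ, h1, h2⟩ := (h.and self_mem_nhdsWithin).exists
    exact ⟨δ, h2, h1⟩
  obtain ⟨γ, h0, h1⟩ := exists_isMIntegralCurve_of_isMIntegralCurveOn (I := 𝓡 n) (ε := δ)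
    (contMDiff_one_of_smoothVFieldAt hX) hδ (fun w => by
      obtain ⟨z, hz, γ, h0, h1⟩ := mem_iUnion₂.1 (ht (mem_univ w))
      exact ⟨γ, h0, fun s hs => HasMFDerivAt.hasMFDerivWithinAt
        (h1 s ⟨by linarith [hs.1, hδt z hz], by linarith [hs.2, hδt z hz]⟩)⟩) x
  exact ⟨γ, h0, isMIntegralCurve_iff_hasVelocity.1 h1⟩

variable [T2Space M] {X : VField n M} (hX : ∀ x, SmoothVFieldAt X x) {γ γ' : ℝ → M}
include hX

theorem eqOn_of_hasVelocity {a b t : ℝ} (ht : t ∈ Ioo a b)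
    (hγ : ∀ s ∈ Ioo a b, HasVelocity γ s (X (γ s)))
    (hγ' : ∀ s ∈ Ioo a b, HasVelocity γ' s (X (γ' s))) (h : γ t = γ' t) : EqOn γ γ' (Ioo a b) := by
  have : IsManifold (𝓡 n) 1 M := IsManifold.of_le (n := ∞) (by exact WithTop.coe_le_coe.2 le_top)
  exact isMIntegralCurveOn_Ioo_eqOn_of_contMDiff_boundaryless ht
    (contMDiff_one_of_smoothVFieldAt hX)
    (fun s hs => HasMFDerivAt.hasMFDerivWithinAt (hγ s hs))
    (fun s hs => HasMFDerivAt.hasMFDerivWithinAt (hγ' s hs)) h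

theorem eq_of_hasVelocity (hγ : ∀ s, HasVelocity γ s (X (γ s)))
    (hγ' : ∀ s, HasVelocity γ' s (X (γ' s))) {t : ℝ} (h : γ t = γ' t) : γ = γ' := by
  have : IsManifold (𝓡 n) 1 M := IsManifold.of_le (n := ∞) (by exact WithTop.coe_le_coe.2 le_top)
  exact isMIntegralCurve_Ioo_eq_of_contMDiff_boundaryless (I := 𝓡 n) (t₀ := t)
    (contMDiff_one_of_smoothVFieldAt hX) hγ hγ' h

end Flow

/-! ### Commuting frames integrate to transitive local diffeomorphism actions. -/

section Frame

variable {n : ℕ} {M : Type*} [TopologicalSpace M] [ChartedSpace (EuclideanSpace ℝ (Fin n)) M]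
  [IsManifold (𝓡 n) ∞ M]
  {W : Type*} [NormedAddCommGroup W] [NormedSpace ℝ W]

theorem HasVelocity.comp_mul_const {γ : ℝ → M} {s a : ℝ} {v : EuclideanSpace ℝ (Fin n)}
    (h : HasVelocity γ (s * a) v) : HasVelocity (fun r => γ (r * a)) s (a • v) := by
  have h3 : HasMFDerivAt 𝓘(ℝ, ℝ) 𝓘(ℝ, ℝ) (fun r : ℝ => r * a) s
      ((ContinuousLinearMap.id ℝ ℝ).smulRight a) :=
    hasMFDerivAt_iff_hasFDerivAt.2 ((hasFDerivAt_id s).mul_const' a)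
  refine hasVelocity_of_hasMFDerivAt
    (HasMFDerivAt.comp (f := fun r : ℝ => r * a) (g := γ) s h h3) ?_
  exact congrArg (fun c : ℝ => c • v) (one_mul a)

/-- `σ` is differentiable at `v` with derivative given by the frame `X`. -/
def HasFrameDerivAt (X : (x : M) → W →L[ℝ] TangentSpace (𝓡 n) x) (σ : W → M) (v : W) : Prop :=
  HasMFDerivAt 𝓘(ℝ, W) (𝓡 n) σ v (X (σ v))

variable {X : (x : M) → W →L[ℝ] TangentSpace (𝓡 n) x}

theorem HasFrameDerivAt.hasVelocity {σ : W → M} {u w : W} {s : ℝ}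
    (h : HasFrameDerivAt X σ (u + s • w)) :
    HasVelocity (fun r : ℝ => σ (u + r • w)) s (X (σ (u + s • w)) w) := by
  have h1 : HasDerivAt (fun r : ℝ => u + r • w) w s := by
    simpa using ((hasDerivAt_id s).smul_const w).const_add u
  refine hasVelocity_of_hasMFDerivAt
    (HasMFDerivAt.comp s h (hasMFDerivAt_iff_hasFDerivAt.2 h1.hasFDerivAt)) ?_
  exact congrArg (X (σ (u + s • w))) (one_smul ℝ w)

/-- A family of flows for the fields of a frame, `act w` being the time-one flow of the field
`X w`. -/
structure IsFrameAction (X : (x : M) → W →L[ℝ] TangentSpace (𝓡 n) x) (act : W → M → M) : Prop where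
  zero : ∀ x, act 0 x = x
  hasVelocity : ∀ w x s, HasVelocity (fun s : ℝ => act (s • w) x) s (X (act (s • w) x) w)

/-- By rescaling time, the time-one flow of the field of `s • w` is the time-`s` flow of the field
of `w`. Additivity in `w` is not part of this; it comes later from commutation. -/
theorem exists_isFrameAction [T2Space M] [CompactSpace M]
    (hX : ∀ w x, SmoothVFieldAt (fun x => X x w) x) : ∃ act : W → M → M, IsFrameAction X act := by
  choose γ hγ0 hγ using fun w => exists_complete_hasVelocity (hX w)
  have hs : ∀ w x (s : ℝ), γ (s • w) x 1 = γ w x s := by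
    intro w x s
    have h1 : ∀ r, HasVelocity (fun r => γ w x (r * s)) r (X (γ w x (r * s)) (s • w)) := by
      intro r
      refine (hγ w x (r * s)).comp_mul_const.congr_velocity ?_
      exact ((X (γ w x (r * s))).map_smul s w).symm
    have h2 := eq_of_hasVelocity (hX (s • w)) (hγ (s • w) x) h1 (t := 0)
      (by simp only [zero_mul, hγ0])
    simpa using congrFun h2 1
  refine ⟨fun w x => γ w x 1, fun x => ?_, fun w x s => ?_⟩
  · have h := hs 0 x 0
    rw [hγ0, smul_zero] at h
    exact h
  · have h1 := hγ w x s
    rw [← hs] at h1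
    refine (congrArg (fun c : ℝ → M => HasVelocity c s (X (γ (s • w) x 1) w))
      (funext fun r => hs w x r)).mpr h1

namespace IsFrameAction

variable [T2Space M] (hX : ∀ w x, SmoothVFieldAt (fun x => X x w) x) {act : W → M → M}
  (ha : IsFrameAction X act)
include hX ha

theorem eq_of_hasVelocity {w : W} {γ : ℝ → M} (hγ : ∀ s, HasVelocity γ s (X (γ s) w)) (s : ℝ) :
    γ s = act (s • w) (γ 0) :=
  congrFun (ToricGK.eq_of_hasVelocity (hX w) hγ (ha.hasVelocity w (γ 0)) (t := 0)
    (by simp only [zero_smul, ha.zero])) s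

theorem add_smul (w : W) (x : M) (s t : ℝ) :
    act ((s + t) • w) x = act (s • w) (act (t • w) x) := by
  have h := ha.eq_of_hasVelocity hX (w := w) (γ := fun s => act ((s + t) • w) x)
    (fun s => (ha.hasVelocity w x (s + t)).comp_add_const) s
  simpa using h

/-- In a box straight lines are integral curves, so flowing is translation. -/
theorem eq_of_box {σ : W → M} {ρ : ℝ} (hσ : ∀ v, ‖v‖ < 3 * ρ → HasFrameDerivAt X σ v) {u w : W}
    (hu : ‖u‖ < ρ) (hw : ‖w‖ < ρ) : act w (σ u) = σ (u + w) := by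
  -- Times in this interval keep `u + s • w` within `3ρ`, and the interval contains both 0 and 1.
  have h1 : ∀ s ∈ Ioo (-1 : ℝ) 2, HasVelocity (fun r : ℝ => σ (u + r • w)) s
      (X (σ (u + s • w)) w) := by
    intro s hs
    refine HasFrameDerivAt.hasVelocity (hσ _ ?_)
    have h2 : ‖s • w‖ ≤ 2 * ‖w‖ := by
      rw [norm_smul]
      gcongr
      exact abs_le.2 ⟨by linarith [hs.1], hs.2.le⟩
    linarith [norm_add_le u (s • w)]
  have h3 := eqOn_of_hasVelocity (hX w) (t := 0) ⟨by norm_num, by norm_num⟩ h1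
    (fun s _ => ha.hasVelocity w (σ u) s) (by simp [ha.zero])
    (show (1 : ℝ) ∈ Ioo (-1 : ℝ) 2 from ⟨by norm_num, by norm_num⟩)
  simpa using h3.symm

variable {R : Set M}
  (hbox : ∀ p ∈ R, ∃ σ : W → M, σ 0 = p ∧ Filter.map σ (𝓝 0) = 𝓝 p ∧
    ∀ᶠ v in 𝓝 0, HasFrameDerivAt X σ v)
  (hR : ∀ w, ∀ x ∈ R, act w x ∈ R)
include hbox hR

/-- Additivity for a small second argument is propagated along the ray `t • v` by a clopen argument
on `t`. Smooth dependence of flows on initial conditions is never needed. -/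
theorem eventually_add {x : M} (hx : x ∈ R) (v : W) :
    ∀ᶠ u in 𝓝 (0 : W), act (v + u) x = act u (act v x) := by
  set S := {t : ℝ | ∀ᶠ u in 𝓝 (0 : W), act (t • v + u) x = act u (act (t • v) x)} with hS
  have h0 : (0 : ℝ) ∈ S := by
    simp [hS, ha.zero]
  have hloc : ∀ t₀ : ℝ, ∀ᶠ t in 𝓝 t₀, (t ∈ S ↔ t₀ ∈ S) := by
    intro t₀
    obtain ⟨σ, hσ0, -, hσ⟩ := hbox _ (hR (t₀ • v) x hx)
    obtain ⟨ρ, hρ, hσρ⟩ := Metric.eventually_nhds_iff.1 hσ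
    have hσ' : ∀ w, ‖w‖ < 3 * (ρ / 3) → HasFrameDerivAt X σ w := fun w hw =>
      hσρ (by rw [dist_zero_right]; linarith)
    have hbx : ∀ u w : W, ‖u‖ < ρ / 3 → ‖w‖ < ρ / 3 → act w (σ u) = σ (u + w) :=
      fun u w hu hw => ha.eq_of_box hX hσ' hu hw
    have hρ3 : 0 < ρ / 3 := by positivity
    have hsmall : ∀ᶠ t in 𝓝 t₀, ‖(t - t₀) • v‖ < ρ / 3 := by
      have hc : Continuous fun t : ℝ => ‖(t - t₀) • v‖ := by fun_prop
      exact hc.continuousAt.eventually_lt continuousAt_const (by simpa using hρ3)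
    have hray : ∀ t, ‖(t - t₀) • v‖ < ρ / 3 → act (t • v) x = σ ((t - t₀) • v) := by
      intro t ht
      have h := ha.add_smul hX v x (t - t₀) t₀
      rw [sub_add_cancel] at h
      rw [h, ← hσ0, hbx 0 _ (by simpa using hρ3) ht, zero_add]
    by_cases hS0 : t₀ ∈ S
    · have h2 : Tendsto (fun t : ℝ => (t - t₀) • v) (𝓝 t₀) (𝓝 0) := by
        have hc : Continuous fun t : ℝ => (t - t₀) • v := by fun_prop
        simpa using hc.tendsto t₀
      filter_upwards [hsmall, h2.eventually (eventually_eventually_nhds.2 hS0)] with t ht htS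
      refine iff_of_true ?_ hS0
      have h3 : Tendsto (fun u : W => (t - t₀) • v + u) (𝓝 0) (𝓝 ((t - t₀) • v)) := by
        have hc : Continuous fun u : W => (t - t₀) • v + u := by fun_prop
        simpa using hc.tendsto 0
      have h4 : ∀ᶠ u in 𝓝 (0 : W), ‖(t - t₀) • v + u‖ < ρ / 3 := by
        have hc : Continuous fun u : W => ‖(t - t₀) • v + u‖ := by fun_prop
        exact hc.continuousAt.eventually_lt continuousAt_const (by simpa using ht)
      have h5 : ∀ᶠ u in 𝓝 (0 : W), ‖u‖ < ρ / 3 :=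
        continuous_norm.continuousAt.eventually_lt continuousAt_const (by simpa using hρ3)
      filter_upwards [h3.eventually htS, h4, h5] with u hu hu4 hu5
      have e1 : t₀ • v + ((t - t₀) • v + u) = t • v + u := by module
      rw [e1] at hu
      rw [hu, hray t ht, hbx _ _ ht hu5, ← hσ0, hbx 0 _ (by simpa using hρ3) hu4, zero_add]
    · have ht₀ : t₀ ≠ 0 := fun h => hS0 (h ▸ h0)
      have hratio : ∀ᶠ t in 𝓝 t₀, |1 - t / t₀| < 1 := by
        have hc : Continuous fun t : ℝ => |1 - t / t₀| := by fun_prop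
        exact hc.continuousAt.eventually_lt continuousAt_const (by simp [ht₀])
      have hhalf : ∀ᶠ t in 𝓝 t₀, ‖(t - t₀) • v‖ < ρ / 6 := by
        have hc : Continuous fun t : ℝ => ‖(t - t₀) • v‖ := by fun_prop
        exact hc.continuousAt.eventually_lt continuousAt_const (by simp; positivity)
      filter_upwards [hsmall, hratio, hhalf] with t ht htr hth
      have h3 : ∀ᶠ u in 𝓝 (0 : W), ‖u‖ < ρ / 6 :=
        continuous_norm.continuousAt.eventually_lt continuousAt_const (by simp; positivity)
      have h4 : ∀ᶠ u in 𝓝 (0 : W), ‖(t - t₀) • v + (t / t₀) • u‖ < ρ / 3 := by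
        have hc : Continuous fun u : W => ‖(t - t₀) • v + (t / t₀) • u‖ := by fun_prop
        exact hc.continuousAt.eventually_lt continuousAt_const (by simpa using ht)
      refine iff_of_false (fun hS1 => hS0 ?_) hS0
      -- To pass from `t` to `t₀`, run the flow of `t₀ • v + u` for the fraction `t / t₀` of its
      -- time. It reaches `t • v + (t / t₀) • u`, where additivity is known, and the remaining
      -- fraction takes place inside the box.
      have h2 : Tendsto (fun u : W => (t / t₀) • u) (𝓝 0) (𝓝 0) := by
        have hc : Continuous fun u : W => (t / t₀) • u := by fun_prop
        simpa using hc.tendsto 0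
      have h5 : ∀ᶠ u in 𝓝 (0 : W), ‖(t / t₀) • u‖ < ρ / 3 :=
        (h2.norm).eventually_lt tendsto_const_nhds (by simpa using hρ3)
      filter_upwards [h2.eventually hS1, h3, h4, h5] with u hu hu3 hu4 hu5
      have e1 : t₀ • v + u = ((1 - t / t₀) + t / t₀) • (t₀ • v + u) := by
        rw [sub_add_cancel, one_smul]
      have e2 : (t / t₀) • (t₀ • v + u) = t • v + (t / t₀) • u := by
        rw [smul_add, smul_smul, div_mul_cancel₀ _ ht₀]
      have e3 : (t - t₀) • v + (t / t₀) • u + (1 - t / t₀) • (t₀ • v + u) = u := by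
        have : (1 - t / t₀) * t₀ = t₀ - t := by field_simp
        rw [smul_add (1 - t / t₀), smul_smul, this]
        module
      have e4 : ‖(1 - t / t₀) • (t₀ • v + u)‖ < ρ / 3 := by
        have : (1 - t / t₀) * t₀ = t₀ - t := by field_simp
        rw [smul_add, smul_smul, this]
        have h6 : ‖(t₀ - t) • v‖ < ρ / 6 := by
          rw [← neg_sub, neg_smul, norm_neg]; exact hth
        have h7 : ‖(1 - t / t₀) • u‖ ≤ ‖u‖ := by
          rw [norm_smul]
          exact mul_le_of_le_one_left (norm_nonneg _) htr.le
        linarith [norm_add_le ((t₀ - t) • v) ((1 - t / t₀) • u)]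
      rw [e1, ha.add_smul hX, e2, hu, hray t ht, hbx _ _ ht hu5, hbx _ _ hu4 e4, e3, ← hσ0,
        hbx 0 u (by simpa using hρ3) (by linarith), zero_add]
  have hclopen : IsClopen S := by
    have ho : ∀ T : Set ℝ, (∀ t₀, ∀ᶠ t in 𝓝 t₀, (t ∈ T ↔ t₀ ∈ T)) → IsOpen T := fun T hT =>
      isOpen_iff_mem_nhds.2 fun t ht => (hT t).mono fun s hs => hs.2 ht
    refine ⟨⟨ho _ fun t₀ => (hloc t₀).mono fun t ht => not_congr ht⟩, ho _ hloc⟩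
  have h1 : (1 : ℝ) ∈ S := hclopen.eq_univ ⟨0, h0⟩ ▸ mem_univ _
  simpa only [hS, mem_ofPred_eq, one_smul] using h1

theorem exists_box_orbit {x : M} (hx : x ∈ R) (v : W) : ∃ σ : W → M, σ 0 = act v x ∧
    Filter.map σ (𝓝 0) = 𝓝 (act v x) ∧ (∀ᶠ u in 𝓝 0, HasFrameDerivAt X σ u) ∧
      ∀ᶠ u in 𝓝 0, act (v + u) x = σ u := by
  obtain ⟨σ, hσ0, hσm, hσ⟩ := hbox _ (hR v x hx)
  refine ⟨σ, hσ0, hσm, hσ, ?_⟩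
  obtain ⟨ρ, hρ, hσρ⟩ := Metric.eventually_nhds_iff.1 hσ
  have hσ' : ∀ w, ‖w‖ < 3 * (ρ / 3) → HasFrameDerivAt X σ w := fun w hw =>
    hσρ (by rw [dist_zero_right]; linarith)
  have hρ3 : 0 < ρ / 3 := by positivity
  have h3 : ∀ᶠ u in 𝓝 (0 : W), ‖u‖ < ρ / 3 :=
    continuous_norm.continuousAt.eventually_lt continuousAt_const (by simpa using hρ3)
  filter_upwards [ha.eventually_add hX hbox hR hx v, h3] with u hu hu3
  rw [hu, ← hσ0, ha.eq_of_box hX hσ' (by simpa using hρ3) hu3, zero_add]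

/-- The orbit map of a frame action is a local diffeomorphism with derivative the frame. -/
theorem hasFrameDerivAt {x : M} (hx : x ∈ R) (v : W) : HasFrameDerivAt X (fun v => act v x) v := by
  obtain ⟨σ, hσ0, -, hσ, hσe⟩ := ha.exists_box_orbit hX hbox hR hx v
  have h1 : HasMFDerivAt 𝓘(ℝ, W) 𝓘(ℝ, W) (fun u : W => u - v) v (ContinuousLinearMap.id ℝ W) :=
    hasMFDerivAt_iff_hasFDerivAt.2 ((hasFDerivAt_id v).sub_const v)
  have h2 : ∀ w, w = 0 → HasMFDerivAt 𝓘(ℝ, W) (𝓡 n) σ w (X (act v x)) := by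
    rintro _ rfl
    rw [← hσ0]
    exact hσ.self_of_nhds
  have h3 := HasMFDerivAt.comp (f := fun u : W => u - v) v (h2 (v - v) (sub_self v)) h1
  refine HasMFDerivAt.congr_of_eventuallyEq h3 ?_
  have h4 : Tendsto (fun u : W => u - v) (𝓝 v) (𝓝 0) := by
    have hc : Continuous fun u : W => u - v := by fun_prop
    simpa using hc.tendsto v
  filter_upwards [h4.eventually hσe] with u hu
  rw [add_sub_cancel] at hu
  exact hu

/-- The orbit map has the frame as derivative, so `s ↦ act (v + s • w) x` is an integral curve of
the field of `w`. -/
theorem add {x : M} (hx : x ∈ R) (v w : W) : act (v + w) x = act w (act v x) := by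
  have h := ha.eq_of_hasVelocity hX (w := w) (γ := fun s : ℝ => act (v + s • w) x)
    (fun s => (ha.hasFrameDerivAt hX hbox hR hx (v + s • w)).hasVelocity) 1
  simpa using h

theorem isOpen_range {x : M} (hx : x ∈ R) : IsOpen (range fun v => act v x) := by
  rw [isOpen_iff_mem_nhds]
  rintro _ ⟨v, rfl⟩
  obtain ⟨σ, -, hσm, -, hσe⟩ := ha.exists_box_orbit hX hbox hR hx v
  simp only
  rw [← hσm, Filter.mem_map]
  filter_upwards [hσe] with u hu using ⟨v + u, hu⟩

/-- The orbit is open, and it is closed in `R`: a box around a limit point meets the orbit, and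
flows translate any point of the box to its center. -/
theorem subset_range (hRc : IsPreconnected R) {x : M} (hx : x ∈ R) :
    R ⊆ range fun v => act v x := by
  refine hRc.subset_of_closure_inter_subset (ha.isOpen_range hX hbox hR hx)
    ⟨x, hx, 0, ha.zero x⟩ ?_
  rintro p ⟨hp, hpR⟩
  obtain ⟨σ, hσ0, hσm, hσ⟩ := hbox p hpR
  obtain ⟨ρ, hρ, hσρ⟩ := Metric.eventually_nhds_iff.1 hσ
  have hσ' : ∀ w, ‖w‖ < 3 * (ρ / 3) → HasFrameDerivAt X σ w := fun w hw =>
    hσρ (by rw [dist_zero_right]; linarith)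
  have hρ3 : 0 < ρ / 3 := by positivity
  have hN : σ '' Metric.ball 0 (ρ / 3) ∈ 𝓝 p := by
    rw [← hσm]
    exact Filter.image_mem_map (Metric.ball_mem_nhds _ hρ3)
  obtain ⟨_, ⟨u, hu, hue⟩, ⟨v, rfl⟩⟩ := mem_closure_iff_nhds.1 hp _ hN
  have hu' : ‖u‖ < ρ / 3 := by simpa using hu
  refine ⟨v + -u, ?_⟩
  simp only at hue ⊢
  rw [ha.add hX hbox hR hx, ← hue, ha.eq_of_box hX hσ' hu' (by simpa using hu'), add_neg_cancel,
    hσ0]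

end IsFrameAction

theorem map_chart_symm_nhds {z : M} {y : EuclideanSpace ℝ (Fin n)}
    (hy : y ∈ (extChartAt (𝓡 n) z).target) :
    Filter.map (extChartAt (𝓡 n) z).symm (𝓝 y) = 𝓝 ((extChartAt (𝓡 n) z).symm y) := by
  refine le_antisymm (contMDiffAt_chart_symm hy).continuousAt fun U hU => ?_
  have hs := (extChartAt (𝓡 n) z).map_target hy
  have hc := (contMDiffAt_chart (n := n) hs).continuousAt
  rw [ContinuousAt, (extChartAt (𝓡 n) z).right_inv hy] at hc
  filter_upwards [hc hU, (isOpen_extChartAt_source z).mem_nhds hs] with w hw hws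
  have hw' : (extChartAt (𝓡 n) z).symm (extChartAt (𝓡 n) z w) ∈ U := hw
  rwa [(extChartAt (𝓡 n) z).left_inv hws] at hw'

/-- A commuting frame of vector fields is a coordinate frame. -/
theorem exists_box_of_bracket_eq_zero [FiniteDimensional ℝ W]
    (hX : ∀ w x, SmoothVFieldAt (fun x => X x w) x) {p : M} (hbij : Function.Bijective (X p))
    (hbr : ∀ᶠ x in 𝓝 p, ∀ a b, bracket (fun x => X x a) (fun x => X x b) x = 0) :
    ∃ σ : W → M, σ 0 = p ∧ Filter.map σ (𝓝 0) = 𝓝 p ∧ ∀ᶠ v in 𝓝 0, HasFrameDerivAt X σ v := by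
  have hps := mem_extChartAt_source (I := 𝓡 n) p
  have hp := (extChartAt (𝓡 n) p).map_source hps
  have hpp := (extChartAt (𝓡 n) p).left_inv hps
  set y₀ := extChartAt (𝓡 n) p p with hy₀
  let B : EuclideanSpace ℝ (Fin n) → W →L[ℝ] EuclideanSpace ℝ (Fin n) := fun y =>
    chartDeriv p _ ∘L X ((extChartAt (𝓡 n) p).symm y)
  have hBs : ContDiffOn ℝ ∞ B (extChartAt (𝓡 n) p).target :=
    contDiffOn_clm_apply.2 fun w y hy =>
      (SmoothVFieldAt.chartRep hy (hX w _)).contDiffWithinAt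
  have hBd : ∀ y ∈ (extChartAt (𝓡 n) p).target, ∀ u b,
      fderiv ℝ B y u b = fderiv ℝ (chartRep p fun x => X x b) y u := by
    intro y hy u b
    have h1 := ((hBs.contDiffAt (chart_target_mem_nhds hy)).differentiableAt (by simp)).hasFDerivAt
    have h2 := h1.clm_apply (hasFDerivAt_const b y)
    have h3 : (fun y => B y b) = chartRep p fun x => X x b := rfl
    rw [h3] at h2
    rw [h2.fderiv]
    simp
  have hBp : Function.Bijective (B y₀) := by
    have h : ∀ x, x = p → Function.Bijective (chartDeriv (n := n) p x ∘L X x) := by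
      rintro _ rfl
      exact ⟨(chartDeriv_injective hps).comp hbij.1, (chartDeriv_surjective hps).comp hbij.2⟩
    exact h _ hpp
  have hinv : (B y₀).IsInvertible := by
    refine ⟨(LinearEquiv.ofBijective (B y₀).toLinearMap hBp).toContinuousLinearEquiv, ?_⟩
    ext w; rfl
  -- Vanishing of brackets, read in the chart, is exactly the symmetry condition of
  -- `exists_straightening`.
  have hsymm : ∀ᶠ y in 𝓝 y₀, ∀ a b : W, fderiv ℝ B y (B y a) b = fderiv ℝ B y (B y b) a := by
    have hc : Tendsto (extChartAt (𝓡 n) p).symm (𝓝 y₀) (𝓝 p) := by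
      have := (contMDiffAt_chart_symm (n := n) hp).continuousAt
      rwa [ContinuousAt, hpp] at this
    filter_upwards [hc.eventually hbr, chart_target_mem_nhds hp] with y hy hyt a b
    rw [hBd y hyt, hBd y hyt]
    have h := (bracket_eq_zero_iff ((extChartAt (𝓡 n) p).map_target hyt) (hX a _) (hX b _)).1
      (hy a b)
    rw [(extChartAt (𝓡 n) p).right_inv hyt, VectorField.lieBracket, sub_eq_zero] at h
    exact h
  obtain ⟨τ, hτ0, hτm, hτ⟩ := exists_straightening B y₀
    ((hBs.contDiffAt (chart_target_mem_nhds hp)).of_le (by exact WithTop.coe_le_coe.2 le_top))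
    hinv hsymm
  refine ⟨(extChartAt (𝓡 n) p).symm ∘ τ, (congrArg (extChartAt (𝓡 n) p).symm hτ0).trans hpp, ?_, ?_⟩
  · rw [← Filter.map_map, hτm, map_chart_symm_nhds hp, hpp]
  · have hτc : Tendsto τ (𝓝 0) (𝓝 y₀) := hτm.le
    filter_upwards [hτ, hτc.eventually (chart_target_mem_nhds hp)] with v hv hvt
    have h1 := HasMFDerivAt.comp v (hasMFDerivAt_chart_symm hvt) (hasMFDerivAt_iff_hasFDerivAt.2 hv)
    have h2 : chartSymmDeriv p (τ v) ∘L B (τ v) = X ((extChartAt (𝓡 n) p).symm (τ v)) :=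
      ContinuousLinearMap.ext fun w => chartSymmDeriv_chartRep hvt fun x => X x w
    exact (congrArg (HasMFDerivAt 𝓘(ℝ, W) (𝓡 n) ((extChartAt (𝓡 n) p).symm ∘ τ) v) h2).mp h1

end Frame

/-! ### The complexified action and the Gram matrix. -/

section ToricFrame

variable {n m : ℕ} {M : Type*} [TopologicalSpace M] [ChartedSpace (EuclideanSpace ℝ (Fin n)) M]
  [MulAction (Torus m) M]

variable (n m) in
/-- The infinitesimal action at a point as a linear map. -/
def infMap (x : M) : (Fin m → ℝ) →L[ℝ] TangentSpace (𝓡 n) x :=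
  ∑ i, (ContinuousLinearMap.proj (R := ℝ) (φ := fun _ : Fin m => ℝ) i).smulRight
    (infAction (n := n) (Pi.single i (1 : ℝ)) x)

/-- The fields `ξ^♯ - J η^♯`. -/
def toricFrame (J : EndField n M) (x : M) :
    (Fin m → ℝ) × (Fin m → ℝ) →L[ℝ] TangentSpace (𝓡 n) x :=
  infMap n m x ∘L ContinuousLinearMap.fst ℝ _ _ -
    J x ∘L infMap n m x ∘L ContinuousLinearMap.snd ℝ _ _

/-- The matrix of `ω(·, J ·)` on the infinitesimal action. -/
def gramMatrix [IsManifold (𝓡 n) ∞ M] (Ω : SymplecticForm n M) (J : EndField n M) (x : M) :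
    Matrix (Fin m) (Fin m) ℝ := fun k j =>
  Ω.form x (infAction (Pi.single k (1 : ℝ)) x) (J x (infAction (Pi.single j (1 : ℝ)) x))

variable [IsManifold (𝓡 n) ∞ M] {Ω : SymplecticForm n M} {μ : M → Fin m → ℝ}
  (hμ : IsHamiltonianToric Ω μ)
include hμ

theorem infMap_apply (x : M) (ξ : Fin m → ℝ) : infMap n m x ξ = infAction (n := n) ξ x := by
  rw [infAction_eq_sum hμ]
  simp [infMap]

theorem toricFrame_apply (J : EndField n M) (x : M) (w : (Fin m → ℝ) × (Fin m → ℝ)) :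
    toricFrame J x w = infAction (n := n) w.1 x + J x (infAction (n := n) (-w.2) x) := by
  rw [← infMap_apply hμ, ← infMap_apply hμ, map_neg, map_neg, ← sub_eq_add_neg]
  rfl

theorem toricFrame_fst (J : EndField n M) (x : M) (ξ : Fin m → ℝ) :
    toricFrame J x (ξ, 0) = infAction (n := n) ξ x := by
  rw [← infMap_apply hμ]
  simp [toricFrame]

theorem toricFrame_snd (J : EndField n M) (x : M) (η : Fin m → ℝ) :
    toricFrame J x (0, η) = -J x (infAction (n := n) η x) := by
  rw [← infMap_apply hμ]
  simp [toricFrame]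

variable {J : EndField n M} (hJ : J ∈ GK m Ω)
include hJ

theorem smoothVFieldAt_image (ξ : Fin m → ℝ) (x : M) :
    SmoothVFieldAt (fun y => J y (infAction (n := n) ξ y)) x :=
  (smoothVFieldAt_infAction hμ.smooth_action ξ x).endField_apply hJ.1.smooth

theorem smoothVFieldAt_toricFrame (w : (Fin m → ℝ) × (Fin m → ℝ)) (x : M) :
    SmoothVFieldAt (fun y => toricFrame J y w) x :=
  ((smoothVFieldAt_infAction hμ.smooth_action w.1 x).add (smoothVFieldAt_image hμ hJ (-w.2) x)).congr
    (Eventually.of_forall fun y => toricFrame_apply hμ J y w)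

theorem actDeriv_image (t : Torus m) (ξ : Fin m → ℝ) (x : M) :
    actDeriv t x (J x (infAction (n := n) ξ x)) = J (t • x) (infAction (n := n) ξ (t • x)) :=
  (hJ.2.2.1 t x _).trans (congrArg (J (t • x)) (actDeriv_infAction hμ.smooth_action t ξ x))

theorem actDeriv_toricFrame (t : Torus m) (w : (Fin m → ℝ) × (Fin m → ℝ)) (x : M) :
    actDeriv t x (toricFrame J x w) = toricFrame J (t • x) w := by
  rw [toricFrame_apply hμ, toricFrame_apply hμ, map_add, actDeriv_image hμ hJ,
    actDeriv_infAction hμ.smooth_action]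

theorem bracket_toricFrame (a b : (Fin m → ℝ) × (Fin m → ℝ)) (x : M) :
    bracket (fun y => toricFrame J y a) (fun y => toricFrame J y b) x = 0 := by
  have hact := hμ.smooth_action
  have hd : ∀ {X : VField n M}, SmoothVFieldAt X x → MDifferentiableAt (𝓡 n) (𝓡 n).tangent
      (fun x => (⟨x, X x⟩ : TangentBundle (𝓡 n) M)) x := fun h => h.mdifferentiableAt (by simp)
  have e : ∀ a : (Fin m → ℝ) × (Fin m → ℝ), (fun y => toricFrame J y a) =
      (infAction (n := n) a.1 + fun y => J y (infAction (n := n) (-a.2) y) : VField n M) :=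
    fun a => funext fun y => toricFrame_apply hμ J y a
  have h1 : bracket (infAction (n := n) a.1) (fun y => toricFrame J y b) x = 0 :=
    bracket_infAction_eq_zero hact _ (smoothVFieldAt_toricFrame hμ hJ b x)
      fun t => actDeriv_toricFrame hμ hJ t b x
  have h2 : bracket (infAction (n := n) b.1) (fun y => J y (infAction (n := n) (-a.2) y)) x = 0 :=
    bracket_infAction_eq_zero hact _ (smoothVFieldAt_image hμ hJ _ x)
      fun t => actDeriv_image hμ hJ t _ x
  have h3 := bracket_image_eq_zero hμ hJ.2.2.1 hJ.2.2.2.1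
    (smoothVFieldAt_image hμ hJ (-a.2) x) (smoothVFieldAt_image hμ hJ (-b.2) x)
  rw [e a, bracket, VectorField.mlieBracket_add_left (hd (smoothVFieldAt_infAction hact a.1 x))
    (hd (smoothVFieldAt_image hμ hJ (-a.2) x)), ← bracket, h1, zero_add, e b,
    VectorField.mlieBracket_add_right (hd (smoothVFieldAt_infAction hact b.1 x))
    (hd (smoothVFieldAt_image hμ hJ (-b.2) x)), VectorField.mlieBracket_swap_apply]
  rw [← bracket, ← bracket, h2, h3, neg_zero, add_zero]

theorem infAction_eq_zero_of_form_image_eq_zero {ξ : Fin m → ℝ} {x : M}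
    (h : Ω.form x (infAction ξ x) (J x (infAction ξ x)) = 0) : infAction (n := n) ξ x = 0 := by
  by_contra hne
  exact (hJ.2.1 x _ hne).ne' h

/-- If `ξ^♯ = J η^♯`, then `ω(η^♯, J η^♯) = ω(η^♯, ξ^♯) = 0` by isotropy, so `η^♯ = 0` by tameness.
Surjectivity is a dimension count. -/
theorem bijective_toricFrame (hn : n = m + m) {x : M} (hx : x ∈ regularSet n m M) :
    Function.Bijective (toricFrame (m := m) J x) := by
  have hinj : Function.Injective (toricFrame (m := m) J x) := by
    refine (injective_iff_map_eq_zero _).2 fun w hw => ?_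
    rw [toricFrame_apply hμ] at hw
    have h1 : infAction (n := n) (-w.2) x = 0 := by
      refine infAction_eq_zero_of_form_image_eq_zero hμ hJ ?_
      rw [eq_neg_of_add_eq_zero_right hw, map_neg, form_infAction_infAction hμ, neg_zero]
    rw [h1, map_zero, add_zero] at hw
    exact Prod.ext (hx _ hw) (neg_eq_zero.1 (hx _ h1))
  have hfin : Module.finrank ℝ ((Fin m → ℝ) × (Fin m → ℝ)) =
      Module.finrank ℝ (TangentSpace (𝓡 n) x) := by
    have : Module.finrank ℝ (TangentSpace (𝓡 n) x) = n := finrank_euclideanSpace_fin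
    rw [this, Module.finrank_prod, Module.finrank_fin_fun, hn]
  exact ⟨hinj, (LinearMap.injective_iff_surjective_of_finrank_eq_finrank (f :=
    (toricFrame (m := m) J x).toLinearMap) hfin).1 hinj⟩

theorem contMDiff_momentDeriv_image (ξ : Fin m → ℝ) (k : Fin m) :
    ContMDiff (𝓡 n) 𝓘(ℝ, ℝ) ∞ fun x => momentDeriv μ x (J x (infAction (n := n) ξ x)) k := by
  have h : (fun x => momentDeriv μ x (J x (infAction (n := n) ξ x)) k) =
      deriveAlong (fun x => J x (infAction (n := n) ξ x)) (fun y => μ y k) :=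
    funext fun x => (deriveAlong_moment hμ (fun x => J x (infAction (n := n) ξ x)) k x).symm
  rw [h]
  exact fun x => contMDiffAt_deriveAlong (contMDiff_moment_apply hμ k)
    (smoothVFieldAt_image hμ hJ ξ x)

theorem contMDiff_gramMatrix (k j : Fin m) :
    ContMDiff (𝓡 n) 𝓘(ℝ, ℝ) ∞ fun x => gramMatrix Ω J x k j := by
  have h : (fun x => gramMatrix Ω J x k j) = fun x =>
      -momentDeriv μ x (J x (infAction (n := n) (Pi.single j 1) x)) k :=
    funext fun x => form_infAction_single hμ k x _
  rw [h]
  exact (contMDiff_momentDeriv_image hμ hJ _ k).neg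

theorem gramMatrix_mulVec (x : M) (ξ : Fin m → ℝ) (k : Fin m) :
    (gramMatrix Ω J x).mulVec ξ k =
      Ω.form x (infAction (Pi.single k (1 : ℝ)) x) (J x (infAction ξ x)) := by
  rw [infAction_eq_sum hμ ξ]
  simp [Matrix.mulVec, dotProduct, gramMatrix, mul_comm]

theorem form_image_eq (x : M) (ξ η : Fin m → ℝ) :
    Ω.form x (infAction ξ x) (J x (infAction η x)) = ξ ⬝ᵥ (gramMatrix Ω J x).mulVec η := by
  simp only [dotProduct, gramMatrix_mulVec hμ hJ]
  rw [infAction_eq_sum hμ ξ]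
  simp

/-- The Gram matrix is not symmetric, but by tameness its quadratic form vanishes only where the
infinitesimal action does. The two kernels therefore agree. -/
theorem mem_regularSet_iff (x : M) : x ∈ regularSet n m M ↔ (gramMatrix (m := m) Ω J x).det ≠ 0 := by
  rw [Ne, ← Matrix.exists_mulVec_eq_zero_iff, not_exists]
  constructor
  · rintro hx ξ ⟨hξ, h⟩
    refine hξ (hx ξ (infAction_eq_zero_of_form_image_eq_zero hμ hJ ?_))
    rw [form_image_eq hμ hJ, h, dotProduct_zero]
  · intro h ξ hξ
    by_contra hne
    refine h ξ ⟨hne, funext fun k => ?_⟩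
    rw [gramMatrix_mulVec hμ hJ, hξ]
    simp

theorem isOpen_regularSet : IsOpen (regularSet n m M) := by
  have h : regularSet n m M = {x | (gramMatrix (m := m) Ω J x).det ≠ 0} :=
    Set.ext fun x => mem_regularSet_iff hμ hJ x
  rw [h]
  refine isOpen_ne_fun ?_ continuous_const
  exact Continuous.matrix_det
    (continuous_matrix fun k j => (contMDiff_gramMatrix hμ hJ k j).continuous)

section Action

variable [T2Space M] {act : (Fin m → ℝ) × (Fin m → ℝ) → M → M}
  (ha : IsFrameAction (toricFrame (m := m) J) act)
include ha

theorem act_torus_smul (t : Torus m) (w : (Fin m → ℝ) × (Fin m → ℝ)) (x : M) :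
    act w (t • x) = t • act w x := by
  have hX := smoothVFieldAt_toricFrame hμ hJ
  have h := ha.eq_of_hasVelocity hX (w := w) (γ := fun s : ℝ => t • act (s • w) x) (fun s => by
    have h1 := (ha.hasVelocity w x s).comp (hasMFDerivAt_torus_smul hμ.smooth_action t _)
    exact h1.congr_velocity (actDeriv_toricFrame hμ hJ t w _)) 1
  simpa [ha.zero] using h.symm

/-- The flows commute with the torus and are invertible, so they carry infinitesimal stabilizers to
infinitesimal stabilizers. -/
theorem act_mem_regularSet (w : (Fin m → ℝ) × (Fin m → ℝ)) (x : M) (hx : x ∈ regularSet n m M) :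
    act w x ∈ regularSet n m M := by
  intro ξ hξ
  refine hx ξ (infAction_eq_zero_of_torusExp_smul_eq hμ.smooth_action fun s => ?_)
  have h1 := torusExp_smul_eq_of_infAction_eq_zero hμ.smooth_action hξ s
  rw [← act_torus_smul hμ hJ ha] at h1
  have h2 : ∀ y, act (-w) (act w y) = y := by
    intro y
    have := ha.add_smul (smoothVFieldAt_toricFrame hμ hJ) w y (-1) 1
    simpa [ha.zero] using this.symm
  have h3 := congrArg (act (-w)) h1
  rwa [h2, h2] at h3

theorem act_fst (ξ : Fin m → ℝ) (x : M) : act (ξ, 0) x = torusExp ξ • x := by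
  have hX := smoothVFieldAt_toricFrame hμ hJ
  have h := ha.eq_of_hasVelocity hX (w := (ξ, 0)) (γ := fun s : ℝ => torusExp (s • ξ) • x)
    (fun s => (hasVelocity_torusExp hμ.smooth_action ξ x s).congr_velocity
      (toricFrame_fst hμ J _ ξ).symm) 1
  simpa [torusExp_zero] using h.symm

variable (hn : n = m + m)
include hn

theorem exists_box_toricFrame (p : M) (hp : p ∈ regularSet n m M) :
    ∃ σ : (Fin m → ℝ) × (Fin m → ℝ) → M, σ 0 = p ∧ Filter.map σ (𝓝 0) = 𝓝 p ∧
      ∀ᶠ v in 𝓝 0, HasFrameDerivAt (toricFrame (m := m) J) σ v :=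
  exists_box_of_bracket_eq_zero (smoothVFieldAt_toricFrame hμ hJ)
    (bijective_toricFrame hμ hJ hn hp)
    (Eventually.of_forall fun x a b => bracket_toricFrame hμ hJ a b x)

theorem hasFrameDerivAt_act {x : M} (hx : x ∈ regularSet n m M) (v : (Fin m → ℝ) × (Fin m → ℝ)) :
    HasFrameDerivAt (toricFrame (m := m) J) (fun v => act v x) v :=
  ha.hasFrameDerivAt (smoothVFieldAt_toricFrame hμ hJ) (exists_box_toricFrame hμ hJ ha hn)
    (act_mem_regularSet hμ hJ ha) hx v

theorem act_eq_torusExp_smul {x : M} (hx : x ∈ regularSet n m M) (ξ η : Fin m → ℝ) :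
    act (ξ, η) x = torusExp ξ • act (0, η) x := by
  rw [← act_fst hμ hJ ha, ← ha.add (smoothVFieldAt_toricFrame hμ hJ)
    (exists_box_toricFrame hμ hJ ha hn) (act_mem_regularSet hμ hJ ha) hx]
  simp

end Action

end ToricFrame

/-! ### The regular set is the preimage of the interior of the moment image. -/

section MomentImage

variable {n m : ℕ} {M : Type*} [TopologicalSpace M] [ChartedSpace (EuclideanSpace ℝ (Fin n)) M]
  [MulAction (Torus m) M] [IsManifold (𝓡 n) ∞ M] [T2Space M]

/-- The moment map along the orbit of the fields `-J ξ^♯`. -/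
def orbitMoment (μ : M → Fin m → ℝ) (act : (Fin m → ℝ) × (Fin m → ℝ) → M → M) (x : M)
    (η : EuclideanSpace ℝ (Fin m)) : EuclideanSpace ℝ (Fin m) :=
  (EuclideanSpace.equiv (Fin m) ℝ).symm (μ (act (0, EuclideanSpace.equiv (Fin m) ℝ η) x))

/-- The derivative of `orbitMoment`. -/
def orbitMomentDeriv (μ : M → Fin m → ℝ) (J : EndField n M)
    (act : (Fin m → ℝ) × (Fin m → ℝ) → M → M) (x : M) (η : EuclideanSpace ℝ (Fin m)) :
    EuclideanSpace ℝ (Fin m) →L[ℝ] EuclideanSpace ℝ (Fin m) :=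
  ((EuclideanSpace.equiv (Fin m) ℝ).symm : (Fin m → ℝ) →L[ℝ] EuclideanSpace ℝ (Fin m)) ∘L
    (momentDeriv μ _ ∘L toricFrame J (act (0, EuclideanSpace.equiv (Fin m) ℝ η) x)) ∘L
      (ContinuousLinearMap.inr ℝ (Fin m → ℝ) (Fin m → ℝ)) ∘L
        (EuclideanSpace.equiv (Fin m) ℝ : EuclideanSpace ℝ (Fin m) →L[ℝ] (Fin m → ℝ))

variable {Ω : SymplecticForm n M} {μ : M → Fin m → ℝ} (hμ : IsHamiltonianToric Ω μ)
  {J : EndField n M} (hJ : J ∈ GK m Ω) {act : (Fin m → ℝ) × (Fin m → ℝ) → M → M}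
  (ha : IsFrameAction (toricFrame (m := m) J) act) (hn : n = m + m) {x : M}
  (hx : x ∈ regularSet n m M)
include hμ hJ ha hn hx

theorem continuous_act : Continuous fun v => act v x :=
  continuous_iff_continuousAt.2 fun v =>
    HasMFDerivAt.continuousAt (hasFrameDerivAt_act hμ hJ ha hn hx v)

theorem hasFDerivAt_orbitMoment (η : EuclideanSpace ℝ (Fin m)) :
    HasFDerivAt (orbitMoment μ act x) (orbitMomentDeriv μ J act x η) η := by
  have h1 : HasFDerivAt (fun v => μ (act v x))
      (momentDeriv μ _ ∘L toricFrame J (act (0, EuclideanSpace.equiv (Fin m) ℝ η) x))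
      (0, EuclideanSpace.equiv (Fin m) ℝ η) :=
    hasMFDerivAt_iff_hasFDerivAt.1 (HasMFDerivAt.comp (0, EuclideanSpace.equiv (Fin m) ℝ η)
      (hasMFDerivAt_moment hμ _) (hasFrameDerivAt_act hμ hJ ha hn hx _))
  have h2 := (EuclideanSpace.equiv (Fin m) ℝ :
    EuclideanSpace ℝ (Fin m) →L[ℝ] (Fin m → ℝ)).hasFDerivAt (x := η)
  have h3 := (ContinuousLinearMap.inr ℝ (Fin m → ℝ) (Fin m → ℝ)).hasFDerivAt.comp η h2
  have h4 := HasFDerivAt.comp η (g := fun v => μ (act v x)) h1 h3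
  exact ((EuclideanSpace.equiv (Fin m) ℝ).symm :
    (Fin m → ℝ) →L[ℝ] EuclideanSpace ℝ (Fin m)).hasFDerivAt.comp η h4

omit hn hx in
theorem orbitMomentDeriv_apply (η ζ : EuclideanSpace ℝ (Fin m)) :
    orbitMomentDeriv μ J act x η ζ = (EuclideanSpace.equiv (Fin m) ℝ).symm
      (-momentDeriv μ _ (J _ (infAction (n := n) (EuclideanSpace.equiv (Fin m) ℝ ζ)
        (act (0, EuclideanSpace.equiv (Fin m) ℝ η) x)))) := by
  have h := congrArg (momentDeriv μ _) (toricFrame_snd hμ J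
    (act (0, EuclideanSpace.equiv (Fin m) ℝ η) x) (EuclideanSpace.equiv (Fin m) ℝ ζ))
  rw [map_neg] at h
  exact congrArg (EuclideanSpace.equiv (Fin m) ℝ).symm h

theorem continuous_orbitMomentDeriv : Continuous (orbitMomentDeriv μ J act x) := by
  refine continuous_clm_apply.2 fun ζ => ?_
  simp only [orbitMomentDeriv_apply hμ hJ ha]
  refine (EuclideanSpace.equiv (Fin m) ℝ).symm.continuous.comp (continuous_pi fun k => ?_)
  have h1 := (contMDiff_momentDeriv_image hμ hJ (EuclideanSpace.equiv (Fin m) ℝ ζ) k).continuous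
  have h2 : Continuous fun η : EuclideanSpace ℝ (Fin m) =>
      act (0, EuclideanSpace.equiv (Fin m) ℝ η) x :=
    (continuous_act hμ hJ ha hn hx).comp
      (continuous_const.prodMk (EuclideanSpace.equiv (Fin m) ℝ).continuous)
  exact (h1.comp h2).neg

/-- The pairing equals `ω(ζ^♯, J ζ^♯)`, positive by tameness. The minus sign in the frame is chosen
for this. -/
theorem orbitMomentDeriv_pos (η ζ : EuclideanSpace ℝ (Fin m)) (hζ : ζ ≠ 0) :
    0 < ⟪ζ, orbitMomentDeriv μ J act x η ζ⟫ := by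
  set y := act (0, EuclideanSpace.equiv (Fin m) ℝ η) x with hy
  have hyR : y ∈ regularSet n m M := act_mem_regularSet hμ hJ ha _ x hx
  set ζ' := EuclideanSpace.equiv (Fin m) ℝ ζ with hζ'
  have h1 : infAction (n := n) ζ' y ≠ 0 := fun h => hζ (by simpa [hζ'] using hyR _ h)
  have h2 := hJ.2.1 y _ h1
  rw [form_infAction hμ] at h2
  rw [orbitMomentDeriv_apply hμ hJ ha, PiLp.inner_apply]
  refine h2.trans_eq ?_
  rw [← Finset.sum_neg_distrib]
  refine Finset.sum_congr rfl fun i _ => ?_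
  simp [hζ']
  ring

theorem moment_act (ξ η : Fin m → ℝ) : μ (act (ξ, η) x) =
    EuclideanSpace.equiv (Fin m) ℝ (orbitMoment μ act x ((EuclideanSpace.equiv (Fin m) ℝ).symm η)) := by
  rw [act_eq_torusExp_smul hμ hJ ha hn hx, hμ.moment_invariant]
  simp only [orbitMoment, ContinuousLinearEquiv.apply_symm_apply]

theorem orbitMoment_injective : Function.Injective (orbitMoment μ act x) := by
  intro a b hab
  by_contra hne
  have h := inner_sub_pos_of_fderiv_pos (hasFDerivAt_orbitMoment hμ hJ ha hn hx)
    (orbitMomentDeriv_pos hμ hJ ha hn hx) hne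
  rw [hab, sub_self, inner_zero_right] at h
  exact lt_irrefl _ h

theorem isOpenMap_orbitMoment : IsOpenMap (orbitMoment μ act x) :=
  isOpenMap_of_fderiv_pos (hasFDerivAt_orbitMoment hμ hJ ha hn hx)
    (continuous_orbitMomentDeriv hμ hJ ha hn hx) (orbitMomentDeriv_pos hμ hJ ha hn hx)

variable (hdense : Dense (regularSet n m M)) (hpre : IsPreconnected (regularSet n m M))
include hpre

theorem exists_act_eq {y : M} (hy : y ∈ regularSet n m M) : ∃ ξ η : Fin m → ℝ, act (ξ, η) x = y := by
  obtain ⟨⟨ξ, η⟩, h⟩ := ha.subset_range (smoothVFieldAt_toricFrame hμ hJ)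
    (exists_box_toricFrame hμ hJ ha hn) (act_mem_regularSet hμ hJ ha) hpre hx hy
  exact ⟨ξ, η, h⟩

/-- `R` is one orbit and the torus does not change the moment map, so the values taken on `R` form
the range of an open map. -/
theorem regularSet_subset_openPart : regularSet n m M ⊆ openPart μ := by
  intro y hy
  obtain ⟨ξ, η, rfl⟩ := exists_act_eq hμ hJ ha hn hx hpre hy
  rw [openPart, mem_preimage, mem_interior]
  refine ⟨EuclideanSpace.equiv (Fin m) ℝ '' range (orbitMoment μ act x), ?_,
    (EuclideanSpace.equiv (Fin m) ℝ).toHomeomorph.isOpenMap _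
      (isOpenMap_orbitMoment hμ hJ ha hn hx).isOpen_range, ?_⟩
  · rintro _ ⟨_, ⟨η, rfl⟩, rfl⟩
    exact ⟨act (0, EuclideanSpace.equiv (Fin m) ℝ η) x,
      by simp only [orbitMoment, ContinuousLinearEquiv.apply_symm_apply]⟩
  · rw [moment_act hμ hJ ha hn hx]
    exact mem_image_of_mem _ (mem_range_self _)

include hdense

/-- By density of `R`, an interior moment value lies in the interior of the closure of the range
along the orbit, so it is attained at some `η₀`. Regular points near `y` have parameters near `η₀`
by injectivity and openness. Modulo periods they lie in a compact subset of `R`, which must then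
contain `y`. -/
theorem openPart_subset_regularSet : openPart μ ⊆ regularSet n m M := by
  set e := EuclideanSpace.equiv (Fin m) ℝ with he
  intro y hy
  have hμc : Continuous μ := hμ.smooth_moment.continuous
  have hrange : range (e.symm ∘ μ) ⊆ closure (range (orbitMoment μ act x)) := by
    have h1 : Continuous (e.symm ∘ μ) := e.symm.continuous.comp hμc
    refine (h1.range_subset_closure_image_dense hdense).trans (closure_mono ?_)
    rintro _ ⟨z, hz, rfl⟩
    obtain ⟨ξ, η, rfl⟩ := exists_act_eq hμ hJ ha hn hx hpre hz
    rw [Function.comp_apply, moment_act hμ hJ ha hn hx, ContinuousLinearEquiv.symm_apply_apply]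
    exact mem_range_self _
  have hyint : e.symm (μ y) ∈ interior (closure (range (orbitMoment μ act x))) := by
    refine mem_interior.2 ⟨e.symm '' interior (range μ), ?_,
      e.symm.toHomeomorph.isOpenMap _ isOpen_interior, mem_image_of_mem _ hy⟩
    rintro _ ⟨p, hp, rfl⟩
    obtain ⟨z, rfl⟩ := interior_subset hp
    exact hrange ⟨z, rfl⟩
  obtain ⟨η₀, hη₀⟩ := interior_closure_range_subset_of_fderiv_pos
    (hasFDerivAt_orbitMoment hμ hJ ha hn hx) (continuous_orbitMomentDeriv hμ hJ ha hn hx)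
    (orbitMomentDeriv_pos hμ hJ ha hn hx) hyint
  set N := Metric.closedBall η₀ 1 with hN
  set C := (fun q : (Fin m → ℝ) × EuclideanSpace ℝ (Fin m) => act (q.1, e q.2) x) ''
    (Set.pi univ (fun _ : Fin m => Icc 0 (2 * Real.pi)) ×ˢ N) with hC
  have hCc : IsCompact C := by
    refine ((isCompact_univ_pi fun _ => isCompact_Icc).prod (isCompact_closedBall _ _)).image ?_
    exact (continuous_act hμ hJ ha hn hx).comp
      (continuous_fst.prodMk (e.continuous.comp continuous_snd))
  have hCR : C ⊆ regularSet n m M := by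
    rintro _ ⟨q, -, rfl⟩
    exact act_mem_regularSet hμ hJ ha _ x hx
  refine hCR (hCc.isClosed.closure_subset ?_)
  rw [mem_closure_iff_nhds]
  intro U hU
  have hU2 : (e.symm ∘ μ) ⁻¹' (orbitMoment μ act x '' Metric.ball η₀ 1) ∈ 𝓝 y := by
    refine (e.symm.continuous.comp hμc).continuousAt ?_
    rw [Function.comp_apply, ← hη₀]
    exact (isOpenMap_orbitMoment hμ hJ ha hn hx).image_mem_nhds (Metric.ball_mem_nhds _ one_pos)
  obtain ⟨z, ⟨hzU, hz2⟩, hzR⟩ := mem_closure_iff_nhds.1 (hdense y) _ (inter_mem hU hU2)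
  refine ⟨z, hzU, ?_⟩
  obtain ⟨ξ, η, rfl⟩ := exists_act_eq hμ hJ ha hn hx hpre hzR
  rw [mem_preimage, Function.comp_apply, moment_act hμ hJ ha hn hx,
    ContinuousLinearEquiv.symm_apply_apply] at hz2
  obtain ⟨η', hη', hηe⟩ := hz2
  have hη : η' = e.symm η := orbitMoment_injective hμ hJ ha hn hx hηe
  choose r hr hrs using fun i => Circle.periodic_exp.exists_mem_Ico₀ Real.two_pi_pos (ξ i)
  refine ⟨(r, η'), ⟨fun i _ => ⟨(hr i).1, (hr i).2.le⟩, Metric.ball_subset_closedBall hη'⟩, ?_⟩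
  have ht : torusExp r = torusExp ξ := funext fun i => (hrs i).symm
  simp only [hη, ContinuousLinearEquiv.apply_symm_apply]
  rw [act_eq_torusExp_smul hμ hJ ha hn hx, ht, ← act_eq_torusExp_smul hμ hJ ha hn hx]

end MomentImage

section MomentImageFour

variable {M : Type*} [TopologicalSpace M] [ChartedSpace (EuclideanSpace ℝ (Fin 4)) M]
  [MulAction (Torus 2) M] [IsManifold (𝓡 4) ∞ M] [T2Space M] [CompactSpace M] [ConnectedSpace M]
  {Ω : SymplecticForm 4 M} {μ : M → Fin 2 → ℝ} (hμ : IsHamiltonianToric Ω μ)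
  {J : EndField 4 M} (hJ : J ∈ GK 2 Ω)
include hμ hJ

/-- The torus acts freely, up to a discrete group, exactly over the interior of the moment
polytope. -/
theorem openPart_eq_regularSet : openPart μ = regularSet 4 2 M := by
  have hdense := dense_regularSet hμ hJ.1.sq hJ.2.2.1 (by norm_num)
  have hpre := isPreconnected_regularSet hμ hJ.1.sq hJ.2.2.1 (by norm_num)
  obtain ⟨x, hx⟩ := hdense.nonempty
  obtain ⟨act, ha⟩ := exists_isFrameAction (smoothVFieldAt_toricFrame hμ hJ)
  exact (openPart_subset_regularSet hμ hJ ha rfl hx hdense hpre).antisymm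
    (regularSet_subset_openPart hμ hJ ha rfl hx hpre)

end MomentImageFour

/-! ### Integrability of both structures as differential relations on the Gram matrix. -/

section Ratio

variable {M : Type*} [TopologicalSpace M] [ChartedSpace (EuclideanSpace ℝ (Fin 4)) M]
  [MulAction (Torus 2) M] [IsManifold (𝓡 4) ∞ M] {Ω : SymplecticForm 4 M} {μ : M → Fin 2 → ℝ}

/-- The image of a generator of the action under a field of endomorphisms. -/
def imageField (A : EndField 4 M) (i : Fin 2) : VField 4 M :=
  fun y => A y (infAction (Pi.single i (1 : ℝ)) y)

variable (hμ : IsHamiltonianToric Ω μ) {J : EndField 4 M}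

section
include hμ

theorem infAction_eq_add (ξ : Fin 2 → ℝ) (x : M) :
    infAction (n := 4) ξ x = ξ 0 • infAction (n := 4) (Pi.single (0 : Fin 2) (1 : ℝ)) x +
      ξ 1 • infAction (n := 4) (Pi.single (1 : Fin 2) (1 : ℝ)) x := by
  rw [infAction_eq_sum hμ, Fin.sum_univ_two]

theorem deriveAlong_imageField (j k : Fin 2) :
    deriveAlong (imageField J j) (fun y => μ y k) = fun y => -gramMatrix (m := 2) Ω J y k j := by
  funext y
  rw [deriveAlong_moment hμ, gramMatrix, form_infAction_single hμ, neg_neg]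
  rfl

theorem deriveAlong_imageField_adj (j k : Fin 2) :
    deriveAlong (imageField (Ω.adj J) j) (fun y => μ y k) = fun y => gramMatrix (m := 2) Ω J y j k := by
  funext y
  rw [deriveAlong_moment hμ, gramMatrix, Ω.antisymm, Ω.form_adj, form_infAction_single hμ, neg_neg]
  rfl

end

variable (hJ : J ∈ DGK Ω μ)
include hμ hJ

theorem exists_adj_infAction_eq {x : M} (hx : x ∈ openPart μ) (ξ : Fin 2 → ℝ) :
    ∃ ζ : Fin 2 → ℝ, Ω.adj J x (infAction (n := 4) ξ x) = J x (infAction (n := 4) ζ x) := by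
  have h1 : Ω.adj J x (infAction (n := 4) ξ x) ∈ (orbitDist 2 x).map
      (J x : TangentSpace (𝓡 4) x →ₗ[ℝ] TangentSpace (𝓡 4) x) := by
    rw [← hJ.2 x hx]
    exact Submodule.mem_map_of_mem (Submodule.subset_span ⟨ξ, rfl⟩)
  have h2 : orbitDist 2 x ≤ LinearMap.range (infMap 4 2 x).toLinearMap :=
    Submodule.span_le.2 (by rintro _ ⟨ζ, rfl⟩; exact ⟨ζ, infMap_apply hμ x ζ⟩)
  obtain ⟨κ, hκ, hκe⟩ := h1
  obtain ⟨ζ, rfl⟩ := h2 hκ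
  exact ⟨ζ, hκe.symm.trans (congrArg (J x) (infMap_apply hμ x ζ))⟩

variable (hreg : openPart μ = regularSet 4 2 M)
include hreg

theorem det_gramMatrix_ne_zero {x : M} (hx : x ∈ openPart μ) :
    gramMatrix (m := 2) Ω J x 0 0 * gramMatrix (m := 2) Ω J x 1 1 -
      gramMatrix (m := 2) Ω J x 0 1 * gramMatrix (m := 2) Ω J x 1 0 ≠ 0 := by
  rw [hreg, mem_regularSet_iff hμ hJ.1, Matrix.det_fin_two] at hx
  exact hx

/-- The coefficients expressing the fields `J^{*ω} ξ^♯` through the fields `J ξ^♯`. -/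
theorem adj_imageField_eq {x : M} (hx : x ∈ openPart μ) (j : Fin 2) :
    imageField (Ω.adj J) j x =
      ((gramMatrix (m := 2) Ω J x 0 1 * gramMatrix (m := 2) Ω J x j 1 - gramMatrix (m := 2) Ω J x 1 1 * gramMatrix (m := 2) Ω J x j 0) /
        (gramMatrix (m := 2) Ω J x 0 0 * gramMatrix (m := 2) Ω J x 1 1 -
          gramMatrix (m := 2) Ω J x 0 1 * gramMatrix (m := 2) Ω J x 1 0)) • imageField J 0 x +
      ((gramMatrix (m := 2) Ω J x 1 0 * gramMatrix (m := 2) Ω J x j 0 - gramMatrix (m := 2) Ω J x 0 0 * gramMatrix (m := 2) Ω J x j 1) /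
        (gramMatrix (m := 2) Ω J x 0 0 * gramMatrix (m := 2) Ω J x 1 1 -
          gramMatrix (m := 2) Ω J x 0 1 * gramMatrix (m := 2) Ω J x 1 0)) • imageField J 1 x := by
  have hdet := det_gramMatrix_ne_zero hμ hJ hreg hx
  obtain ⟨ζ, hζ⟩ := exists_adj_infAction_eq hμ hJ hx (Pi.single j 1)
  -- Pairing the relation `J^{*ω} K_j = J ζ^♯` with the generators gives a linear system for `ζ`,
  -- solved by Cramer's rule.
  have hk : ∀ k : Fin 2, gramMatrix (m := 2) Ω J x k 0 * ζ 0 + gramMatrix (m := 2) Ω J x k 1 * ζ 1 =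
      -gramMatrix (m := 2) Ω J x j k := by
    intro k
    have h1 := gramMatrix_mulVec hμ hJ.1 x ζ k
    rw [← hζ, ← Ω.form_adj, Ω.antisymm] at h1
    change _ = -Ω.form x (infAction (Pi.single j (1 : ℝ)) x) (J x (infAction (Pi.single k (1 : ℝ)) x))
    simpa [Matrix.mulVec, dotProduct, Fin.sum_univ_two] using h1
  have h0 := hk 0
  have h1 := hk 1
  have e0 : (gramMatrix (m := 2) Ω J x 0 1 * gramMatrix (m := 2) Ω J x j 1 -
      gramMatrix (m := 2) Ω J x 1 1 * gramMatrix (m := 2) Ω J x j 0) /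
        (gramMatrix (m := 2) Ω J x 0 0 * gramMatrix (m := 2) Ω J x 1 1 -
          gramMatrix (m := 2) Ω J x 0 1 * gramMatrix (m := 2) Ω J x 1 0) = ζ 0 := by
    rw [div_eq_iff hdet]
    linear_combination (-gramMatrix (m := 2) Ω J x 1 1) * h0 + gramMatrix (m := 2) Ω J x 0 1 * h1
  have e1 : (gramMatrix (m := 2) Ω J x 1 0 * gramMatrix (m := 2) Ω J x j 0 -
      gramMatrix (m := 2) Ω J x 0 0 * gramMatrix (m := 2) Ω J x j 1) /
        (gramMatrix (m := 2) Ω J x 0 0 * gramMatrix (m := 2) Ω J x 1 1 -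
          gramMatrix (m := 2) Ω J x 0 1 * gramMatrix (m := 2) Ω J x 1 0) = ζ 1 := by
    rw [div_eq_iff hdet]
    linear_combination gramMatrix (m := 2) Ω J x 1 0 * h0 - gramMatrix (m := 2) Ω J x 0 0 * h1
  rw [e0, e1]
  refine hζ.trans ?_
  rw [infAction_eq_add hμ ζ, map_add, map_smul, map_smul]
  rfl

/-- Smoothness comes from the Cramer coefficients in the frame, so smoothness of the adjoint field
itself is not needed. -/
theorem smoothVFieldAt_adj_imageField {x : M} (hx : x ∈ openPart μ) (j : Fin 2) :
    SmoothVFieldAt (imageField (Ω.adj J) j) x := by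
  have hop : openPart μ ∈ 𝓝 x := by
    have := isOpen_regularSet hμ hJ.1
    rw [← hreg] at this
    exact this.mem_nhds hx
  have hg : ∀ k l : Fin 2, ContMDiffAt (𝓡 4) 𝓘(ℝ, ℝ) ∞ (fun y => gramMatrix (m := 2) Ω J y k l) x :=
    fun k l => contMDiff_gramMatrix hμ hJ.1 k l x
  have hd : ContMDiffAt (𝓡 4) 𝓘(ℝ, ℝ) ∞ (fun x => gramMatrix (m := 2) Ω J x 0 0 *
      gramMatrix (m := 2) Ω J x 1 1 - gramMatrix (m := 2) Ω J x 0 1 * gramMatrix (m := 2) Ω J x 1 0)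
      x := ((hg 0 0).mul (hg 1 1)).sub ((hg 0 1).mul (hg 1 0))
  have hdet := det_gramMatrix_ne_zero hμ hJ hreg hx
  refine SmoothVFieldAt.congr (SmoothVFieldAt.add (SmoothVFieldAt.smul ?_ ?_)
    (SmoothVFieldAt.smul ?_ ?_)) (by
      filter_upwards [hop] with y hy using adj_imageField_eq hμ hJ hreg hy j)
  · exact (((hg 0 1).mul (hg j 1)).sub ((hg 1 1).mul (hg j 0))).div₀ hd hdet
  · exact smoothVFieldAt_image hμ hJ.1 _ x
  · exact (((hg 1 0).mul (hg j 0)).sub ((hg 0 0).mul (hg j 1))).div₀ hd hdet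
  · exact smoothVFieldAt_image hμ hJ.1 _ x

/-- The fields `J K₀, J K₁` commute, and their derivatives of the component `μ k` are minus the
`k`-th row of the Gram matrix. -/
theorem deriv_gramMatrix_image (x : M) (k : Fin 2) :
    deriveAlong (imageField J 0) (fun y => gramMatrix (m := 2) Ω J y k 1) x =
      deriveAlong (imageField J 1) (fun y => gramMatrix (m := 2) Ω J y k 0) x := by
  have h := deriveAlong_deriveAlong_comm (X := imageField J 0) (Y := imageField J 1)
    (smoothVFieldAt_image hμ hJ.1 _ x)
    (smoothVFieldAt_image hμ hJ.1 _ x) (contMDiff_moment_apply hμ k)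
    (bracket_image_eq_zero hμ hJ.1.2.2.1 hJ.1.2.2.2.1 (smoothVFieldAt_image hμ hJ.1 _ x)
      (smoothVFieldAt_image hμ hJ.1 _ x))
  rw [deriveAlong_imageField hμ, deriveAlong_imageField hμ] at h
  have hneg : ∀ (X : VField 4 M) (f : M → ℝ),
      deriveAlong X (fun y => -f y) x = -deriveAlong X f x := by
    intro X f
    have : mvfderiv (𝓡 4) (fun y => -f y) x = -mvfderiv (𝓡 4) f x := mvfderiv_neg
    exact congrArg (fun L => L (X x)) this
  rw [hneg, hneg, neg_inj] at h
  exact h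

/-- The same argument for the adjoint, whose fields differentiate `μ k` to the `k`-th column. -/
theorem deriv_gramMatrix_adj {x : M} (hx : x ∈ openPart μ) (k : Fin 2) :
    deriveAlong (imageField (Ω.adj J) 0) (fun y => gramMatrix (m := 2) Ω J y 1 k) x =
      deriveAlong (imageField (Ω.adj J) 1) (fun y => gramMatrix (m := 2) Ω J y 0 k) x := by
  have h := deriveAlong_deriveAlong_comm (X := imageField (Ω.adj J) 0)
    (Y := imageField (Ω.adj J) 1) (smoothVFieldAt_adj_imageField hμ hJ hreg hx 0)
    (smoothVFieldAt_adj_imageField hμ hJ hreg hx 1) (contMDiff_moment_apply hμ k)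
    (bracket_image_eq_zero hμ (invariantEnd_adj hμ hJ.1.2.2.1) hJ.1.2.2.2.2
      (smoothVFieldAt_adj_imageField hμ hJ hreg hx 0)
      (smoothVFieldAt_adj_imageField hμ hJ hreg hx 1))
  rwa [deriveAlong_imageField_adj hμ, deriveAlong_imageField_adj hμ] at h

/-- The antisymmetric part of the Gram matrix and its determinant have proportional derivatives. -/
theorem deriv_ratio_eq_zero {x : M} (hx : x ∈ openPart μ) (i : Fin 2) {a b c d : ℝ}
    {D : Fin 2 → Fin 2 → ℝ} (ha : gramMatrix (m := 2) Ω J x 0 0 = a) (hb : gramMatrix (m := 2) Ω J x 0 1 = b)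
    (hc : gramMatrix (m := 2) Ω J x 1 0 = c) (hd : gramMatrix (m := 2) Ω J x 1 1 = d)
    (hD : ∀ k l, D k l = deriveAlong (imageField J i) (fun y => gramMatrix (m := 2) Ω J y k l) x) :
    (D 0 1 - D 1 0) * (a * d - b * c) =
      (b - c) * (D 0 0 * d + a * D 1 1 - D 0 1 * c - b * D 1 0) := by
  have hdet := det_gramMatrix_ne_zero hμ hJ hreg hx
  have hV : ∀ j k l, deriveAlong (imageField (Ω.adj J) j) (fun y => gramMatrix (m := 2) Ω J y k l) x =
      ((gramMatrix (m := 2) Ω J x 0 1 * gramMatrix (m := 2) Ω J x j 1 - gramMatrix (m := 2) Ω J x 1 1 * gramMatrix (m := 2) Ω J x j 0) /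
        (gramMatrix (m := 2) Ω J x 0 0 * gramMatrix (m := 2) Ω J x 1 1 -
          gramMatrix (m := 2) Ω J x 0 1 * gramMatrix (m := 2) Ω J x 1 0)) *
            deriveAlong (imageField J 0) (fun y => gramMatrix (m := 2) Ω J y k l) x +
      ((gramMatrix (m := 2) Ω J x 1 0 * gramMatrix (m := 2) Ω J x j 0 - gramMatrix (m := 2) Ω J x 0 0 * gramMatrix (m := 2) Ω J x j 1) /
        (gramMatrix (m := 2) Ω J x 0 0 * gramMatrix (m := 2) Ω J x 1 1 -
          gramMatrix (m := 2) Ω J x 0 1 * gramMatrix (m := 2) Ω J x 1 0)) *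
            deriveAlong (imageField J 1) (fun y => gramMatrix (m := 2) Ω J y k l) x := by
    intro j k l
    rw [deriveAlong, adj_imageField_eq hμ hJ hreg hx, map_add, map_smul, map_smul]
    rfl
  have a0 := deriv_gramMatrix_image hμ hJ hreg x 0
  have a1 := deriv_gramMatrix_image hμ hJ hreg x 1
  have b0 := deriv_gramMatrix_adj hμ hJ hreg hx 0
  have b1 := deriv_gramMatrix_adj hμ hJ hreg hx 1
  rw [hV, hV] at b0 b1
  simp only [ha, hb, hc, hd] at hdet b0 b1
  -- The relations for `J` turn every derivative in `b0` into one along `J K₀`, and every derivative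
  -- in `b1` into one along `J K₁`. With denominators cleared these are the claims for `i = 0` and
  -- `i = 1`.
  rw [← a0, ← a1] at b0
  rw [a0, a1] at b1
  have hdet' : d * a - b * c ≠ 0 := by rwa [mul_comm d a]
  field_simp at b0 b1
  fin_cases i <;> simp only [Fin.zero_eta, Fin.mk_one, Fin.isValue] at hD
  · rw [hD, hD, hD, hD]
    linear_combination b0
  · rw [hD, hD, hD, hD]
    linear_combination b1

end Ratio

/-! ### Constancy of the ratio of antisymmetric part to determinant. -/

section Constant

variable {M : Type*} [TopologicalSpace M] [ChartedSpace (EuclideanSpace ℝ (Fin 4)) M]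
  [MulAction (Torus 2) M] [IsManifold (𝓡 4) ∞ M] {Ω : SymplecticForm 4 M} {μ : M → Fin 2 → ℝ}
  (hμ : IsHamiltonianToric Ω μ) {J : EndField 4 M} (hJ : J ∈ DGK Ω μ)
include hμ hJ

theorem gramMatrix_torus_smul (t : Torus 2) (x : M) :
    gramMatrix (m := 2) Ω J (t • x) = gramMatrix (m := 2) Ω J x := by
  ext k j
  have h := hμ.symplectic t x (infAction (Pi.single k (1 : ℝ)) x)
    (J x (infAction (Pi.single j (1 : ℝ)) x))
  rw [gramMatrix, gramMatrix, ← h]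
  exact congrArg₂ (fun u v => Ω.form (t • x) u v)
    (actDeriv_infAction hμ.smooth_action t _ x).symm (actDeriv_image hμ hJ.1 t _ x).symm

variable [T2Space M] (hreg : openPart μ = regularSet 4 2 M)
  {act : (Fin 2 → ℝ) × (Fin 2 → ℝ) → M → M} (ha : IsFrameAction (toricFrame (m := 2) J) act)
include hreg ha

/-- The ratio of the antisymmetric part of the Gram matrix to its determinant is constant along
the fields `J ξ^♯`. -/
theorem gramMatrix_ratio_act {x : M} (hx : x ∈ openPart μ) (ζ : Fin 2 → ℝ) :
    (gramMatrix (m := 2) Ω J (act (0, ζ) x) 0 1 - gramMatrix (m := 2) Ω J (act (0, ζ) x) 1 0) /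
        (gramMatrix (m := 2) Ω J (act (0, ζ) x)).det =
      (gramMatrix (m := 2) Ω J x 0 1 - gramMatrix (m := 2) Ω J x 1 0) /
        (gramMatrix (m := 2) Ω J x).det := by
  simp only [Matrix.det_fin_two]
  set γ : ℝ → M := fun r => act (r • ((0 : Fin 2 → ℝ), ζ)) x with hγ
  have hmem : ∀ r, γ r ∈ openPart μ := fun r => by
    rw [hreg] at hx ⊢
    exact act_mem_regularSet hμ hJ.1 ha _ x hx
  have hvel : ∀ r, HasVelocity γ r (toricFrame J (γ r) (0, ζ)) := ha.hasVelocity _ x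
  have hder : ∀ (k l : Fin 2) (r : ℝ), HasDerivAt (fun r => gramMatrix (m := 2) Ω J (γ r) k l)
      (-(ζ 0 * deriveAlong (imageField J 0) (fun y => gramMatrix (m := 2) Ω J y k l) (γ r) +
        ζ 1 * deriveAlong (imageField J 1) (fun y => gramMatrix (m := 2) Ω J y k l) (γ r))) r := by
    intro k l r
    have h1 := (hvel r).hasDerivAt_comp (hasMFDerivAt_mvfderiv
      ((contMDiff_gramMatrix hμ hJ.1 k l (γ r)).mdifferentiableAt (by simp)))
    refine h1.congr_deriv ?_
    rw [toricFrame_snd hμ, map_neg, infAction_eq_add hμ ζ, map_add, map_add, map_smul, map_smul,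
      map_smul, map_smul]
    rfl
  have hder0 : ∀ r, HasDerivAt (fun r =>
      (gramMatrix (m := 2) Ω J (γ r) 0 1 - gramMatrix (m := 2) Ω J (γ r) 1 0) /
        (gramMatrix (m := 2) Ω J (γ r) 0 0 * gramMatrix (m := 2) Ω J (γ r) 1 1 -
          gramMatrix (m := 2) Ω J (γ r) 0 1 * gramMatrix (m := 2) Ω J (γ r) 1 0)) 0 r := by
    intro r
    have hdet := det_gramMatrix_ne_zero hμ hJ hreg (hmem r)
    have h := ((hder 0 1 r).sub (hder 1 0 r)).div
      (((hder 0 0 r).mul (hder 1 1 r)).sub ((hder 0 1 r).mul (hder 1 0 r))) hdet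
    have e : ∀ i, _ := fun i => deriv_ratio_eq_zero hμ hJ hreg (hmem r) i rfl rfl rfl rfl
      (fun k l => rfl)
    refine h.congr_deriv ?_
    simp only [Pi.sub_apply, Pi.mul_apply]
    rw [div_eq_zero_iff]
    left
    linear_combination (-ζ 0) * e 0 - ζ 1 * e 1
  have h := is_const_of_deriv_eq_zero (fun r => (hder0 r).differentiableAt)
    (fun r => (hder0 r).deriv) 1 0
  have h0 : act ((0 : Fin 2 → ℝ), (0 : Fin 2 → ℝ)) x = x := ha.zero x
  simpa [hγ, h0] using h

end Constant

section Skew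

variable {M : Type*} [TopologicalSpace M] [ChartedSpace (EuclideanSpace ℝ (Fin 4)) M]
  [MulAction (Torus 2) M] [IsManifold (𝓡 4) ∞ M] [T2Space M] [CompactSpace M] [ConnectedSpace M]
  {Ω : SymplecticForm 4 M} {μ : M → Fin 2 → ℝ}
  (hμ : IsHamiltonianToric Ω μ) {J : EndField 4 M} (hJ : J ∈ DGK Ω μ)
include hμ hJ

/-- Every regular point is reached from one base point by a flow of a field `-J η^♯` followed by a
torus element, and neither changes the ratio. -/
theorem exists_gramMatrix_ratio : ∃ c : ℝ, ∀ x ∈ regularSet 4 2 M,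
    gramMatrix (m := 2) Ω J x 0 1 - gramMatrix (m := 2) Ω J x 1 0 =
      c * (gramMatrix (m := 2) Ω J x).det := by
  have hreg := openPart_eq_regularSet hμ hJ.1
  have hdense := dense_regularSet hμ hJ.1.1.sq hJ.1.2.2.1 (by norm_num)
  have hpre := isPreconnected_regularSet hμ hJ.1.1.sq hJ.1.2.2.1 (by norm_num)
  obtain ⟨x₀, hx₀⟩ := hdense.nonempty
  obtain ⟨act, ha⟩ := exists_isFrameAction (smoothVFieldAt_toricFrame hμ hJ.1)
  refine ⟨(gramMatrix (m := 2) Ω J x₀ 0 1 - gramMatrix (m := 2) Ω J x₀ 1 0) /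
    (gramMatrix (m := 2) Ω J x₀).det, fun x hx => ?_⟩
  obtain ⟨ξ, η, rfl⟩ := exists_act_eq hμ hJ.1 ha rfl hx₀ hpre hx
  have hdet := (mem_regularSet_iff hμ hJ.1 _).1 hx
  rw [act_eq_torusExp_smul hμ hJ.1 ha rfl hx₀, gramMatrix_torus_smul hμ hJ] at hdet ⊢
  rw [← gramMatrix_ratio_act hμ hJ hreg ha (hreg ▸ hx₀) η, div_mul_cancel₀ _ hdet]

end Skew

/-- The form `ω(·, J·) + ω(J·, ·)`, which vanishes where `J` is compatible with `ω`. -/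
def skewPart {n : ℕ} {M : Type*} [TopologicalSpace M] [ChartedSpace (EuclideanSpace ℝ (Fin n)) M]
    [IsManifold (𝓡 n) ∞ M] (Ω : SymplecticForm n M) (J : EndField n M) (x : M)
    (v w : TangentSpace (𝓡 n) x) : ℝ :=
  Ω.form x v (J x w) + Ω.form x (J x v) w

/-! ### The defect of compatibility in the frame. -/

section Proportional

variable {M : Type*} [TopologicalSpace M] [ChartedSpace (EuclideanSpace ℝ (Fin 4)) M]
  [MulAction (Torus 2) M] [IsManifold (𝓡 4) ∞ M]
  {Ω : SymplecticForm 4 M} {μ : M → Fin 2 → ℝ}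

/-- The real part of the square of the volume form `ν₁ ∧ ν₂`, with `νᵢ = ω(Kᵢ, ·)`, under `J`. -/
def momentWedge (Ω : SymplecticForm 4 M) (J : EndField 4 M) (x : M)
    (v w : TangentSpace (𝓡 4) x) : ℝ :=
  Ω.form x (infAction (Pi.single (0 : Fin 2) (1 : ℝ)) x) v *
      Ω.form x (infAction (Pi.single (1 : Fin 2) (1 : ℝ)) x) w -
    Ω.form x (infAction (Pi.single (0 : Fin 2) (1 : ℝ)) x) w *
      Ω.form x (infAction (Pi.single (1 : Fin 2) (1 : ℝ)) x) v -
    (Ω.form x (infAction (Pi.single (0 : Fin 2) (1 : ℝ)) x) (J x v) *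
      Ω.form x (infAction (Pi.single (1 : Fin 2) (1 : ℝ)) x) (J x w) -
    Ω.form x (infAction (Pi.single (0 : Fin 2) (1 : ℝ)) x) (J x w) *
      Ω.form x (infAction (Pi.single (1 : Fin 2) (1 : ℝ)) x) (J x v))

variable (hμ : IsHamiltonianToric Ω μ) {J : EndField 4 M} (hJ : J ∈ DGK Ω μ)
include hμ hJ

theorem adj_adj (x : M) (v : TangentSpace (𝓡 4) x) : Ω.adj J x (Ω.adj J x v) = -v := by
  refine sub_eq_zero.1 (Ω.nondegenerate x _ fun w => ?_)
  rw [Ω.antisymm, map_sub, ← Ω.form_adj, ← Ω.form_adj, hJ.1.1.sq]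
  simp

/-- Writing the second vector as `J^{*ω} κ` moves the first `J` across: `ω(J ξ^♯, J^{*ω} κ) = ω(ξ^♯,
(J^{*ω})² κ) = -ω(ξ^♯, κ)`, which vanishes by isotropy of orbits. -/
theorem form_image_image_eq_zero {x : M} (hx : x ∈ openPart μ) (ξ η : Fin 2 → ℝ) :
    Ω.form x (J x (infAction ξ x)) (J x (infAction η x)) = 0 := by
  obtain ⟨κ, hκ⟩ : ∃ κ ∈ orbitDist 2 x, Ω.adj J x κ = J x (infAction (n := 4) η x) := by
    have h1 : J x (infAction (n := 4) η x) ∈ (orbitDist 2 x).map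
        (Ω.adj J x : TangentSpace (𝓡 4) x →ₗ[ℝ] TangentSpace (𝓡 4) x) := by
      rw [hJ.2 x hx]
      exact Submodule.mem_map_of_mem (Submodule.subset_span ⟨η, rfl⟩)
    exact h1
  have h2 : orbitDist 2 x ≤ LinearMap.range (infMap 4 2 x).toLinearMap :=
    Submodule.span_le.2 (by rintro _ ⟨ζ, rfl⟩; exact ⟨ζ, infMap_apply hμ x ζ⟩)
  obtain ⟨ζ, hζ⟩ := h2 hκ.1
  have h3 : κ = infAction (n := 4) ζ x := hζ.symm.trans (infMap_apply hμ x ζ)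
  rw [Ω.form_adj, ← hκ.2, adj_adj hμ hJ, h3, map_neg, form_infAction_infAction hμ, neg_zero]

/-- On the regular set, the form `skewPart` is proportional to `momentWedge`. -/
theorem skewPart_eq_of_mem {x : M} (hx : x ∈ openPart μ) (hxR : x ∈ regularSet 4 2 M) {c : ℝ}
    (hc : gramMatrix (m := 2) Ω J x 0 1 - gramMatrix (m := 2) Ω J x 1 0 =
      c * (gramMatrix (m := 2) Ω J x).det) (v w : TangentSpace (𝓡 4) x) :
    skewPart Ω J x v w = -c * momentWedge Ω J x v w := by
  obtain ⟨⟨ξ, η⟩, rfl⟩ := (bijective_toricFrame hμ hJ.1 rfl hxR).2 v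
  obtain ⟨⟨ξ', η'⟩, rfl⟩ := (bijective_toricFrame hμ hJ.1 rfl hxR).2 w
  simp only [toricFrame_apply hμ]
  generalize -η = α
  generalize -η' = α'
  have hanti : ∀ ξ η : Fin 2 → ℝ, Ω.form x (J x (infAction ξ x)) (infAction η x) =
      -Ω.form x (infAction η x) (J x (infAction ξ x)) := fun ξ η => Ω.antisymm x _ _
  simp only [skewPart, momentWedge, map_add, map_neg, add_apply, neg_apply, hJ.1.1.sq,
    form_infAction_infAction hμ, form_image_image_eq_zero hμ hJ hx, hanti, form_image_eq hμ hJ.1]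
  simp only [Matrix.det_fin_two] at hc
  simp only [Matrix.mulVec, dotProduct, Fin.sum_univ_two, Pi.single_apply]
  simp
  -- In frame coordinates both sides are multiples of `ξ ∧ ξ' - α ∧ α'`, with factors `G 0 1 - G 1
  -- 0` and `c det G`.
  linear_combination (ξ 0 * ξ' 1 - ξ 1 * ξ' 0 - α 0 * α' 1 + α 1 * α' 0) * hc

end Proportional

/-! ### Extending vectors to fields; pointwise forms of compatibility. -/

section Extension

variable {n : ℕ} {M : Type*} [TopologicalSpace M] [ChartedSpace (EuclideanSpace ℝ (Fin n)) M]
  [IsManifold (𝓡 n) ∞ M]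

/-- A field constant in the chart suffices. It lets tensor identities on a dense set be extended by
continuity of scalar functions. -/
theorem exists_smoothVFieldAt_eq (x : M) (v : TangentSpace (𝓡 n) x) :
    ∃ X : VField n M, SmoothVFieldAt X x ∧ X x = v := by
  have hxs := mem_extChartAt_source (I := 𝓡 n) x
  have hx := (extChartAt (𝓡 n) x).map_source hxs
  let u : EuclideanSpace ℝ (Fin n) := chartDeriv x x v
  let X : VField n M := fun y =>
    (chartSymmDeriv x (extChartAt (𝓡 n) x y) u : EuclideanSpace ℝ (Fin n))
  refine ⟨X, smoothVFieldAt_of_chartRep ?_, ?_⟩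
  · refine (contDiffAt_const (c := u)).congr_of_eventuallyEq ?_
    filter_upwards [chart_target_mem_nhds hx] with y hy
    have h : ∀ y', y' = y → chartDeriv x ((extChartAt (𝓡 n) x).symm y)
        ((chartSymmDeriv x y' u : EuclideanSpace ℝ (Fin n))) = u := by
      rintro _ rfl
      exact chartDeriv_chartSymmDeriv hy u
    exact h _ ((extChartAt (𝓡 n) x).right_inv hy)
  · have h : ∀ x', x' = x → chartDeriv x x'
        ((chartSymmDeriv x (extChartAt (𝓡 n) x x) u : EuclideanSpace ℝ (Fin n))) = u →
        chartDeriv x x (X x) = u := by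
      rintro _ rfl; exact id
    exact chartDeriv_injective hxs
      (h _ ((extChartAt (𝓡 n) x).left_inv hxs) (chartDeriv_chartSymmDeriv hx u))

theorem contMDiffAt_form (Ω : SymplecticForm n M) {X Y : VField n M} {x : M}
    (hX : SmoothVFieldAt X x) (hY : SmoothVFieldAt Y x) :
    ContMDiffAt (𝓡 n) 𝓘(ℝ, ℝ) ∞ (fun y => Ω.form y (X y) (Y y)) x := by
  have h := ContMDiffAt.clm_bundle_apply₂ (F₃ := ℝ) (E₃ := Bundle.Trivial M ℝ) (b := fun y : M => y)
    (Ω.smooth x) hX hY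
  rw [Bundle.contMDiffAt_section] at h
  exact h

theorem skewPart_eq_zero_iff_adj (Ω : SymplecticForm n M) (J : EndField n M) (x : M) :
    (∀ v w, skewPart Ω J x v w = 0) ↔ J x = -Ω.adj J x := by
  constructor
  · intro h
    have h1 : -J x = Ω.adj J x := Ω.eq_adj J x _ fun v w => by
      have := h v w
      rw [skewPart] at this
      rw [neg_apply, map_neg]
      linarith
    rw [← h1, neg_neg]
  · intro h v w
    rw [skewPart, Ω.form_adj]
    have h1 : Ω.adj J x w = -J x w := by
      have := congrArg (fun L => L w) h
      rw [neg_apply] at this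
      rw [this, neg_neg]
    rw [h1, map_neg, add_neg_cancel]

theorem isCompatibleAt_iff {Ω : SymplecticForm n M} {J : EndField n M} (hJ : IsAlmostComplex J)
    (ht : IsTamed Ω J) (x : M) :
    IsCompatibleAt Ω J x ↔ ∀ v w, skewPart Ω J x v w = 0 := by
  constructor
  · rintro ⟨h, -⟩ v w
    have := h v (J x w)
    rw [hJ.sq, map_neg] at this
    rw [skewPart]
    linarith
  · refine fun h => ⟨fun v w => ?_, ht x⟩
    have := h v (J x w)
    rw [skewPart, hJ.sq, map_neg] at this
    linarith

end Extension

/-- An endomorphism which is skew with respect to an inner product and whose square is traceless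
vanishes. -/
theorem eq_zero_of_skew_of_trace_sq {V : Type*} [AddCommGroup V] [Module ℝ V]
    [FiniteDimensional ℝ V] {g : LinearMap.BilinForm ℝ V} (hs : g.IsSymm)
    (hpos : ∀ v, v ≠ 0 → 0 < g v v) {S : V →ₗ[ℝ] V} (hS : ∀ v w, g (S v) w = -g v (S w))
    (htr : LinearMap.trace ℝ V (S ∘ₗ S) = 0) : S = 0 := by
  obtain ⟨b, hb⟩ := LinearMap.BilinForm.exists_orthogonal_basis ⟨hs.eq⟩
  have hrepr : ∀ v i, b.repr v i = g (b i) v / g (b i) (b i) := by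
    intro v i
    rw [eq_div_iff (hpos _ (b.ne_zero i)).ne']
    conv_rhs => rw [← b.sum_repr v]
    rw [map_sum, Finset.sum_eq_single i]
    · rw [map_smul, smul_eq_mul]
    · intro j _ hj
      rw [map_smul, smul_eq_mul, hb hj.symm, mul_zero]
    · simp
  rw [LinearMap.trace_eq_matrix_trace ℝ b, Matrix.trace] at htr
  have hnn : ∀ v, 0 ≤ g v v := fun v => by
    rcases eq_or_ne v 0 with rfl | h
    · simp
    · exact (hpos v h).le
  -- In an orthogonal basis, minus the trace of `S²` is the sum of the nonnegative terms `g(S bᵢ, S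
  -- bᵢ) / g(bᵢ, bᵢ)`.
  have hterm : ∀ i, Matrix.diag (LinearMap.toMatrix b b (S ∘ₗ S)) i =
      -(g (S (b i)) (S (b i)) / g (b i) (b i)) := by
    intro i
    rw [Matrix.diag_apply, LinearMap.toMatrix_apply, hrepr, LinearMap.comp_apply, hS, neg_div, neg_neg]
  simp only [hterm, Finset.sum_neg_distrib, neg_eq_zero] at htr
  rw [Finset.sum_eq_zero_iff_of_nonneg fun i _ => div_nonneg (hnn _) (hnn _)] at htr
  refine b.ext fun i => ?_
  have h := htr i (Finset.mem_univ i)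
  rw [div_eq_zero_iff, or_iff_left (hpos _ (b.ne_zero i)).ne'] at h
  rw [LinearMap.zero_apply]
  by_contra hne
  exact (hpos _ hne).ne' h

/-! ### The angle function. -/

section Angle

variable {M : Type*} [TopologicalSpace M] [ChartedSpace (EuclideanSpace ℝ (Fin 4)) M]
  [IsManifold (𝓡 4) ∞ M] {Ω : SymplecticForm 4 M} {J : EndField 4 M}

theorem angle_eq_of_eq_neg_adj (hJ : IsAlmostComplex J) {x : M} (h : J x = -Ω.adj J x) :
    angle Ω J x = -1 := by
  have h1 : ((J x ∘L Ω.adj J x : TangentSpace (𝓡 4) x →L[ℝ] TangentSpace (𝓡 4) x) :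
      TangentSpace (𝓡 4) x →ₗ[ℝ] TangentSpace (𝓡 4) x) = LinearMap.id := by
    refine LinearMap.ext fun v => ?_
    have h2 : Ω.adj J x v = -J x v := by
      have := congrArg (fun L => L v) h
      rw [neg_apply] at this
      rw [this, neg_neg]
    change J x (Ω.adj J x v) = v
    rw [h2, map_neg, hJ.sq, neg_neg]
  have h3 : Module.finrank ℝ (TangentSpace (𝓡 4) x) = 4 := finrank_euclideanSpace_fin
  rw [angle, h1, LinearMap.trace_id, h3]
  norm_num

/-- Put `A = J` and `B = J^{*ω}`. The form `ω(·, (A - B)·)` is symmetric with `g(v, v) = 2 ω(v, J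
v)`, so it is an inner product, and `A + B` is skew for it. The trace of `(A + B)²` is `-4 - 4 + 2
tr(AB)`, which is zero exactly when the angle is `-1`. -/
theorem eq_neg_adj_of_angle_eq (hJ : IsAlmostComplex J) (ht : IsTamed Ω J) {x : M}
    (h : angle Ω J x = -1) : J x = -Ω.adj J x := by
  let A : TangentSpace (𝓡 4) x →ₗ[ℝ] TangentSpace (𝓡 4) x := (J x).toLinearMap
  let B : TangentSpace (𝓡 4) x →ₗ[ℝ] TangentSpace (𝓡 4) x := (Ω.adj J x).toLinearMap
  have hA : ∀ v, A (A v) = -v := hJ.sq x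
  have hAB : ∀ v w, Ω.form x (A v) w = Ω.form x v (B w) := Ω.form_adj J x
  have hBA : ∀ v w, Ω.form x (B v) w = Ω.form x v (A w) := fun v w => by
    rw [Ω.antisymm, ← hAB, ← Ω.antisymm]
  have hB : ∀ v, B (B v) = -v := fun v => by
    refine sub_eq_zero.1 (Ω.nondegenerate x _ fun w => ?_)
    rw [map_sub, sub_apply, hBA, hBA, hA, map_neg, map_neg, neg_apply, sub_self]
  let g : LinearMap.BilinForm ℝ (TangentSpace (𝓡 4) x) := (Ω.bilin x).compRight (A - B)
  have hg : ∀ v w, g v w = Ω.form x v (A w) - Ω.form x v (B w) := fun v w => by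
    change Ω.form x v (A w - B w) = _
    rw [map_sub]
  have hS : A + B = 0 := by
    refine eq_zero_of_skew_of_trace_sq (g := g) ⟨fun v w => ?_⟩ (fun v hv => ?_) (fun v w => ?_) ?_
    · rw [hg, hg, ← hAB, ← hBA, Ω.antisymm x (A v), Ω.antisymm x (B v)]
      ring
    · rw [hg, ← hAB, Ω.antisymm x (A v)]
      have := ht x v hv
      change 0 < Ω.form x v (J x v) - -Ω.form x v (J x v)
      linarith
    · rw [hg, hg, LinearMap.add_apply, LinearMap.add_apply, map_add (Ω.form x), add_apply,
        add_apply, hAB, hBA, hAB, hBA, map_add A, map_add B, hA, hB]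
      simp only [map_add, map_neg]
      ring
    · have h1 : LinearMap.trace ℝ _ (A ∘ₗ B) = 4 := by
        have h2 : -(1 / 4) * LinearMap.trace ℝ _ (A ∘ₗ B) = -1 := h
        linarith
      have h2 : LinearMap.trace ℝ _ (B ∘ₗ A) = 4 := by
        rw [LinearMap.trace_comp_comm', h1]
      have h3 : A ∘ₗ A = -LinearMap.id := LinearMap.ext hA
      have h4 : B ∘ₗ B = -LinearMap.id := LinearMap.ext hB
      have h5 : Module.finrank ℝ (TangentSpace (𝓡 4) x) = 4 := finrank_euclideanSpace_fin
      rw [LinearMap.add_comp, LinearMap.comp_add, LinearMap.comp_add, map_add, map_add, map_add, h1,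
        h2, h3, h4, map_neg, LinearMap.trace_id, h5]
      norm_num
  refine ContinuousLinearMap.ext fun v => ?_
  exact eq_neg_of_add_eq_zero_left (LinearMap.congr_fun hS v)

end Angle

/-! ### The compatibility locus. -/

section Main

variable {M : Type*} [TopologicalSpace M] [ChartedSpace (EuclideanSpace ℝ (Fin 4)) M]
  [MulAction (Torus 2) M] [IsManifold (𝓡 4) ∞ M] [T2Space M] [CompactSpace M] [ConnectedSpace M]
  {Ω : SymplecticForm 4 M} {μ : M → Fin 2 → ℝ}
  (hμ : IsHamiltonianToric Ω μ) {J : EndField 4 M} (hJ : J ∈ DGK Ω μ)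
include hμ hJ

/-- Both sides make sense and are continuous on all of `M`, although the frame degenerates off `R`.
The identity therefore extends from the dense set `R`. -/
theorem exists_skewPart_eq : ∃ c : ℝ,
    (∀ x v w, skewPart Ω J x v w = -c * momentWedge Ω J x v w) ∧
      ∀ x ∈ regularSet 4 2 M, gramMatrix (m := 2) Ω J x 0 1 - gramMatrix (m := 2) Ω J x 1 0 =
        c * (gramMatrix (m := 2) Ω J x).det := by
  have hreg := openPart_eq_regularSet hμ hJ.1
  have hdense := dense_regularSet hμ hJ.1.1.sq hJ.1.2.2.1 (by norm_num)
  obtain ⟨c, hc⟩ := exists_gramMatrix_ratio hμ hJ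
  refine ⟨c, fun x v w => ?_, hc⟩
  obtain ⟨X, hX, rfl⟩ := exists_smoothVFieldAt_eq x v
  obtain ⟨Y, hY, rfl⟩ := exists_smoothVFieldAt_eq x w
  have hJX := hX.endField_apply hJ.1.1.smooth
  have hJY := hY.endField_apply hJ.1.1.smooth
  have hK : ∀ i : Fin 2, SmoothVFieldAt (infAction (n := 4) (Pi.single i (1 : ℝ))) x :=
    fun i => smoothVFieldAt_infAction hμ.smooth_action _ x
  have hs : ContinuousAt (fun y => skewPart Ω J y (X y) (Y y)) x :=
    (contMDiffAt_form Ω hX hJY).continuousAt.add (contMDiffAt_form Ω hJX hY).continuousAt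
  have hk : ∀ (i : Fin 2) {Z : VField 4 M}, SmoothVFieldAt Z x →
      ContinuousAt (fun y => Ω.form y (infAction (Pi.single i (1 : ℝ)) y) (Z y)) x :=
    fun i Z hZ => (contMDiffAt_form Ω (hK i) hZ).continuousAt
  have hw : ContinuousAt (fun y => -c * momentWedge Ω J y (X y) (Y y)) x :=
    continuousAt_const.mul (((((hk 0 hX).mul (hk 1 hY)).sub ((hk 0 hY).mul (hk 1 hX)))).sub
      (((hk 0 hJX).mul (hk 1 hJY)).sub ((hk 0 hJY).mul (hk 1 hJX))))
  have hne : (𝓝[regularSet 4 2 M] x).NeBot := mem_closure_iff_nhdsWithin_neBot.1 (hdense x)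
  refine tendsto_nhds_unique_of_eventuallyEq (l := 𝓝[regularSet 4 2 M] x)
    (hs.mono_left nhdsWithin_le_nhds) (hw.mono_left nhdsWithin_le_nhds) ?_
  filter_upwards [self_mem_nhdsWithin] with y hy
  exact skewPart_eq_of_mem hμ hJ (hreg ▸ hy) hy (hc y hy) _ _

/-- Off `R` the two generators are linearly dependent, hence so are their contractions with `ω`, and
both wedge products vanish. -/
theorem momentWedge_eq_zero {x : M} (hx : x ∉ regularSet 4 2 M) (v w : TangentSpace (𝓡 4) x) :
    momentWedge Ω J x v w = 0 := by
  simp only [regularSet, mem_ofPred_eq, not_forall] at hx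
  obtain ⟨ξ, hξ, hξ0⟩ := hx
  have h : ∀ u, ξ 0 * Ω.form x (infAction (Pi.single (0 : Fin 2) (1 : ℝ)) x) u +
      ξ 1 * Ω.form x (infAction (Pi.single (1 : Fin 2) (1 : ℝ)) x) u = 0 := by
    intro u
    have h1 := congrArg (fun k => Ω.form x k u) hξ
    simp only [infAction_eq_add hμ ξ, map_add, map_smul, add_apply, smul_apply, smul_eq_mul,
      map_zero, zero_apply] at h1
    exact h1
  have hdet : ∀ u u', Ω.form x (infAction (Pi.single (0 : Fin 2) (1 : ℝ)) x) u *
      Ω.form x (infAction (Pi.single (1 : Fin 2) (1 : ℝ)) x) u' -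
      Ω.form x (infAction (Pi.single (0 : Fin 2) (1 : ℝ)) x) u' *
      Ω.form x (infAction (Pi.single (1 : Fin 2) (1 : ℝ)) x) u = 0 := by
    intro u u'
    have h1 := h u
    have h2 := h u'
    by_cases h0 : ξ 0 = 0
    · have h3 : ξ 1 ≠ 0 := fun h3 => hξ0 (by ext i; fin_cases i <;> simpa)
      refine (mul_eq_zero.1 (?_ : ξ 1 * _ = 0)).resolve_left h3
      linear_combination Ω.form x (infAction (Pi.single (0 : Fin 2) (1 : ℝ)) x) u * h2 -
        Ω.form x (infAction (Pi.single (0 : Fin 2) (1 : ℝ)) x) u' * h1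
    · refine (mul_eq_zero.1 (?_ : ξ 0 * _ = 0)).resolve_left h0
      linear_combination Ω.form x (infAction (Pi.single (1 : Fin 2) (1 : ℝ)) x) u' * h1 -
        Ω.form x (infAction (Pi.single (1 : Fin 2) (1 : ℝ)) x) u * h2
  rw [momentWedge, hdet, hdet, sub_zero]

/-- Unless `J` is compatible with `ω` everywhere, it is so exactly over the boundary of the moment
polytope. -/
theorem notMem_openPart_iff (hK : J ∉ Kahler 2 Ω) (x : M) :
    x ∉ openPart μ ↔ ∀ v w, skewPart Ω J x v w = 0 := by
  rw [openPart_eq_regularSet hμ hJ.1]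
  obtain ⟨c, hc, hc'⟩ := exists_skewPart_eq hμ hJ
  have hc0 : c ≠ 0 := by
    rintro rfl
    refine hK ⟨hJ.1.1, fun y => ?_, hJ.1.2.2.1, hJ.1.2.2.2.1⟩
    exact (isCompatibleAt_iff hJ.1.1 hJ.1.2.1 y).2 fun v w => by rw [hc]; simp
  constructor
  · intro hx v w
    rw [hc, momentWedge_eq_zero hμ hJ hx, mul_zero]
  · intro h hx
    -- On the two generators the defect is `G 0 1 - G 1 0 = c det G`, and at a regular point the
    -- determinant is nonzero.
    have h1 := h (infAction (Pi.single (0 : Fin 2) (1 : ℝ)) x)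
      (infAction (Pi.single (1 : Fin 2) (1 : ℝ)) x)
    have h2 := hc' x hx
    rw [skewPart, Ω.antisymm x (J x _)] at h1
    have h3 : c * (gramMatrix (m := 2) Ω J x).det = 0 := by
      rw [← h2, ← h1]
      rfl
    exact (mul_ne_zero hc0 ((mem_regularSet_iff hμ hJ.1 x).1 hx)) h3

end Main

end ToricGK

end

theorem proposition6p5 {M : Type*} [TopologicalSpace M] [T2Space M] [CompactSpace M]
    [ConnectedSpace M] [ChartedSpace (EuclideanSpace ℝ (Fin 4)) M] [IsManifold (𝓡 4) ∞ M]
    [MulAction (ToricGK.Torus 2) M] (Ω : ToricGK.SymplecticForm 4 M) (μ : M → Fin 2 → ℝ)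
    (hμ : ToricGK.IsHamiltonianToric Ω μ) (J : ToricGK.EndField 4 M)
    (hJ : J ∈ ToricGK.DGK Ω μ \ ToricGK.Kahler 2 Ω) :
    (ToricGK.openPart μ)ᶜ = {x : M | ToricGK.IsCompatibleAt Ω J x} ∧
    (ToricGK.openPart μ)ᶜ = {x : M | J x = -Ω.adj J x} ∧
    (ToricGK.openPart μ)ᶜ = {x : M | ToricGK.angle Ω J x = -1} := by
  have h := ToricGK.notMem_openPart_iff hμ hJ.1 hJ.2
  refine ⟨Set.ext fun x => (h x).trans ?_, Set.ext fun x => (h x).trans ?_,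
    Set.ext fun x => (h x).trans ?_⟩
  · exact (ToricGK.isCompatibleAt_iff hJ.1.1.1 hJ.1.1.2.1 x).symm
  · exact ToricGK.skewPart_eq_zero_iff_adj Ω J x
  · rw [ToricGK.skewPart_eq_zero_iff_adj]
    exact ⟨ToricGK.angle_eq_of_eq_neg_adj hJ.1.1.1,
      ToricGK.eq_neg_adj_of_angle_eq hJ.1.1.1 hJ.1.1.2.1⟩
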